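/- Let $2<p<6$ and $2<q<4$. For an integer $N\ge 1$ let $S_N$ be the star graph consisting of $N$ half-lines $[0,+\infty)$ glued together at their origins (the vertex $0$), and let $H^1(S_N)$ be the space of complex-valued functions $u=(u_1,\dots,u_N)$ on $S_N$, with $u_i\in H^1(0,+\infty)$ for every $i$, that are continuous at the vertex, i.e. $u_1(0)=\dots=u_N(0)=:u(0)$. For $\mu>0$ put $H^1_\mu(S_N)=\{u\in H^1(S_N):\int_{S_N}|u|^2\,dx=\mu\}$, $$F_{p,q}(u,S_N)=\frac12\int_{S_N}|u'|^2\,dx-\frac1p\int_{S_N}|u|^p\,dx-\frac1q|u(0)|^q,\qquad \mathcal F_{p,q}(\mu)=\inf_{v\in H^1_\mu(S_N)}F_{p,q}(v,S_N).$$ A ground state at mass $\mu$ is a function $u\in H^1_\mu(S_N)$ with $F_{p,q}(u,S_N)=\mathcal F_{p,q}(\mu)$. 1. If $q<\frac p2+1$, then for every $N\ge3$ there exists $\mu^*(p,q,N)>0$ such that there is a ground state at mass $\mu$ for every $0<\mu\le\mu^*(p,q,N)$, and $\mathcal F_{p,q}(\mu)$ is not attained for any $\mu>\mu^*(p,q,N)$.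 2. If $q>\frac p2+1$, then for every $N\ge3$ there exists $\mu^*(p,q,N)>0$ such that $\mathcal F_{p,q}(\mu)$ is not attained for any $0<\mu<\mu^*(p,q,N)$, and there is a ground state at mass $\mu$ for every $\mu\ge\mu^*(p,q,N)$. 3. If $q=\frac p2+1$, then there exists an integer $N^*(p)\ge3$ such that, for every $N\ge 1$: if $N\le N^*(p)$, then for every $\mu>0$ there is a ground state at mass $\mu$; if $N>N^*(p)$, then for no $\mu>0$ is there a ground state at mass $\mu$. -/

import Mathlib

open MeasureTheory Set
open scoped ContDiff

noncomputable section

/-- `g` is a weak derivative of `f` on the open set `Ω ⊆ ℝ`: both are locally integrable on `Ω`, and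
`∫_Ω φ' f = - ∫_Ω φ g` for every smooth `φ` with compact support contained in `Ω`. -/
def HasWeakDerivOn (f g : ℝ → ℂ) (Ω : Set ℝ) : Prop :=
  LocallyIntegrableOn f Ω ∧ LocallyIntegrableOn g Ω ∧
    ∀ φ : ℝ → ℝ, ContDiff ℝ ∞ φ → HasCompactSupport φ → tsupport φ ⊆ Ω →
      ∫ x in Ω, deriv φ x • f x = -∫ x in Ω, φ x • g x

/-- The weak derivative on an open set is unique up to null sets. -/
theorem HasWeakDerivOn.ae_eq {f g₁ g₂ : ℝ → ℂ} {Ω : Set ℝ} (hΩ : IsOpen Ω)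
    (h₁ : HasWeakDerivOn f g₁ Ω) (h₂ : HasWeakDerivOn f g₂ Ω) :
    ∀ᵐ x ∂(volume.restrict Ω), g₁ x = g₂ x := by
  have key : ∀ᵐ x ∂(volume : Measure ℝ), x ∈ Ω → (g₁ - g₂) x = 0 := by
    refine hΩ.ae_eq_zero_of_integral_contDiff_smul_eq_zero (h₁.2.1.sub h₂.2.1) ?_
    intro φ hφ hc hs
    have aux : ∀ g : ℝ → ℂ, LocallyIntegrableOn g Ω → Integrable (fun x => φ x • g x) := by
      intro g hg
      have hK : IntegrableOn g (tsupport φ) := hg.integrableOn_compact_subset hs hc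
      have h3 : IntegrableOn (fun x => φ x • g x) (tsupport φ) :=
        hK.continuousOn_smul hφ.continuous.continuousOn hc
      refine (integrableOn_iff_integrable_of_support_subset ?_).1 h3
      intro x hx
      refine subset_tsupport φ ?_
      intro h0
      exact hx (by simp [h0])
    have whole : ∀ g : ℝ → ℂ, ∫ x in Ω, φ x • g x = ∫ x, φ x • g x := by
      intro g
      refine setIntegral_eq_integral_of_forall_compl_eq_zero ?_
      intro x hx
      rw [image_eq_zero_of_notMem_tsupport (fun h => hx (hs h)), zero_smul]
    have e := (h₁.2.2 φ hφ hc hs).symm.trans (h₂.2.2 φ hφ hc hs)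
    rw [whole, whole, neg_inj] at e
    simp only [Pi.sub_apply, smul_sub]
    rw [integral_sub (aux g₁ h₁.2.1) (aux g₂ h₂.2.1), e, sub_self]
  rw [ae_restrict_iff' hΩ.measurableSet]
  filter_upwards [key] with x hx hxΩ
  exact sub_eq_zero.1 (hx hxΩ)

/-- An element of `H¹(S_N)`, where `S_N` is the star graph made of `N` half-lines `[0, +∞)` glued
together at their origins (the vertex). It is given by its components on the half-lines, each of
them being in `H¹(0, +∞)` and represented by its continuous representative on `[0, +∞)`, together
with their weak derivatives and the common value of the components at the vertex.
The weak derivatives are determined by the components up to null sets. Only the values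
of `toFun i` on `[0, +∞)` and of `weakDeriv i` on `(0, +∞)` are relevant. -/
structure StarH1 (N : ℕ) where
  /-- the components `u_i` on the half-lines -/
  toFun : Fin N → ℝ → ℂ
  /-- the weak derivatives `u_i'` of the components -/
  weakDeriv : Fin N → ℝ → ℂ
  /-- the value of `u` at the vertex -/
  vertexValue : ℂ
  continuousOn : ∀ i, ContinuousOn (toFun i) (Ici 0)
  toFun_zero : ∀ i, toFun i 0 = vertexValue
  memLp : ∀ i, MemLp (toFun i) 2 (volume.restrict (Ioi 0))
  memLp_weakDeriv : ∀ i, MemLp (weakDeriv i) 2 (volume.restrict (Ioi 0))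
  hasWeakDerivOn : ∀ i, HasWeakDerivOn (toFun i) (weakDeriv i) (Ioi 0)

namespace StarH1

variable {N : ℕ}

/-- The mass `∫_{S_N} |u|² dx`. -/
def mass (u : StarH1 N) : ℝ :=
  ∑ i, ∫ x in Ioi (0 : ℝ), ‖u.toFun i x‖ ^ 2

/-- The energy with standard nonlinearity of power `p` and pointwise nonlinearity of power `q`
at the vertex `0` of the star graph,
`F_{p,q}(u, S_N) = ½ ∫ |u'|² dx - (1/p) ∫ |u|^p dx - (1/q) |u(0)|^q`. -/
def energy (p q : ℝ) (u : StarH1 N) : ℝ :=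
  1 / 2 * (∑ i, ∫ x in Ioi (0 : ℝ), ‖u.weakDeriv i x‖ ^ 2)
    - 1 / p * (∑ i, ∫ x in Ioi (0 : ℝ), ‖u.toFun i x‖ ^ p)
    - 1 / q * ‖u.vertexValue‖ ^ q

end StarH1

/-- The ground state energy level `inf { F_{p,q}(v, S_N) : v ∈ H¹_μ(S_N) }`, an extended real. -/
def groundLevel (p q : ℝ) (N : ℕ) (μ : ℝ) : EReal :=
  ⨅ v : {v : StarH1 N // v.mass = μ}, ((v.1.energy p q : ℝ) : EReal)

/-- `u` is a ground state of `F_{p,q}(·, S_N)` at mass `μ`: it belongs to `H¹_μ(S_N)` and its energy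
attains the infimum. -/
def IsGroundState (p q : ℝ) {N : ℕ} (μ : ℝ) (u : StarH1 N) : Prop :=
  u.mass = μ ∧ ((u.energy p q : ℝ) : EReal) = groundLevel p q N μ

end

/-!
Everything rests on a calibration. For a height `M`, let `W_M(t) = (M ^ (p - 2) t² - t ^ p) / p`,
which is nonnegative on `[0, M]`, and let `Φ_M = ∫ √(2 W_M)` (`calibration`). If `|u| ≤ M`, then
`½ |u'|² + W_M(|u|) ≥ |(Φ_M ∘ |u|)'|`, with equality along the soliton of height `M`. Integrating
over the half-lines bounds the energy of `u` from below by a function `reducedEnergy` of `M`, of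
the value `a = |u(0)|` and of the maximum `b` (`StarH1.reducedEnergy_le_energy`). The height `M ≥ b`
is free. The functions for which the bound is attained with `a = b` are the stars of tails: the same
decreasing piece of a soliton on every half-line, glued at the height `s` (`IsTailPair`).

Let `lineLevel` be the energy of the soliton of mass `μ` on the line. A suitable choice of `M` shows
that a function with less energy than `lineLevel`, or equal energy, has at least the energy of some
star of tails of the same mass (`StarH1.lineLevel_lt_energy_or_exists_isTailPair`). For `N ≥ 2`, a
soliton can escape to infinity along a half-line, so the infimum is at most `lineLevel`. Stars of
tails form a one-parameter family, indexed by the ratio `r = s / M` in `(0, 1]`, and for `q < 4`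
their energy becomes positive as `r` tends to `0`. Hence the minimum over the family exists whenever
some member does not exceed `lineLevel`, and for `N ≥ 2` there is a ground state if and only if some
star of tails does not exceed `lineLevel` (`exists_isGroundState_iff`). No compactness of minimising
sequences is needed.

By scaling, the condition for the ratio `r` reads
`σ ^ (p / 2 + 1) A(r) - σ ^ q B(r) ≤ σ ^ (p / 2 + 1) ℓ`, where `σ` is a positive power of the mass
up to a constant, `A` and `B` are the bulk and vertex parts of the energy of the star of tails at unit
scale, and `ℓ` is `lineLevel` there. So ground states exist exactly when
`σ ^ (q - (p / 2 + 1)) ≥ min (A - ℓ) / B`. For `N ≥ 3` this minimum is positive and attained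
(`exists_threshold`), which gives the mass thresholds in the two cases with `q ≠ p / 2 + 1`.

If `q = p / 2 + 1`, the scale drops out. There is a distinguished ratio `r_N` (`criticalRatio`) at
which the vertex term cancels the boundary terms of the tails. Comparing any star of tails with the
calibration of height `s / r_N`, which may differ from its own height, turns the criterion into
`N τ(r_N) ≤ 2 τ(1)`, where `τ` is the normalised mass of a tail (`tailMass`). The left-hand side
increases without bound in `N`, so the set of admissible `N` is an initial segment. That it contains
`3` amounts, after the substitution `r ^ (p - 2) = cos² φ`, to an inequality for incomplete
integrals of powers of the cosine with exponent `k = 4 / (p - 2) - 1` (`integral_cos_rpow_le`). It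
is proved by comparison with the exponents `1` and `3` if `k ≥ 1`, and by Bernoulli's inequality if
`k < 1`; the case `k = 0` would be an equality.
-/

open Filter Topology

/-! ### Absolute continuity of Sobolev functions on the half-line -/

/-- The primitive of an integrable function with values in a Banach space is absolutely
continuous. -/
theorem IntervalIntegrable.absolutelyContinuousOnInterval_primitive
    {E : Type*} [NormedAddCommGroup E] [NormedSpace ℝ E] {g : ℝ → E} {a b c : ℝ}
    (hg : IntervalIntegrable g volume a b) (hc : c ∈ uIcc a b) :
    AbsolutelyContinuousOnInterval (fun x => ∫ t in c..x, g t) a b := by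
  have hn := hg.norm.absolutelyContinuousOnInterval_intervalIntegral hc
  unfold AbsolutelyContinuousOnInterval at hn ⊢
  refine squeeze_zero' (Eventually.of_forall fun t => Finset.sum_nonneg fun i _ => dist_nonneg) ?_
    hn
  rw [eventually_inf_principal]
  filter_upwards with E hE
  refine Finset.sum_le_sum fun i hi => ?_
  have h₁ := (hE.1 i hi).1
  have h₂ := (hE.1 i hi).2
  rw [dist_comm, dist_comm (∫ t in c..(E.2 i).1, ‖g t‖), dist_eq_norm, Real.dist_eq,
    intervalIntegral.integral_interval_sub_left (hg.mono_set (uIcc_subset_uIcc hc h₂))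
      (hg.mono_set (uIcc_subset_uIcc hc h₁)),
    intervalIntegral.integral_interval_sub_left (hg.norm.mono_set (uIcc_subset_uIcc hc h₂))
      (hg.norm.mono_set (uIcc_subset_uIcc hc h₁))]
  exact intervalIntegral.norm_integral_le_abs_integral_norm

/-- The fundamental theorem of calculus for an absolutely continuous function with values in a
Banach space whose derivative is known almost everywhere. -/
theorem AbsolutelyContinuousOnInterval.integral_eq_sub_of_ae_hasDerivAt
    {E : Type*} [NormedAddCommGroup E] [NormedSpace ℝ E] [CompleteSpace E] {f g : ℝ → E} {a b : ℝ}
    (hf : AbsolutelyContinuousOnInterval f a b) (hg : IntervalIntegrable g volume a b)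
    (h : ∀ᵐ x, x ∈ uIcc a b → HasDerivAt f (g x) x) :
    ∫ x in a..b, g x = f b - f a := by
  have hac : AbsolutelyContinuousOnInterval (fun x => f x - ∫ t in a..x, g t) a b :=
    hf.fun_sub (hg.absolutelyContinuousOnInterval_primitive (c := a) left_mem_uIcc)
  obtain ⟨C, hC⟩ := hac.const_of_ae_hasDerivAt_zero (by
    filter_upwards [h, hg.ae_hasDerivAt_integral] with x hx₁ hx₂ hx₃
    have h' := (hx₁ hx₃).sub (hx₂ hx₃ a (by simp))
    rwa [sub_self] at h')
  have h₁ := hC a (by simp)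
  have h₂ := hC b (by simp)
  simp only [intervalIntegral.integral_same, sub_zero] at h₁
  rw [h₁, ← h₂]
  simp

/-- The composition of a Lipschitz function with an absolutely continuous one. -/
theorem LipschitzWith.comp_absolutelyContinuousOnInterval {X Y : Type*} [PseudoMetricSpace X]
    [PseudoMetricSpace Y] {K : NNReal} {Λ : X → Y} (hΛ : LipschitzWith K Λ) {f : ℝ → X} {a b : ℝ}
    (hf : AbsolutelyContinuousOnInterval f a b) :
    AbsolutelyContinuousOnInterval (fun x => Λ (f x)) a b := by
  unfold AbsolutelyContinuousOnInterval at hf ⊢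
  refine squeeze_zero (fun t => Finset.sum_nonneg fun i _ => dist_nonneg) (fun t => ?_)
    (by simpa using hf.const_mul (K : ℝ))
  rw [Finset.mul_sum]
  exact Finset.sum_le_sum fun i _ => hΛ.dist_le_mul _ _

/-- The composition of an absolutely continuous function with a function that is Lipschitz on a
set containing its values. -/
theorem LipschitzOnWith.comp_absolutelyContinuousOnInterval {X Y : Type*} [PseudoMetricSpace X]
    [PseudoMetricSpace Y] {K : NNReal} {Λ : X → Y} {s : Set X} (hΛ : LipschitzOnWith K Λ s)
    {f : ℝ → X} {a b : ℝ} (hs : ∀ x ∈ uIcc a b, f x ∈ s)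
    (hf : AbsolutelyContinuousOnInterval f a b) :
    AbsolutelyContinuousOnInterval (fun x => Λ (f x)) a b := by
  unfold AbsolutelyContinuousOnInterval at hf ⊢
  refine squeeze_zero' (Eventually.of_forall fun t => Finset.sum_nonneg fun i _ => dist_nonneg) ?_
    (by simpa using hf.const_mul (K : ℝ))
  rw [eventually_inf_principal]
  filter_upwards with E hE
  rw [Finset.mul_sum]
  refine Finset.sum_le_sum fun i hi => ?_
  exact hΛ.dist_le_mul _ (hs _ (hE.1 i hi).1) _ (hs _ (hE.1 i hi).2)

/-- A compact subset of the open half-line lies in a compact interval of it. -/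
theorem IsCompact.exists_subset_Icc_of_subset_Ioi {K : Set ℝ} (hK : IsCompact K)
    (hs : K ⊆ Ioi 0) : ∃ ε R : ℝ, 0 < ε ∧ ε < R ∧ K ⊆ Icc ε R := by
  rcases K.eq_empty_or_nonempty with rfl | hne
  · exact ⟨1, 2, by norm_num, by norm_num, by simp⟩
  obtain ⟨ε, hε, hle⟩ := hK.exists_isLeast hne
  obtain ⟨R, hR, hge⟩ := hK.exists_isGreatest hne
  exact ⟨ε, R + 1, hs hε, by linarith [hle hR], fun x hx => ⟨hle hx, by linarith [hge hx]⟩⟩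

/-- A test function on the open half-line with vanishing integral is the derivative of a test
function. -/
theorem exists_testFunction_deriv_eq {η : ℝ → ℝ} (hη : ContDiff ℝ ∞ η)
    (hc : HasCompactSupport η) (hs : tsupport η ⊆ Ioi 0) (h0 : ∫ x, η x = 0) :
    ∃ φ : ℝ → ℝ, ContDiff ℝ ∞ φ ∧ HasCompactSupport φ ∧ tsupport φ ⊆ Ioi 0 ∧ deriv φ = η := by
  obtain ⟨ε, R, hε, hεR, hK⟩ := IsCompact.exists_subset_Icc_of_subset_Ioi hc hs
  have hz : ∀ x, x ∉ Icc ε R → η x = 0 := fun x hx =>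
    image_eq_zero_of_notMem_tsupport fun h => hx (hK h)
  have hd : ∀ x, HasDerivAt (fun y => ∫ t in (0 : ℝ)..y, η t) (η x) x := fun x =>
    intervalIntegral.integral_hasDerivAt_right (hη.continuous.intervalIntegrable _ _)
      hη.continuous.stronglyMeasurable.stronglyMeasurableAtFilter hη.continuous.continuousAt
  have hderiv : deriv (fun y => ∫ t in (0 : ℝ)..y, η t) = η := funext fun x => (hd x).deriv
  have hsupp : Function.support (fun y => ∫ t in (0 : ℝ)..y, η t) ⊆ Icc ε R := by
    intro y hy
    by_contra hn
    apply hy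
    rcases lt_or_ge y ε with h | h
    · refine intervalIntegral.integral_zero_ae (Eventually.of_forall fun t ht => hz t fun ht' => ?_)
      rcases le_total 0 y with h' | h'
      · rw [uIoc_of_le h'] at ht
        linarith [ht.2, ht'.1]
      · rw [uIoc_of_ge h'] at ht
        linarith [ht.2, ht'.1]
    · have hyR : R < y := by
        by_contra h'
        exact hn ⟨h, not_lt.1 h'⟩
      change ∫ t in (0 : ℝ)..y, η t = 0
      rw [intervalIntegral.integral_of_le (by linarith), ← h0]
      refine setIntegral_eq_integral_of_forall_compl_eq_zero fun t ht => hz t fun ht' => ht ?_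
      exact ⟨by linarith [ht'.1], by linarith [ht'.2]⟩
  have hts : tsupport (fun y => ∫ t in (0 : ℝ)..y, η t) ⊆ Icc ε R :=
    closure_minimal hsupp isClosed_Icc
  refine ⟨fun y => ∫ t in (0 : ℝ)..y, η t, ?_, ?_, ?_, hderiv⟩
  · refine contDiff_infty_iff_deriv.2 ⟨fun x => (hd x).differentiableAt, ?_⟩
    rw [hderiv]
    exact hη
  · exact isCompact_Icc.of_isClosed_subset (isClosed_tsupport _) hts
  · exact hts.trans fun x hx => lt_of_lt_of_le hε hx.1

theorem integrableOn_testFunction_smul {h : ℝ → ℂ} (hc : LocallyIntegrableOn h (Ioi 0))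
    {φ : ℝ → ℝ} (hφ : Continuous φ) (hcs : HasCompactSupport φ) (hs : tsupport φ ⊆ Ioi 0) :
    IntegrableOn (fun x => φ x • h x) (Ioi 0) := by
  have h3 : IntegrableOn (fun x => φ x • h x) (tsupport φ) :=
    (hc.integrableOn_compact_subset hs hcs).continuousOn_smul hφ.continuousOn hcs
  refine Integrable.integrableOn ((integrableOn_iff_integrable_of_support_subset ?_).1 h3)
  intro x hx
  refine subset_tsupport φ fun h0 => hx ?_
  simp [h0]

/-- A continuous function on the open half-line which annihilates the derivatives of all test
functions is constant. -/
theorem exists_eq_const_of_integral_deriv_smul_eq_zero {h : ℝ → ℂ} (hc : ContinuousOn h (Ioi 0))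
    (hz : ∀ φ : ℝ → ℝ, ContDiff ℝ ∞ φ → HasCompactSupport φ → tsupport φ ⊆ Ioi 0 →
      ∫ x in Ioi (0 : ℝ), deriv φ x • h x = 0) :
    ∃ C, ∀ x ∈ Ioi (0 : ℝ), h x = C := by
  have hloc : LocallyIntegrableOn h (Ioi 0) := hc.locallyIntegrableOn measurableSet_Ioi
  let B : ContDiffBump (2 : ℝ) := ⟨1 / 2, 1, by norm_num, by norm_num⟩
  let ψ₀ : ℝ → ℝ := B.normed volume
  have hψ₀ : ContDiff ℝ ∞ ψ₀ := B.contDiff_normed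
  have hψ₀c : HasCompactSupport ψ₀ := B.hasCompactSupport_normed
  have hψ₀s : tsupport ψ₀ ⊆ Ioi 0 := by
    rw [B.tsupport_normed_eq, Real.closedBall_eq_Icc]
    intro x hx
    have : (2 : ℝ) - 1 ≤ x := hx.1
    simp only [mem_Ioi]
    linarith
  have hψ₀i : ∫ x, ψ₀ x = 1 := B.integral_normed
  refine ⟨∫ x in Ioi (0 : ℝ), ψ₀ x • h x, ?_⟩
  set C := ∫ x in Ioi (0 : ℝ), ψ₀ x • h x with hC
  have hhC : ContinuousOn (fun x => h x - C) (Ioi 0) := hc.sub continuousOn_const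
  have key : ∀ᵐ x ∂(volume : Measure ℝ), x ∈ Ioi (0 : ℝ) → h x - C = 0 := by
    refine isOpen_Ioi.ae_eq_zero_of_integral_contDiff_smul_eq_zero
      (hhC.locallyIntegrableOn measurableSet_Ioi) ?_
    intro ψ hψ hψc hψs
    have hint : ∫ x in Ioi (0 : ℝ), ψ x = ∫ x, ψ x :=
      setIntegral_eq_integral_of_forall_compl_eq_zero fun x hx =>
        image_eq_zero_of_notMem_tsupport fun h => hx (hψs h)
    have hi₁ := hψ.continuous.integrable_of_hasCompactSupport (μ := volume) hψc
    have hi₀ := hψ₀.continuous.integrable_of_hasCompactSupport (μ := volume) hψ₀c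
    set m := ∫ x, ψ x with hm
    have hts : tsupport (fun x => ψ x - m * ψ₀ x) ⊆ tsupport ψ ∪ tsupport ψ₀ := by
      refine closure_minimal ?_ ((isClosed_tsupport _).union (isClosed_tsupport _))
      intro x hx
      by_contra hn
      rw [mem_union, not_or] at hn
      apply hx
      simp [image_eq_zero_of_notMem_tsupport hn.1, image_eq_zero_of_notMem_tsupport hn.2]
    obtain ⟨φ, hφ, hφc, hφs, hφd⟩ := exists_testFunction_deriv_eq
      (η := fun x => ψ x - m * ψ₀ x) (hψ.sub (contDiff_const.mul hψ₀))
      ((hψc.isCompact.union hψ₀c.isCompact).of_isClosed_subset (isClosed_tsupport _) hts)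
      (hts.trans (union_subset hψs hψ₀s)) (by
        rw [integral_sub hi₁ (hi₀.const_mul m), integral_const_mul, hψ₀i, mul_one, sub_self])
    have h0 := hz φ hφ hφc hφs
    rw [hφd] at h0
    have e : ∀ x, (ψ x - m * ψ₀ x) • h x = ψ x • h x - m • (ψ₀ x • h x) := fun x => by
      rw [sub_smul, mul_smul]
    simp only [e] at h0
    have j₁ := integrableOn_testFunction_smul hloc hψ.continuous hψc hψs
    have j₀ := integrableOn_testFunction_smul hloc hψ₀.continuous hψ₀c hψ₀s
    rw [integral_sub j₁ (by exact j₀.smul m),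
      integral_smul, ← hC] at h0
    have hw : ∫ x, ψ x • (h x - C) = ∫ x in Ioi (0 : ℝ), ψ x • (h x - C) :=
      (setIntegral_eq_integral_of_forall_compl_eq_zero fun x hx => by
        rw [image_eq_zero_of_notMem_tsupport fun h => hx (hψs h), zero_smul]).symm
    rw [hw]
    simp only [smul_sub]
    rw [integral_sub j₁ (hi₁.integrableOn.smul_const C), integral_smul_const, hint]
    exact h0
  have hzero : EqOn (fun x => h x - C) (fun _ => 0) (Ioi 0) := by
    refine Measure.eqOn_open_of_ae_eq (μ := volume) ?_ isOpen_Ioi hhC continuousOn_const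
    rw [Filter.EventuallyEq, ae_restrict_iff' measurableSet_Ioi]
    exact key
  intro x hx
  exact sub_eq_zero.1 (hzero hx)

/-- Continuous representatives are absolutely continuous: a continuous function with a weak
derivative on the open half-line is the primitive of that derivative. -/
theorem HasWeakDerivOn.integral_eq_sub {f g : ℝ → ℂ} (hc : ContinuousOn f (Ici 0))
    (hg : LocallyIntegrable ((Ioi (0 : ℝ)).indicator g)) (hw : HasWeakDerivOn f g (Ioi 0)) {x : ℝ}
    (hx : 0 ≤ x) : ∫ t in (0 : ℝ)..x, (Ioi (0 : ℝ)).indicator g t = f x - f 0 := by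
  set G := (Ioi (0 : ℝ)).indicator g with hG
  set v : ℝ → ℂ := fun x => ∫ t in (0 : ℝ)..x, G t with hv
  have hGi : ∀ a b, IntervalIntegrable G volume a b := fun a b =>
    (hg.integrableOn_isCompact isCompact_uIcc).intervalIntegrable
  have hvc : Continuous v := intervalIntegral.continuous_primitive hGi 0
  obtain ⟨C, hC⟩ := exists_eq_const_of_integral_deriv_smul_eq_zero (h := fun x => f x - v x)
    ((hc.mono Ioi_subset_Ici_self).sub hvc.continuousOn) (by
      intro φ hφ hφc hφs
      obtain ⟨ε, R, hε, hεR, hK⟩ := IsCompact.exists_subset_Icc_of_subset_Ioi hφc hφs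
      have hφd : Continuous (deriv φ) := hφ.continuous_deriv (by norm_num)
      have hφ0 : ∀ y, y ∉ Icc ε R → φ y = 0 := fun y hy =>
        image_eq_zero_of_notMem_tsupport fun h => hy (hK h)
      have hφd0 : ∀ y, y ∉ Icc ε R → deriv φ y = 0 := fun y hy =>
        image_eq_zero_of_notMem_tsupport fun h => hy (hK (tsupport_deriv_subset h))
      have hdc : HasCompactSupport (deriv φ) := hφc.deriv
      have hds : tsupport (deriv φ) ⊆ Ioi 0 := tsupport_deriv_subset.trans hφs
      have hvl : LocallyIntegrableOn v (Ioi 0) := hvc.locallyIntegrable.locallyIntegrableOn _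
      have i₁ := integrableOn_testFunction_smul hw.1 hφd hdc hds
      have i₂ := integrableOn_testFunction_smul hvl hφd hdc hds
      have i₃ := integrableOn_testFunction_smul hw.2.1 hφ.continuous hφc hφs
      have hac : AbsolutelyContinuousOnInterval (fun y => φ y • v y) 0 (R + 1) :=
        (AbsolutelyContinuousOnInterval.fun_smul
          (hφ.contDiffOn.of_le (by norm_num)).absolutelyContinuousOnInterval
          ((hGi 0 (R + 1)).absolutelyContinuousOnInterval_primitive left_mem_uIcc))
      have hparts := hac.integral_eq_sub_of_ae_hasDerivAt
        (g := fun y => φ y • G y + deriv φ y • v y)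
        (((hGi 0 (R + 1)).continuousOn_smul hφ.continuous.continuousOn).add
          ((hφd.smul hvc).intervalIntegrable _ _)) (by
          filter_upwards [_root_.LocallyIntegrable.ae_hasDerivAt_integral hg] with y hy _
          exact ((hφ.differentiable (by norm_num)) y).hasDerivAt.smul (hy 0))
      have hR : φ (R + 1) = 0 := hφ0 _ fun h => by linarith [h.2]
      have h0 : φ 0 = 0 := hφ0 _ fun h => by linarith [h.1]
      rw [hR, h0, zero_smul, zero_smul, sub_zero,
        intervalIntegral.integral_of_le (by linarith)] at hparts
      have hwhole : ∫ y in Ioi (0 : ℝ), (φ y • g y + deriv φ y • v y) = 0 := by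
        rw [← hparts]
        have e : ∀ y ∈ Ioc 0 (R + 1), φ y • G y + deriv φ y • v y
            = φ y • g y + deriv φ y • v y := fun y hy => by
          rw [hG, indicator_of_mem (show y ∈ Ioi (0 : ℝ) from hy.1)]
        rw [setIntegral_congr_fun measurableSet_Ioc e]
        refine setIntegral_eq_of_subset_of_forall_sdiff_eq_zero measurableSet_Ioi
          (fun y hy => hy.1) fun y hy => ?_
        have hy' : y ∉ Icc ε R := fun h =>
          hy.2 ⟨hy.1, by linarith [h.2]⟩
        simp [hφ0 y hy', hφd0 y hy']
      rw [integral_add i₃ i₂] at hwhole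
      simp only [smul_sub]
      rw [integral_sub i₁ i₂, hw.2.2 φ hφ hφc hφs]
      linear_combination -hwhole)
  have hall : EqOn (fun x => f x - v x) (fun _ => C) (Ici 0) := by
    have hcl : Ici (0 : ℝ) ⊆ closure (Ioi 0) := by rw [closure_Ioi]
    exact EqOn.of_subset_closure hC (hc.sub hvc.continuousOn) continuousOn_const
      Ioi_subset_Ici_self hcl
  have h₀ := hall (self_mem_Ici (a := (0 : ℝ)))
  have h₁ := hall hx
  simp only [hv, intervalIntegral.integral_same, sub_zero] at h₀ h₁
  rw [h₀, ← h₁]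
  ring

/-- `f` is the continuous representative of an element of `H¹(0, ∞)`, and `g` its weak
derivative. -/
structure IsHalfLineSobolev (f g : ℝ → ℂ) : Prop where
  continuousOn : ContinuousOn f (Ici 0)
  memLp : MemLp f 2 (volume.restrict (Ioi 0))
  memLp_weakDeriv : MemLp g 2 (volume.restrict (Ioi 0))
  hasWeakDerivOn : HasWeakDerivOn f g (Ioi 0)

theorem StarH1.isHalfLineSobolev {N : ℕ} (u : StarH1 N) (i : Fin N) :
    IsHalfLineSobolev (u.toFun i) (u.weakDeriv i) :=
  ⟨u.continuousOn i, u.memLp i, u.memLp_weakDeriv i, u.hasWeakDerivOn i⟩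

/-- The derivative of the norm of a differentiable function is bounded by the norm of the
derivative. -/
theorem abs_deriv_norm_le {E : Type*} [NormedAddCommGroup E] [NormedSpace ℝ E] {f : ℝ → E} {f' : E}
    {d t : ℝ} (hf : HasDerivAt f f' t) (hd : HasDerivAt (fun s => ‖f s‖) d t) : |d| ≤ ‖f'‖ := by
  have h₁ := (hasDerivAt_iff_tendsto_slope.1 hf).norm
  have h₂ := (hasDerivAt_iff_tendsto_slope.1 hd).norm
  refine le_of_tendsto_of_tendsto' h₂ h₁ fun s => ?_
  simp only [slope, vsub_eq_sub, norm_smul, Real.norm_eq_abs, smul_eq_mul, abs_mul]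
  exact mul_le_mul_of_nonneg_left (abs_norm_sub_norm_le _ _) (abs_nonneg _)

namespace IsHalfLineSobolev

variable {f g : ℝ → ℂ}

theorem memLp_indicator (h : IsHalfLineSobolev f g) : MemLp ((Ioi (0 : ℝ)).indicator g) 2 :=
  (memLp_indicator_iff_restrict measurableSet_Ioi).2 h.memLp_weakDeriv

theorem locallyIntegrable_indicator (h : IsHalfLineSobolev f g) :
    LocallyIntegrable ((Ioi (0 : ℝ)).indicator g) :=
  h.memLp_indicator.locallyIntegrable (by norm_num)

theorem integrableOn_sq (h : IsHalfLineSobolev f g) :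
    IntegrableOn (fun x => ‖f x‖ ^ 2) (Ioi 0) :=
  h.memLp.integrable_norm_pow (by norm_num)

theorem integrableOn_sq_weakDeriv (h : IsHalfLineSobolev f g) :
    IntegrableOn (fun x => ‖g x‖ ^ 2) (Ioi 0) :=
  h.memLp_weakDeriv.integrable_norm_pow (by norm_num)

theorem intervalIntegrable_sq_weakDeriv (h : IsHalfLineSobolev f g) {x y : ℝ} (hx : 0 ≤ x)
    (hxy : x ≤ y) : IntervalIntegrable (fun x => ‖g x‖ ^ 2) volume x y :=
  (intervalIntegrable_iff_integrableOn_Ioc_of_le hxy).2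
    (h.integrableOn_sq_weakDeriv.mono_set fun _ ht => lt_of_le_of_lt hx ht.1)

theorem continuousOn_norm (h : IsHalfLineSobolev f g) : ContinuousOn (fun x => ‖f x‖) (Ici 0) :=
  h.continuousOn.norm

theorem intervalIntegrable_comp (h : IsHalfLineSobolev f g) {w : ℝ → ℝ} (hw : Continuous w)
    {x y : ℝ} (hx : 0 ≤ x) (hxy : x ≤ y) :
    IntervalIntegrable (fun t => w ‖f t‖) volume x y := by
  refine ContinuousOn.intervalIntegrable ?_
  rw [uIcc_of_le hxy]
  exact hw.comp_continuousOn (h.continuousOn_norm.mono fun t ht => hx.trans ht.1)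

/-- The calibration inequality: by Young's inequality, the total variation of `Λ ∘ |f|` is
controlled by the integral of `½ |f'|² + ½ (Λ' ∘ |f|)²`. -/
theorem abs_sub_le_integral (h : IsHalfLineSobolev f g) {Λ l : ℝ → ℝ}
    (hΛ : ∀ t, HasDerivAt Λ (l t) t) (hl : Continuous l) {x y : ℝ} (hx : 0 ≤ x) (hxy : x ≤ y) :
    |Λ ‖f y‖ - Λ ‖f x‖| ≤ ∫ t in x..y, (1 / 2 * ‖g t‖ ^ 2 + 1 / 2 * l ‖f t‖ ^ 2) := by
  set G := (Ioi (0 : ℝ)).indicator g with hG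
  have hGl : LocallyIntegrable G := h.locallyIntegrable_indicator
  set F : ℝ → ℂ := fun t => f 0 + ∫ s in (0 : ℝ)..t, G s with hF
  have hFf : ∀ t, 0 ≤ t → F t = f t := fun t ht => by
    simp only [hF]
    rw [h.hasWeakDerivOn.integral_eq_sub h.continuousOn hGl ht]
    ring
  have hFd : ∀ᵐ t, HasDerivAt F (G t) t := by
    filter_upwards [_root_.LocallyIntegrable.ae_hasDerivAt_integral hGl] with t ht
    exact (ht 0).const_add _
  have hGy : IntervalIntegrable G volume 0 y :=
    (hGl.integrableOn_isCompact isCompact_uIcc).intervalIntegrable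
  have hFac : AbsolutelyContinuousOnInterval F x y := by
    have h₁ := hGy.absolutelyContinuousOnInterval_primitive left_mem_uIcc
    have h₂ : AbsolutelyContinuousOnInterval (fun _ : ℝ => f 0) 0 y :=
      (LipschitzWith.const (f 0)).lipschitzOnWith.absolutelyContinuousOnInterval
    refine (h₂.fun_add h₁).mono ?_
    rw [uIcc_of_le hxy, uIcc_of_le (hx.trans hxy)]
    exact Icc_subset_Icc_left hx
  have hNac : AbsolutelyContinuousOnInterval (fun t => ‖F t‖) x y :=
    lipschitzWith_one_norm.comp_absolutelyContinuousOnInterval hFac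
  obtain ⟨B, hB⟩ := hNac.exists_bound
  have hΛc : ContDiff ℝ 1 Λ := by
    refine contDiff_one_iff_deriv.2 ⟨fun t => (hΛ t).differentiableAt, ?_⟩
    rwa [show deriv Λ = l from funext fun t => (hΛ t).deriv]
  obtain ⟨K, hK⟩ := hΛc.contDiffOn.exists_lipschitzOnWith (s := Icc (-B) B) (by simp)
    (convex_Icc _ _) isCompact_Icc
  have hHac : AbsolutelyContinuousOnInterval (fun t => Λ ‖F t‖) x y :=
    hK.comp_absolutelyContinuousOnInterval (fun t ht => abs_le.1 (hB t ht)) hNac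
  have hint : IntervalIntegrable (fun t => 1 / 2 * ‖g t‖ ^ 2 + 1 / 2 * l ‖f t‖ ^ 2) volume x y :=
    ((h.intervalIntegrable_sq_weakDeriv hx hxy).const_mul _).add
      ((h.intervalIntegrable_comp (hl.pow 2) hx hxy).const_mul _)
  rw [← hFf y (hx.trans hxy), ← hFf x hx, ← hHac.integral_deriv_eq_sub]
  refine (intervalIntegral.abs_integral_le_integral_abs hxy).trans ?_
  refine intervalIntegral.integral_mono_ae_restrict hxy hHac.intervalIntegrable_deriv.abs hint ?_
  have h0 : ∀ᵐ t : ℝ, t ≠ 0 := by simp [ae_iff]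
  rw [Filter.EventuallyLE, ae_restrict_iff' measurableSet_Icc]
  filter_upwards [hFd, hNac.ae_differentiableAt, h0] with t ht₁ ht₂ ht₀ ht
  have ht0 : 0 < t := lt_of_le_of_ne (hx.trans ht.1) (Ne.symm ht₀)
  have hd := (ht₂ (by rwa [uIcc_of_le hxy])).hasDerivAt
  have hle := abs_deriv_norm_le ht₁ hd
  rw [hG, indicator_of_mem (show t ∈ Ioi (0 : ℝ) from ht0)] at hle
  have hcomp : HasDerivAt (fun s => Λ ‖F s‖) (l ‖F t‖ * deriv (fun s => ‖F s‖) t) t :=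
    (hΛ _).comp t hd
  rw [hcomp.deriv, abs_mul, hFf t ht0.le]
  have h₃ := mul_le_mul_of_nonneg_left hle (abs_nonneg (l ‖f t‖))
  nlinarith [sq_nonneg (|l ‖f t‖| - ‖g t‖), sq_abs (l ‖f t‖)]

end IsHalfLineSobolev

/-! ### Decay, integrability and maxima on the half-line -/

namespace IsHalfLineSobolev

variable {f g : ℝ → ℂ}

theorem tendsto_norm_atTop (h : IsHalfLineSobolev f g) :
    Tendsto (fun x => ‖f x‖) atTop (𝓝 0) := by
  have hD : IntegrableOn (fun t => ‖g t‖ ^ 2 + ‖f t‖ ^ 2) (Ioi 0) :=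
    h.integrableOn_sq_weakDeriv.add h.integrableOn_sq
  set J := ∫ t in Ioi (0 : ℝ), (‖g t‖ ^ 2 + ‖f t‖ ^ 2)
  have hiv : ∀ x y : ℝ, 0 ≤ x → x ≤ y →
      IntervalIntegrable (fun t => ‖g t‖ ^ 2 + ‖f t‖ ^ 2) volume x y := fun x y hx hxy =>
    (intervalIntegrable_iff_integrableOn_Ioc_of_le hxy).2
      (hD.mono_set fun _ ht => lt_of_le_of_lt hx ht.1)
  have hlim : Tendsto (fun y => ∫ t in (0 : ℝ)..y, (‖g t‖ ^ 2 + ‖f t‖ ^ 2)) atTop (𝓝 J) :=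
    intervalIntegral_tendsto_integral_Ioi 0 hD tendsto_id
  have hle : ∀ y, 0 ≤ y → ∫ t in (0 : ℝ)..y, (‖g t‖ ^ 2 + ‖f t‖ ^ 2) ≤ J := fun y hy => by
    rw [intervalIntegral.integral_of_le hy]
    exact setIntegral_mono_set hD (Eventually.of_forall fun t => by positivity)
      (Eventually.of_forall fun t ht => ht.1)
  have hvar : ∀ x y, 0 ≤ x → x ≤ y → ‖f x‖ ^ 2 - ‖f y‖ ^ 2
      ≤ J - ∫ t in (0 : ℝ)..x, (‖g t‖ ^ 2 + ‖f t‖ ^ 2) := fun x y hx hxy => by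
    have h₁ := h.abs_sub_le_integral (Λ := fun t => t ^ 2 / 2) (l := fun t => t)
      (fun t => by simpa using (hasDerivAt_pow 2 t).div_const 2) continuous_id hx hxy
    have h₂ : ∫ t in x..y, (1 / 2 * ‖g t‖ ^ 2 + 1 / 2 * ‖f t‖ ^ 2)
        = 1 / 2 * ∫ t in x..y, (‖g t‖ ^ 2 + ‖f t‖ ^ 2) := by
      rw [← intervalIntegral.integral_const_mul]
      simp only [mul_add]
    have h₃ := intervalIntegral.integral_add_adjacent_intervals
      (hiv 0 x le_rfl hx) (hiv x y hx hxy)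
    have h₄ := hle y (hx.trans hxy)
    rw [h₂] at h₁
    have h₅ := neg_le_of_abs_le h₁
    linarith
  have hsq : Tendsto (fun x => ‖f x‖ ^ 2) atTop (𝓝 0) := by
    rw [Metric.tendsto_atTop]
    intro ε hε
    obtain ⟨X, hX⟩ := (Metric.tendsto_atTop.1 hlim) (ε / 2) (by linarith)
    refine ⟨max X 0, fun x hx => ?_⟩
    have hx0 : 0 ≤ x := (le_max_right _ _).trans hx
    have hXx := hX x ((le_max_left _ _).trans hx)
    rw [Real.dist_eq] at hXx ⊢
    rw [sub_zero, abs_of_nonneg (sq_nonneg _)]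
    by_contra! hcon
    -- beyond `x` the function would stay away from zero, which square integrability forbids
    have hlow : ∀ y, x ≤ y → ε / 2 ≤ ‖f y‖ ^ 2 := fun y hy => by
      have h₁ := hvar x y hx0 hy
      have h₂ := neg_lt_of_abs_lt hXx
      linarith
    set y := x + 2 * (J + 1) / ε with hy
    have hJ : 0 ≤ J := setIntegral_nonneg measurableSet_Ioi fun t _ => by positivity
    have hxy : x ≤ y := by
      rw [hy]
      have : 0 ≤ 2 * (J + 1) / ε := by positivity
      linarith
    have h₁ : (y - x) * (ε / 2) ≤ ∫ t in x..y, (‖g t‖ ^ 2 + ‖f t‖ ^ 2) := by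
      have h₂ := intervalIntegral.integral_mono_on hxy
        (_root_.intervalIntegrable_const (c := ε / 2)) (hiv x y hx0 hxy) (fun t ht => by
          have := hlow t ht.1
          have : 0 ≤ ‖g t‖ ^ 2 := by positivity
          linarith)
      rwa [intervalIntegral.integral_const, smul_eq_mul] at h₂
    have h₃ := intervalIntegral.integral_add_adjacent_intervals
      (hiv 0 x le_rfl hx0) (hiv x y hx0 hxy)
    have h₄ : 0 ≤ ∫ t in (0 : ℝ)..x, (‖g t‖ ^ 2 + ‖f t‖ ^ 2) :=
      intervalIntegral.integral_nonneg hx0 fun t _ => by positivity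
    have h₅ := hle y (hx0.trans hxy)
    have h₆ : (y - x) * (ε / 2) = J + 1 := by
      rw [hy]
      field_simp
      ring
    linarith
  have := hsq.sqrt
  simpa [Real.sqrt_sq] using this

theorem exists_norm_max (h : IsHalfLineSobolev f g) :
    ∃ x₀, 0 ≤ x₀ ∧ ∀ x, 0 ≤ x → ‖f x‖ ≤ ‖f x₀‖ := by
  by_cases hz : ∀ x, 0 ≤ x → f x = 0
  · exact ⟨0, le_rfl, fun x hx => by simp [hz x hx]⟩
  push Not at hz
  obtain ⟨x₁, hx₁, hne⟩ := hz
  have hev := h.tendsto_norm_atTop.eventually (gt_mem_nhds (norm_pos_iff.2 hne))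
  obtain ⟨R, hR⟩ := eventually_atTop.1 hev
  have hmem : x₁ ∈ Icc 0 (max R x₁) := ⟨hx₁, le_max_right _ _⟩
  obtain ⟨x₀, hx₀, hmax⟩ := isCompact_Icc.exists_isMaxOn ⟨x₁, hmem⟩
    (h.continuousOn_norm.mono fun t (ht : t ∈ Icc 0 (max R x₁)) => ht.1)
  refine ⟨x₀, hx₀.1, fun x hx => ?_⟩
  rcases le_total x (max R x₁) with hx' | hx'
  · exact hmax ⟨hx, hx'⟩
  · exact (hR x ((le_max_left _ _).trans hx')).le.trans (hmax hmem)

theorem integrableOn_rpow (h : IsHalfLineSobolev f g) {p : ℝ} (hp : 2 ≤ p) :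
    IntegrableOn (fun x => ‖f x‖ ^ p) (Ioi 0) := by
  obtain ⟨x₀, -, hmax⟩ := h.exists_norm_max
  refine (h.integrableOn_sq.const_mul (‖f x₀‖ ^ (p - 2))).mono' ?_ ?_
  · exact ((h.continuousOn_norm.rpow_const fun x _ => Or.inr (by linarith)).mono
      Ioi_subset_Ici_self).aestronglyMeasurable measurableSet_Ioi
  · rw [ae_restrict_iff' measurableSet_Ioi]
    refine Eventually.of_forall fun x hx => ?_
    rw [Real.norm_eq_abs, abs_of_nonneg (by positivity)]
    have e : ‖f x‖ ^ p = ‖f x‖ ^ (p - 2) * ‖f x‖ ^ 2 := by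
      rcases eq_or_ne (‖f x‖) 0 with h0 | h0
      · rw [h0, Real.zero_rpow (by linarith)]
        simp
      · rw [← Real.rpow_natCast, ← Real.rpow_add (lt_of_le_of_ne (norm_nonneg _) (Ne.symm h0))]
        norm_num
    rw [e]
    gcongr
    exact hmax x (mem_Ioi.1 hx).le

variable {Λ l : ℝ → ℝ}

theorem intervalIntegrable_density (h : IsHalfLineSobolev f g) (hl : Continuous l) {x y : ℝ}
    (hx : 0 ≤ x) (hxy : x ≤ y) :
    IntervalIntegrable (fun t => 1 / 2 * ‖g t‖ ^ 2 + 1 / 2 * l ‖f t‖ ^ 2) volume x y :=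
  ((h.intervalIntegrable_sq_weakDeriv hx hxy).const_mul _).add
    ((h.intervalIntegrable_comp (hl.pow 2) hx hxy).const_mul _)

/-- The calibration bound on a whole half-line: the value `‖f x‖` has to be reached from the
vertex and left again towards infinity. -/
theorem two_mul_sub_le_integral (h : IsHalfLineSobolev f g) (hΛ : ∀ t, HasDerivAt Λ (l t) t)
    (hl : Continuous l) (hΛ0 : Λ 0 = 0)
    (hi : IntegrableOn (fun t => l ‖f t‖ ^ 2) (Ioi 0)) {x : ℝ} (hx : 0 ≤ x) :
    Λ ‖f x‖ + ∫ t in (0 : ℝ)..x, (1 / 2 * ‖g t‖ ^ 2 + 1 / 2 * l ‖f t‖ ^ 2) ≤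
      ∫ t in Ioi (0 : ℝ), (1 / 2 * ‖g t‖ ^ 2 + 1 / 2 * l ‖f t‖ ^ 2) := by
  have hD : IntegrableOn (fun t => 1 / 2 * ‖g t‖ ^ 2 + 1 / 2 * l ‖f t‖ ^ 2) (Ioi 0) :=
    (h.integrableOn_sq_weakDeriv.const_mul _).add (hi.const_mul _)
  have hlim := intervalIntegral_tendsto_integral_Ioi 0 hD tendsto_id
  have hΛt : Tendsto (fun y => Λ ‖f y‖) atTop (𝓝 0) := by
    have := ((hΛ 0).continuousAt.tendsto).comp h.tendsto_norm_atTop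
    rwa [hΛ0] at this
  have hle : ∀ᶠ y in atTop, Λ ‖f x‖ - Λ ‖f y‖ +
      ∫ t in (0 : ℝ)..x, (1 / 2 * ‖g t‖ ^ 2 + 1 / 2 * l ‖f t‖ ^ 2) ≤
      ∫ t in (0 : ℝ)..y, (1 / 2 * ‖g t‖ ^ 2 + 1 / 2 * l ‖f t‖ ^ 2) := by
    filter_upwards [eventually_ge_atTop x] with y hy
    have h₁ := neg_le_of_abs_le (h.abs_sub_le_integral hΛ hl hx hy)
    have h₂ := intervalIntegral.integral_add_adjacent_intervals
      (h.intervalIntegrable_density hl le_rfl hx) (h.intervalIntegrable_density hl hx hy)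
    linarith
  have h₃ := le_of_tendsto_of_tendsto
    ((tendsto_const_nhds (x := Λ ‖f x‖)).sub hΛt |>.add_const _) hlim hle
  simpa using h₃

/-- A function that vanishes at the vertex cannot saturate the calibration inequality between the
vertex and a point where it does not vanish: an extremal would solve a first-order equation for
which the rest state `0` is never left. -/
theorem lt_integral_of_eq_zero (h : IsHalfLineSobolev f g) (hΛ : ∀ t, HasDerivAt Λ (l t) t)
    (hl : Continuous l) {C : ℝ} (hC : 0 < C) (hΛC : ∀ t, 0 ≤ t → Λ t ≤ C * t ^ 2)
    (h0 : f 0 = 0) {x₀ : ℝ} (hx₀ : 0 ≤ x₀) (hne : f x₀ ≠ 0) :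
    Λ ‖f x₀‖ < ∫ t in (0 : ℝ)..x₀, (1 / 2 * ‖g t‖ ^ 2 + 1 / 2 * l ‖f t‖ ^ 2) := by
  by_contra! hcon
  -- `x₁` is the last zero before `x₀`
  have hcl : IsCompact (Icc 0 x₀ ∩ f ⁻¹' {0}) :=
    isCompact_Icc.of_isClosed_subset
      ((h.continuousOn.mono fun t ht => ht.1).preimage_isClosed_of_isClosed isClosed_Icc
        isClosed_singleton) inter_subset_left
  obtain ⟨x₁, ⟨⟨hx₁, hx₁'⟩, hfx₁⟩, hlast⟩ := hcl.exists_isGreatest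
    ⟨0, ⟨le_rfl, hx₀⟩, h0⟩
  have hfx₁ : f x₁ = 0 := hfx₁
  have hlt : x₁ < x₀ := lt_of_le_of_ne hx₁' fun e => hne (e ▸ hfx₁)
  set x := min x₀ (x₁ + 1 / (4 * C)) with hx
  have hxlt : x₁ < x := lt_min hlt (by have : 0 < 1 / (4 * C) := by positivity
                                       linarith)
  have hxle : x ≤ x₀ := min_le_left _ _
  have hxC : x - x₁ ≤ 1 / (4 * C) := by linarith [min_le_right x₀ (x₁ + 1 / (4 * C))]
  have hxpos : 0 ≤ x := hx₁.trans hxlt.le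
  have hfx : f x ≠ 0 := fun e => absurd (hlast ⟨⟨hxpos, hxle⟩, e⟩) (not_le.2 hxlt)
  have hn : 0 < ‖f x‖ := norm_pos_iff.2 hfx
  have hd : 0 < x - x₁ := by linarith
  have e₁ := intervalIntegral.integral_add_adjacent_intervals
    (h.intervalIntegrable_density hl le_rfl hx₁) (h.intervalIntegrable_density hl hx₁ hxlt.le)
  have e₂ := intervalIntegral.integral_add_adjacent_intervals
    (h.intervalIntegrable_density hl le_rfl hxpos) (h.intervalIntegrable_density hl hxpos hxle)
  have p₁ : 0 ≤ ∫ t in (0 : ℝ)..x₁, (1 / 2 * ‖g t‖ ^ 2 + 1 / 2 * l ‖f t‖ ^ 2) :=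
    intervalIntegral.integral_nonneg hx₁ fun t _ => by positivity
  have p₂ := le_of_abs_le (h.abs_sub_le_integral hΛ hl hxpos hxle)
  -- calibration by a linear function, with the slope that is optimal on `[x₁, x]`
  set s := ‖f x‖ / (x - x₁) with hs
  have p₃ := le_of_abs_le (h.abs_sub_le_integral (Λ := fun t => s * t) (l := fun _ => s)
    (fun t => by simpa using (hasDerivAt_id t).const_mul s) continuous_const hx₁ hxlt.le)
  simp only [hfx₁, norm_zero, mul_zero, sub_zero] at p₃
  have p₄ : ∫ t in x₁..x, (1 / 2 * ‖g t‖ ^ 2 + 1 / 2 * s ^ 2) ≤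
      (∫ t in x₁..x, (1 / 2 * ‖g t‖ ^ 2 + 1 / 2 * l ‖f t‖ ^ 2)) + 1 / 2 * s ^ 2 * (x - x₁) := by
    have : ∫ t in x₁..x, (1 / 2 * s ^ 2 : ℝ) = 1 / 2 * s ^ 2 * (x - x₁) := by
      rw [intervalIntegral.integral_const, smul_eq_mul, mul_comm]
    rw [← this, ← intervalIntegral.integral_add (h.intervalIntegrable_density hl hx₁ hxlt.le)
      (_root_.intervalIntegrable_const)]
    refine intervalIntegral.integral_mono_on hxlt.le
      (((h.intervalIntegrable_sq_weakDeriv hx₁ hxlt.le).const_mul _).add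
        _root_.intervalIntegrable_const)
      ((h.intervalIntegrable_density hl hx₁ hxlt.le).add _root_.intervalIntegrable_const)
      fun t _ => ?_
    have : 0 ≤ l ‖f t‖ ^ 2 := by positivity
    linarith
  have p₅ := hΛC _ (norm_nonneg (f x))
  have p₆ : s * ‖f x‖ = ‖f x‖ ^ 2 / (x - x₁) := by rw [hs]; ring
  have p₇ : s ^ 2 * (x - x₁) = ‖f x‖ ^ 2 / (x - x₁) := by rw [hs]; field_simp
  have p₈ : 1 / 2 * (‖f x‖ ^ 2 / (x - x₁)) ≤ C * ‖f x‖ ^ 2 := by nlinarith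
  have p₉ : 4 * C * ‖f x‖ ^ 2 ≤ ‖f x‖ ^ 2 / (x - x₁) := by
    rw [le_div_iff₀ hd]
    have : C * (x - x₁) ≤ 1 / 4 := by
      rw [le_div_iff₀ (by positivity)] at hxC
      linarith
    nlinarith [sq_nonneg ‖f x‖]
  nlinarith [mul_pos hC (pow_pos hn 2)]

end IsHalfLineSobolev

/-! ### The action and the mass of soliton tails -/

/-- The normalised action `Ψ(r) = ∫₀ʳ t √(1 - t^α) dt` of the piece of a soliton of height `1` along
which it decreases from the height `r` to `0`. -/
noncomputable def tailAction (α r : ℝ) : ℝ := ∫ t in (0 : ℝ)..r, t * √(1 - t ^ α)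

/-- The normalised mass `τ(r) = ∫₀ʳ t / √(1 - t^α) dt` of the piece of a soliton of height `1` along
which it decreases from the height `r` to `0`. It is written in terms of the action, by an
integration by parts, so as to avoid the singular integrand at `t = 1`. -/
noncomputable def tailMass (α r : ℝ) : ℝ :=
  ((α + 4) * tailAction α r - 2 * r ^ 2 * √(1 - r ^ α)) / α

section tail

variable {α r : ℝ}

theorem continuous_tailAction_integrand (hα : 0 < α) : Continuous fun t : ℝ => t * √(1 - t ^ α) :=
  continuous_id.mul (continuous_const.sub (Real.continuous_rpow_const hα.le)).sqrt

theorem hasDerivAt_tailAction (hα : 0 < α) (r : ℝ) :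
    HasDerivAt (tailAction α) (r * √(1 - r ^ α)) r :=
  intervalIntegral.integral_hasDerivAt_right
    ((continuous_tailAction_integrand hα).intervalIntegrable _ _)
    (continuous_tailAction_integrand hα).stronglyMeasurable.stronglyMeasurableAtFilter
    (continuous_tailAction_integrand hα).continuousAt

theorem continuous_tailAction (hα : 0 < α) : Continuous (tailAction α) :=
  continuous_iff_continuousAt.2 fun r => (hasDerivAt_tailAction hα r).continuousAt

@[simp]
theorem tailAction_zero : tailAction α 0 = 0 := by simp [tailAction]

theorem tailAction_monotoneOn (hα : 0 < α) : MonotoneOn (tailAction α) (Ici 0) := by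
  refine monotoneOn_of_deriv_nonneg (convex_Ici 0) (continuous_tailAction hα).continuousOn
    (fun r _ => (hasDerivAt_tailAction hα r).differentiableAt.differentiableWithinAt) fun r hr => ?_
  rw [(hasDerivAt_tailAction hα r).deriv]
  rw [interior_Ici] at hr
  have : 0 < r := hr
  positivity

theorem tailAction_le (hα : 0 < α) (hr : 0 ≤ r) : tailAction α r ≤ r ^ 2 / 2 := by
  have h : ∫ t in (0 : ℝ)..r, t = r ^ 2 / 2 := by simp
  rw [← h]
  refine intervalIntegral.integral_mono_on hr
    ((continuous_tailAction_integrand hα).intervalIntegrable _ _)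
    (continuous_id.intervalIntegrable _ _) fun t ht => ?_
  have h₁ : √(1 - t ^ α) ≤ 1 := by
    rw [Real.sqrt_le_one]
    linarith [Real.rpow_nonneg ht.1 α]
  exact mul_le_of_le_one_right ht.1 h₁

theorem le_tailAction (hα : 0 < α) (hr : 0 ≤ r) :
    r ^ 2 / 2 * √(1 - r ^ α) ≤ tailAction α r := by
  have h : ∫ t in (0 : ℝ)..r, t * √(1 - r ^ α) = r ^ 2 / 2 * √(1 - r ^ α) := by simp
  rw [← h]
  refine intervalIntegral.integral_mono_on hr
    ((continuous_id.mul continuous_const).intervalIntegrable _ _)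
    ((continuous_tailAction_integrand hα).intervalIntegrable _ _) fun t ht => ?_
  have : t ^ α ≤ r ^ α := Real.rpow_le_rpow ht.1 ht.2 hα.le
  exact mul_le_mul_of_nonneg_left (Real.sqrt_le_sqrt (by linarith)) ht.1

@[simp]
theorem tailMass_zero : tailMass α 0 = 0 := by simp [tailMass]

theorem continuous_tailMass (hα : 0 < α) : Continuous (tailMass α) := by
  unfold tailMass
  exact ((continuous_const.mul (continuous_tailAction hα)).sub
    ((continuous_const.mul (continuous_pow 2)).mul
      (continuous_const.sub (Real.continuous_rpow_const hα.le)).sqrt)).div_const _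

theorem hasDerivAt_tailMass (hα : 0 < α) (hr : 0 < r) (hr1 : r < 1) :
    HasDerivAt (tailMass α) (r / √(1 - r ^ α)) r := by
  have hlt : r ^ α < 1 := Real.rpow_lt_one hr.le hr1 hα
  have hpos : 0 < 1 - r ^ α := by linarith
  have hs : 0 < √(1 - r ^ α) := Real.sqrt_pos.2 hpos
  have hsq : √(1 - r ^ α) ^ 2 = 1 - r ^ α := Real.sq_sqrt hpos.le
  have h₁ : HasDerivAt (fun r : ℝ => √(1 - r ^ α))
      (-(α * r ^ (α - 1)) / (2 * √(1 - r ^ α))) r :=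
    ((Real.hasDerivAt_rpow_const (Or.inl hr.ne')).const_sub 1).sqrt hpos.ne'
  have h₂ : HasDerivAt (fun r : ℝ => 2 * r ^ 2) (4 * r) r := by
    have := (hasDerivAt_pow 2 r).const_mul 2
    refine this.congr_deriv ?_
    norm_num
    ring
  have h₃ := (((hasDerivAt_tailAction hα r).const_mul (α + 4)).sub (h₂.mul h₁)).div_const α
  refine h₃.congr_deriv ?_
  have e : r ^ (α - 1) * r = r ^ α := by
    rw [← Real.rpow_add_one hr.ne']
    ring_nf
  have e' : r ^ (α - 1) = r ^ α / r := by rw [← e]; field_simp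
  rw [e']
  field_simp
  rw [hsq]
  ring

theorem tailMass_strictMonoOn (hα : 0 < α) : StrictMonoOn (tailMass α) (Icc 0 1) := by
  refine strictMonoOn_of_deriv_pos (convex_Icc 0 1) (continuous_tailMass hα).continuousOn
    fun r hr => ?_
  rw [interior_Icc] at hr
  rw [(hasDerivAt_tailMass hα hr.1 hr.2).deriv]
  have hlt : r ^ α < 1 := Real.rpow_lt_one hr.1.le hr.2 hα
  exact div_pos hr.1 (Real.sqrt_pos.2 (by linarith))

theorem tailMass_pos (hα : 0 < α) (hr : 0 < r) (hr1 : r ≤ 1) : 0 < tailMass α r := by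
  simpa using tailMass_strictMonoOn hα ⟨le_rfl, zero_le_one⟩ ⟨hr.le, hr1⟩ hr

theorem tailMass_le (hα : 0 < α) (hr : 0 ≤ r) :
    tailMass α r ≤ (α + 4) / (2 * α) * r ^ 2 := by
  have h := tailAction_le hα hr
  have h' : 0 ≤ 2 * r ^ 2 * √(1 - r ^ α) := by positivity
  rw [tailMass, div_le_iff₀ hα]
  have e : (α + 4) / (2 * α) * r ^ 2 * α = (α + 4) * (r ^ 2 / 2) := by field_simp
  rw [e]
  nlinarith

theorem tailAction_eq (hα : 0 < α) (r : ℝ) :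
    (α + 4) * tailAction α r = α * tailMass α r + 2 * r ^ 2 * √(1 - r ^ α) := by
  rw [tailMass]
  field_simp
  ring

theorem tailAction_one (hα : 0 < α) : (α + 4) * tailAction α 1 = α * tailMass α 1 := by
  rw [tailAction_eq hα]
  simp

end tail

/-! ### The calibration -/

/-- The calibration `Φ_M(s) = ∫₀ˢ √(2 W_M)` of the potential `W_M(t) = (M^(p-2) t² - t^p) / p`,
whose zero `M` is the height of the soliton with frequency `2 M^(p-2) / p`. -/
noncomputable def calibration (p M s : ℝ) : ℝ :=
  √(2 / p) * M ^ (p / 2 + 1) * tailAction (p - 2) (s / M)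

/-- The derivative `√(2 W_M)` of the calibration. -/
noncomputable def calibrationDeriv (p M s : ℝ) : ℝ :=
  √(2 / p) * M ^ (p / 2 - 1) * (s * √(1 - (s / M) ^ (p - 2)))

/-- The bound for the energy of a function of mass `μ` on the star graph with `N` half-lines, with
modulus `a` at the vertex and maximal modulus `b`, that results from calibrating with height
`M`. -/
noncomputable def reducedEnergy (p q N μ M a b : ℝ) : ℝ :=
  -(μ / p) * M ^ (p - 2) + (2 * calibration p M b + (N - 2) * calibration p M a) - a ^ q / q

section calibration

variable {p M s : ℝ}

theorem hasDerivAt_calibration (hp : 2 < p) (hM : 0 < M) (s : ℝ) :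
    HasDerivAt (calibration p M) (calibrationDeriv p M s) s := by
  have h₁ := (hasDerivAt_tailAction (α := p - 2) (by linarith) (s / M)).comp s
    ((hasDerivAt_id s).div_const M)
  refine (h₁.const_mul (√(2 / p) * M ^ (p / 2 + 1))).congr_deriv ?_
  have e : M ^ (p / 2 + 1) = M ^ (p / 2 - 1) * M ^ 2 := by
    rw [← Real.rpow_natCast, ← Real.rpow_add hM]
    norm_num
    ring_nf
  rw [calibrationDeriv, e]
  field_simp

theorem continuous_calibrationDeriv (hp : 2 < p) : Continuous (calibrationDeriv p M) := by
  unfold calibrationDeriv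
  exact continuous_const.mul (continuous_id.mul
    (continuous_const.sub ((Real.continuous_rpow_const (by linarith)).comp
      (continuous_id.div_const M))).sqrt)

@[simp]
theorem calibration_zero : calibration p M 0 = 0 := by simp [calibration]

theorem calibration_monotoneOn (hp : 2 < p) (hM : 0 < M) :
    MonotoneOn (calibration p M) (Ici 0) := fun a ha b hb hab => by
  unfold calibration
  refine mul_le_mul_of_nonneg_left ?_ (by positivity)
  exact tailAction_monotoneOn (by linarith) (div_nonneg ha hM.le) (div_nonneg hb hM.le) (by gcongr)

theorem rpow_half_sub_one_sq (hM : 0 < M) : (M ^ (p / 2 - 1)) ^ 2 = M ^ (p - 2) := by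
  rw [← Real.rpow_natCast, ← Real.rpow_mul hM.le]
  norm_num
  ring_nf

theorem half_calibrationDeriv_sq (hp : 2 < p) (hM : 0 < M) (hs : 0 ≤ s) (hsM : s ≤ M) :
    1 / 2 * calibrationDeriv p M s ^ 2 = 1 / p * (M ^ (p - 2) * s ^ 2) - 1 / p * s ^ p := by
  have h₁ : (s / M) ^ (p - 2) ≤ 1 :=
    Real.rpow_le_one (by positivity) ((div_le_one hM).2 hsM) (by linarith)
  have e : s ^ p = s ^ (p - 2) * s ^ 2 := by
    rcases eq_or_lt_of_le hs with h0 | h0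
    · rw [← h0, Real.zero_rpow (by linarith)]
      simp
    · rw [← Real.rpow_natCast, ← Real.rpow_add h0]
      norm_num
  rw [calibrationDeriv, mul_pow, mul_pow, mul_pow, Real.sq_sqrt (by positivity),
    Real.sq_sqrt (by linarith), Real.div_rpow hs hM.le, rpow_half_sub_one_sq hM, e]
  have : M ^ (p - 2) ≠ 0 := (Real.rpow_pos_of_pos hM _).ne'
  field_simp

theorem calibration_le (hp : 2 < p) (hM : 0 < M) (hs : 0 ≤ s) :
    calibration p M s ≤ √(2 / p) * M ^ (p / 2 + 1) / (2 * M ^ 2) * s ^ 2 := by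
  unfold calibration
  have h := tailAction_le (α := p - 2) (by linarith) (div_nonneg hs hM.le)
  calc _ ≤ √(2 / p) * M ^ (p / 2 + 1) * ((s / M) ^ 2 / 2) :=
        mul_le_mul_of_nonneg_left h (by positivity)
    _ = _ := by field_simp

end calibration

namespace StarH1

variable {N : ℕ} {p q M : ℝ}

theorem exists_norm_max (u : StarH1 N) (hN : 1 ≤ N) :
    ∃ i x₀, 0 ≤ x₀ ∧ ∀ j x, 0 ≤ x → ‖u.toFun j x‖ ≤ ‖u.toFun i x₀‖ := by
  choose m hm hmax using fun i => (u.isHalfLineSobolev i).exists_norm_max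
  have : Nonempty (Fin N) := ⟨⟨0, hN⟩⟩
  obtain ⟨i, hi⟩ := Finite.exists_max fun i => ‖u.toFun i (m i)‖
  exact ⟨i, m i, hm i, fun j x hx => (hmax j x hx).trans (hi j)⟩

theorem integrableOn_calibrationDeriv_sq (u : StarH1 N) (hp : 2 < p) (hM : 0 < M)
    (hb : ∀ j x, 0 ≤ x → ‖u.toFun j x‖ ≤ M) (i : Fin N) :
    IntegrableOn (fun t => calibrationDeriv p M ‖u.toFun i t‖ ^ 2) (Ioi 0) := by
  have h := u.isHalfLineSobolev i
  have h₁ : IntegrableOn (fun t => 2 * (1 / p * (M ^ (p - 2) * ‖u.toFun i t‖ ^ 2)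
      - 1 / p * ‖u.toFun i t‖ ^ p)) (Ioi 0) :=
    (((h.integrableOn_sq.const_mul (M ^ (p - 2))).const_mul (1 / p)).sub
      ((h.integrableOn_rpow hp.le).const_mul (1 / p))).const_mul 2
  refine h₁.congr_fun (fun x hx => ?_) measurableSet_Ioi
  have := half_calibrationDeriv_sq hp hM (norm_nonneg (u.toFun i x)) (hb i x (mem_Ioi.1 hx).le)
  simp only
  linarith

/-- The energy is the integral of the calibrated densities, up to the frequency times the mass and
the vertex term. -/
theorem energy_eq_sum_density (u : StarH1 N) (hp : 2 < p) (hM : 0 < M)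
    (hb : ∀ j x, 0 ≤ x → ‖u.toFun j x‖ ≤ M) :
    u.energy p q = -(u.mass / p) * M ^ (p - 2) + (∑ i, ∫ t in Ioi (0 : ℝ),
      (1 / 2 * ‖u.weakDeriv i t‖ ^ 2 + 1 / 2 * calibrationDeriv p M ‖u.toFun i t‖ ^ 2))
      - ‖u.vertexValue‖ ^ q / q := by
  have e : ∀ i, ∫ t in Ioi (0 : ℝ),
      (1 / 2 * ‖u.weakDeriv i t‖ ^ 2 + 1 / 2 * calibrationDeriv p M ‖u.toFun i t‖ ^ 2)
      = 1 / 2 * (∫ t in Ioi (0 : ℝ), ‖u.weakDeriv i t‖ ^ 2)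
        + (M ^ (p - 2) / p * (∫ t in Ioi (0 : ℝ), ‖u.toFun i t‖ ^ 2)
          - 1 / p * ∫ t in Ioi (0 : ℝ), ‖u.toFun i t‖ ^ p) := fun i => by
    have h := u.isHalfLineSobolev i
    rw [← integral_const_mul, ← integral_const_mul, ← integral_const_mul,
      ← integral_sub (h.integrableOn_sq.const_mul _) ((h.integrableOn_rpow hp.le).const_mul _),
      ← integral_add (h.integrableOn_sq_weakDeriv.const_mul _)
        (by exact (h.integrableOn_sq.const_mul _).sub ((h.integrableOn_rpow hp.le).const_mul _))]
    refine setIntegral_congr_fun measurableSet_Ioi fun x hx => ?_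
    have := half_calibrationDeriv_sq hp hM (norm_nonneg (u.toFun i x)) (hb i x (mem_Ioi.1 hx).le)
    simp only [this]
    ring
  simp only [e, Finset.sum_add_distrib, Finset.sum_sub_distrib, ← Finset.mul_sum]
  rw [energy, mass]
  ring

theorem calibration_vertexValue_le (u : StarH1 N) (hp : 2 < p) (hM : 0 < M)
    (hb : ∀ j x, 0 ≤ x → ‖u.toFun j x‖ ≤ M) (i : Fin N) :
    calibration p M ‖u.vertexValue‖ ≤ ∫ t in Ioi (0 : ℝ),
      (1 / 2 * ‖u.weakDeriv i t‖ ^ 2 + 1 / 2 * calibrationDeriv p M ‖u.toFun i t‖ ^ 2) := by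
  have h := (u.isHalfLineSobolev i).two_mul_sub_le_integral (hasDerivAt_calibration hp hM)
    (continuous_calibrationDeriv hp) calibration_zero
    (u.integrableOn_calibrationDeriv_sq hp hM hb i) le_rfl
  simpa [u.toFun_zero i] using h

/-- If one half-line carries the calibrated action `A` and each of the others at least that of a
tail, then the energy is bounded below accordingly. -/
theorem le_energy_of_le_integral (u : StarH1 N) (hp : 2 < p) (hM : 0 < M)
    (hb : ∀ j x, 0 ≤ x → ‖u.toFun j x‖ ≤ M) (i : Fin N) {A : ℝ} (hA : A ≤ ∫ t in Ioi (0 : ℝ),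
      (1 / 2 * ‖u.weakDeriv i t‖ ^ 2 + 1 / 2 * calibrationDeriv p M ‖u.toFun i t‖ ^ 2)) :
    -(u.mass / p) * M ^ (p - 2) + (A + (N - 1) * calibration p M ‖u.vertexValue‖)
      - ‖u.vertexValue‖ ^ q / q ≤ u.energy p q := by
  have hN : 1 ≤ N := Fin.pos i
  rw [u.energy_eq_sum_density hp hM hb, ← Finset.add_sum_erase _ _ (Finset.mem_univ i)]
  have h₁ := Finset.card_nsmul_le_sum (Finset.univ.erase i) _ _
    fun j _ => u.calibration_vertexValue_le hp hM hb j
  rw [Finset.card_erase_of_mem (Finset.mem_univ i), Finset.card_univ, Fintype.card_fin,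
    nsmul_eq_mul, Nat.cast_sub hN, Nat.cast_one] at h₁
  linarith

/-- The lower bound for the energy in terms of the value at the vertex and the maximum. -/
theorem reducedEnergy_le_energy (u : StarH1 N) (hp : 2 < p) (hM : 0 < M)
    (hb : ∀ j x, 0 ≤ x → ‖u.toFun j x‖ ≤ M) {i : Fin N} {x₀ : ℝ} (hx₀ : 0 ≤ x₀) :
    reducedEnergy p q N u.mass M ‖u.vertexValue‖ ‖u.toFun i x₀‖ ≤ u.energy p q := by
  have h := u.isHalfLineSobolev i
  have h₁ := h.two_mul_sub_le_integral (hasDerivAt_calibration hp hM)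
    (continuous_calibrationDeriv hp) calibration_zero
    (u.integrableOn_calibrationDeriv_sq hp hM hb i) hx₀
  have h₂ := le_of_abs_le (h.abs_sub_le_integral (hasDerivAt_calibration hp hM)
    (continuous_calibrationDeriv hp) le_rfl hx₀)
  rw [u.toFun_zero i] at h₂
  have h₃ := u.le_energy_of_le_integral (q := q) hp hM hb i
    (A := 2 * calibration p M ‖u.toFun i x₀‖ - calibration p M ‖u.vertexValue‖) (by linarith)
  refine le_trans (le_of_eq ?_) h₃
  rw [reducedEnergy]
  ring

/-- The lower bound is strict for functions that vanish at the vertex. -/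
theorem reducedEnergy_lt_energy_of_vertexValue_eq_zero (u : StarH1 N) (hp : 2 < p) (hM : 0 < M)
    (hb : ∀ j x, 0 ≤ x → ‖u.toFun j x‖ ≤ M) (hu : u.vertexValue = 0) {i : Fin N} {x₀ : ℝ}
    (hx₀ : 0 ≤ x₀) (hne : u.toFun i x₀ ≠ 0) :
    reducedEnergy p q N u.mass M 0 ‖u.toFun i x₀‖ < u.energy p q := by
  have h := u.isHalfLineSobolev i
  have h₁ := h.two_mul_sub_le_integral (hasDerivAt_calibration hp hM)
    (continuous_calibrationDeriv hp) calibration_zero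
    (u.integrableOn_calibrationDeriv_sq hp hM hb i) hx₀
  have h₂ := h.lt_integral_of_eq_zero (hasDerivAt_calibration hp hM)
    (continuous_calibrationDeriv hp) (C := √(2 / p) * M ^ (p / 2 + 1) / (2 * M ^ 2))
    (by have : 0 < M ^ (p / 2 + 1) := Real.rpow_pos_of_pos hM _
        positivity)
    (fun t ht => calibration_le hp hM ht) ((u.toFun_zero i).trans hu) hx₀ hne
  have h₃ := u.le_energy_of_le_integral (q := q) hp hM hb i (A := _) (h₁)
  rw [hu] at h₃
  simp only [norm_zero, calibration_zero] at h₃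
  rw [reducedEnergy, calibration_zero]
  linarith

end StarH1

/-! ### Solitons -/

/-- The soliton of height `M` on the real line, centred at the origin. -/
noncomputable def soliton (p M x : ℝ) : ℝ :=
  M * Real.cosh ((p - 2) / 2 * √(2 / p) * M ^ (p / 2 - 1) * x) ^ (-(2 / (p - 2)))

/-- The derivative of the soliton of height `M`. -/
noncomputable def solitonDeriv (p M x : ℝ) : ℝ :=
  -(√(2 / p) * M ^ (p / 2 - 1) * Real.tanh ((p - 2) / 2 * √(2 / p) * M ^ (p / 2 - 1) * x)
    * soliton p M x)

section soliton

variable {p M x : ℝ}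

theorem continuous_tanh_real : Continuous Real.tanh := by
  rw [show Real.tanh = fun x => Real.sinh x / Real.cosh x from
    funext fun x => Real.tanh_eq_sinh_div_cosh x]
  exact Real.continuous_sinh.div Real.continuous_cosh fun x => (Real.cosh_pos x).ne'

theorem hasDerivAt_soliton (hp : 2 < p) (x : ℝ) :
    HasDerivAt (soliton p M) (solitonDeriv p M x) x := by
  set k := (p - 2) / 2 * √(2 / p) * M ^ (p / 2 - 1) with hk
  have h₁ : HasDerivAt (fun x => Real.cosh (k * x)) (Real.sinh (k * x) * k) x := by
    have := (Real.hasDerivAt_cosh (k * x)).comp x ((hasDerivAt_id x).const_mul k)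
    rwa [mul_one] at this
  have h₂ := (h₁.rpow_const (p := -(2 / (p - 2))) (Or.inl (Real.cosh_pos _).ne')).const_mul M
  refine h₂.congr_deriv ?_
  rw [solitonDeriv, soliton, ← hk, Real.tanh_eq_sinh_div_cosh,
    Real.rpow_sub_one (Real.cosh_pos _).ne']
  have : p - 2 ≠ 0 := by linarith
  have hc := (Real.cosh_pos (k * x)).ne'
  have e : k * (2 / (p - 2)) = √(2 / p) * M ^ (p / 2 - 1) := by
    rw [hk]
    field_simp
  linear_combination (-(M * Real.sinh (k * x) * Real.cosh (k * x) ^ (-(2 / (p - 2)))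
    / Real.cosh (k * x))) * e

theorem continuous_soliton (hp : 2 < p) : Continuous (soliton p M) :=
  continuous_iff_continuousAt.2 fun x => (hasDerivAt_soliton hp x).continuousAt

theorem continuous_solitonDeriv (hp : 2 < p) : Continuous (solitonDeriv p M) :=
  ((continuous_const.mul (continuous_tanh_real.comp (continuous_const.mul continuous_id))).mul
    (continuous_soliton hp)).neg

theorem soliton_neg (p M x : ℝ) : soliton p M (-x) = soliton p M x := by
  simp [soliton]

theorem solitonDeriv_neg (p M x : ℝ) : solitonDeriv p M (-x) = -solitonDeriv p M x := by
  simp [solitonDeriv, soliton_neg]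

@[simp]
theorem soliton_zero (p M : ℝ) : soliton p M 0 = M := by simp [soliton]

theorem soliton_pos (hM : 0 < M) (x : ℝ) : 0 < soliton p M x :=
  mul_pos hM (Real.rpow_pos_of_pos (Real.cosh_pos _) _)

theorem soliton_le (hp : 2 < p) (hM : 0 < M) (x : ℝ) : soliton p M x ≤ M := by
  refine mul_le_of_le_one_right hM.le (Real.rpow_le_one_of_one_le_of_nonpos (Real.one_le_cosh _) ?_)
  have : 0 < 2 / (p - 2) := div_pos two_pos (by linarith)
  linarith

theorem soliton_lt (hp : 2 < p) (hM : 0 < M) (hx : x ≠ 0) : soliton p M x < M := by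
  refine mul_lt_of_lt_one_right hM (Real.rpow_lt_one_of_one_lt_of_neg (Real.one_lt_cosh.2 ?_) ?_)
  · have : 0 < M ^ (p / 2 - 1) := Real.rpow_pos_of_pos hM _
    have : 0 < √(2 / p) := Real.sqrt_pos.2 (by positivity)
    have : 0 < p - 2 := by linarith
    positivity
  · have : 0 < 2 / (p - 2) := div_pos two_pos (by linarith)
    linarith

/-- Every height in `(0, M]` is attained by the decreasing part of the soliton of height `M`. -/
theorem exists_soliton_eq (hp : 2 < p) (hM : 0 < M) {s : ℝ} (hs : 0 < s) (hsM : s ≤ M) :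
    ∃ y, 0 ≤ y ∧ soliton p M y = s := by
  have hα : 0 < p - 2 := by linarith
  have hk : 0 < (p - 2) / 2 * √(2 / p) * M ^ (p / 2 - 1) := by
    have : 0 < M ^ (p / 2 - 1) := Real.rpow_pos_of_pos hM _
    have : 0 < √(2 / p) := Real.sqrt_pos.2 (by positivity)
    positivity
  have h1 : 1 ≤ (M / s) ^ ((p - 2) / 2) :=
    Real.one_le_rpow ((one_le_div hs).2 hsM) (by linarith)
  refine ⟨Real.arcosh ((M / s) ^ ((p - 2) / 2)) / ((p - 2) / 2 * √(2 / p) * M ^ (p / 2 - 1)),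
    div_nonneg (Real.arcosh_nonneg h1) hk.le, ?_⟩
  rw [soliton, mul_div_cancel₀ _ hk.ne', Real.cosh_arcosh h1, ← Real.rpow_mul (by positivity)]
  have : (p - 2) / 2 * -(2 / (p - 2)) = -1 := by field_simp
  rw [this, Real.rpow_neg_one]
  field_simp

theorem sqrt_one_sub_soliton_div (hp : 2 < p) (hM : 0 < M) (x : ℝ) :
    √(1 - (soliton p M x / M) ^ (p - 2))
      = |Real.tanh ((p - 2) / 2 * √(2 / p) * M ^ (p / 2 - 1) * x)| := by
  set k := (p - 2) / 2 * √(2 / p) * M ^ (p / 2 - 1) with hk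
  have hα : p - 2 ≠ 0 := by linarith
  have hc := Real.cosh_pos (k * x)
  have e : (soliton p M x / M) ^ (p - 2) = 1 / Real.cosh (k * x) ^ 2 := by
    rw [soliton, ← hk, mul_div_cancel_left₀ _ hM.ne', ← Real.rpow_mul hc.le]
    have : -(2 / (p - 2)) * (p - 2) = -(2 : ℕ) := by
      field_simp
      norm_num
    rw [this, Real.rpow_neg hc.le, Real.rpow_natCast, one_div]
  rw [e, ← Real.sqrt_sq_eq_abs, Real.tanh_eq_sinh_div_cosh, div_pow, Real.sinh_sq]
  congr 1
  field_simp

/-- Solitons are extremal for the calibration. -/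
theorem calibrationDeriv_soliton (hp : 2 < p) (hM : 0 < M) (x : ℝ) :
    calibrationDeriv p M (soliton p M x) = |solitonDeriv p M x| := by
  have h₁ : 0 ≤ √(2 / p) * M ^ (p / 2 - 1) := by positivity
  rw [calibrationDeriv, sqrt_one_sub_soliton_div hp hM, solitonDeriv, abs_neg, abs_mul, abs_mul,
    abs_of_nonneg h₁, abs_of_pos (soliton_pos hM x)]
  ring

theorem tanh_nonneg_of_nonneg {t : ℝ} (ht : 0 ≤ t) : 0 ≤ Real.tanh t := by
  rw [Real.tanh_eq_sinh_div_cosh]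
  exact div_nonneg (Real.sinh_nonneg_iff.2 ht) (Real.cosh_pos t).le

theorem solitonDeriv_nonpos (hp : 2 < p) (hM : 0 < M) (hx : 0 ≤ x) : solitonDeriv p M x ≤ 0 := by
  have hα : 0 < p - 2 := by linarith
  have h₁ : 0 ≤ Real.tanh ((p - 2) / 2 * √(2 / p) * M ^ (p / 2 - 1) * x) :=
    tanh_nonneg_of_nonneg (by positivity)
  have h₂ := soliton_pos (p := p) hM x
  rw [solitonDeriv, neg_nonpos]
  positivity

theorem tendsto_cosh_atTop : Tendsto Real.cosh atTop atTop := by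
  refine tendsto_atTop_mono (fun x => ?_) (Real.tendsto_exp_atTop.atTop_div_const two_pos)
  rw [Real.cosh_eq]
  have := Real.exp_pos (-x)
  linarith

theorem tendsto_soliton_atTop (hp : 2 < p) (hM : 0 < M) :
    Tendsto (soliton p M) atTop (𝓝 0) := by
  have hα : 0 < p - 2 := by linarith
  have hk : 0 < (p - 2) / 2 * √(2 / p) * M ^ (p / 2 - 1) := by
    have : 0 < M ^ (p / 2 - 1) := Real.rpow_pos_of_pos hM _
    have : 0 < √(2 / p) := Real.sqrt_pos.2 (by positivity)
    positivity
  have h := (tendsto_rpow_neg_atTop (y := 2 / (p - 2)) (by positivity)).comp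
    (tendsto_cosh_atTop.comp (tendsto_id.const_mul_atTop hk))
  have h' := h.const_mul M
  rwa [mul_zero] at h'

/-- The mass of a tail of the soliton of height `M` is the normalised mass `τ` times
`M ^ (3 - p / 2) / √(2 / p)`. -/
theorem hasDerivAt_tailMass_soliton (hp : 2 < p) (hM : 0 < M) (hx : 0 < x) :
    HasDerivAt (fun x => M ^ (3 - p / 2) / √(2 / p) * tailMass (p - 2) (soliton p M x / M))
      (-soliton p M x ^ 2) x := by
  have hα : 0 < p - 2 := by linarith
  have hs := soliton_pos (p := p) hM x
  have hc : 0 < √(2 / p) := Real.sqrt_pos.2 (by positivity)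
  have hMp : 0 < M ^ (p / 2 - 1) := Real.rpow_pos_of_pos hM _
  have h₁ := hasDerivAt_tailMass hα (r := soliton p M x / M) (by positivity)
    ((div_lt_one hM).2 (soliton_lt hp hM hx.ne'))
  have h₂ := (h₁.comp x ((hasDerivAt_soliton hp x).div_const M)).const_mul
    (M ^ (3 - p / 2) / √(2 / p))
  refine h₂.congr_deriv ?_
  set k := (p - 2) / 2 * √(2 / p) * M ^ (p / 2 - 1) with hk
  have ht : 0 < Real.tanh (k * x) := by
    rw [Real.tanh_eq_sinh_div_cosh]
    exact div_pos (Real.sinh_pos_iff.2 (by positivity)) (Real.cosh_pos _)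
  rw [sqrt_one_sub_soliton_div hp hM, solitonDeriv, ← hk, abs_of_pos ht]
  have e : M ^ (3 - p / 2) * M ^ (p / 2 - 1) = M ^ 2 := by
    rw [← Real.rpow_add hM, ← Real.rpow_natCast]
    norm_num
  calc M ^ (3 - p / 2) / √(2 / p) * (soliton p M x / M / Real.tanh (k * x) *
        (-(√(2 / p) * M ^ (p / 2 - 1) * Real.tanh (k * x) * soliton p M x) / M))
      = -(M ^ (3 - p / 2) * M ^ (p / 2 - 1)) * soliton p M x ^ 2 / M ^ 2 := by
        generalize M ^ (3 - p / 2) = m₁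
        generalize M ^ (p / 2 - 1) = m₂
        field_simp
    _ = -soliton p M x ^ 2 := by
        rw [e]
        field_simp

theorem hasDerivAt_calibration_soliton (hp : 2 < p) (hM : 0 < M) (hx : 0 ≤ x) :
    HasDerivAt (fun x => calibration p M (soliton p M x)) (-solitonDeriv p M x ^ 2) x := by
  refine ((hasDerivAt_calibration hp hM _).comp x (hasDerivAt_soliton hp x)).congr_deriv ?_
  rw [calibrationDeriv_soliton hp hM, abs_of_nonpos (solitonDeriv_nonpos hp hM hx)]
  ring

/-- The integral over a right half-line of a nonnegative function that is minus the derivative of a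
function vanishing at infinity. -/
theorem integral_Ioi_eq_of_hasDerivAt_neg {A h : ℝ → ℝ} (hA : Continuous A)
    (hd : ∀ x, 0 < x → HasDerivAt A (-h x) x) (hh : ∀ x, 0 ≤ h x) (ht : Tendsto A atTop (𝓝 0))
    {y : ℝ} (hy : 0 ≤ y) : IntegrableOn h (Ioi y) ∧ ∫ x in Ioi y, h x = A y := by
  have hc : ContinuousWithinAt (fun x => -A x) (Ici y) y := hA.neg.continuousWithinAt
  have hd' : ∀ x ∈ Ioi y, HasDerivAt (fun x => -A x) (h x) x := fun x hx => by
    have := (hd x (lt_of_le_of_lt hy hx)).neg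
    rwa [neg_neg] at this
  have ht' : Tendsto (fun x => -A x) atTop (𝓝 0) := by simpa using ht.neg
  refine ⟨integrableOn_Ioi_deriv_of_nonneg hc hd' (fun x _ => hh x) ht', ?_⟩
  rw [integral_Ioi_of_hasDerivAt_of_nonneg hc hd' (fun x _ => hh x) ht']
  ring

/-- For an even integrand, the integral over a half-line reaching beyond the centre is obtained by
reflection. -/
theorem integral_Ioi_neg_eq_of_even {h : ℝ → ℝ} (hc : Continuous h) (he : ∀ x, h (-x) = h x)
    (hi : IntegrableOn h (Ioi 0)) {y : ℝ} (hy : 0 ≤ y) : IntegrableOn h (Ioi (-y)) ∧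
      ∫ x in Ioi (-y), h x = 2 * (∫ x in Ioi 0, h x) - ∫ x in Ioi y, h x := by
  have hiy : IntegrableOn h (Ioi (-y)) := by
    rw [← Ioc_union_Ioi_eq_Ioi (show -y ≤ 0 by linarith)]
    exact (hc.integrableOn_Icc.mono_set Ioc_subset_Icc_self).union hi
  refine ⟨hiy, ?_⟩
  rw [← intervalIntegral.integral_interval_add_Ioi hiy hi,
    ← intervalIntegral.integral_interval_add_Ioi hi (hi.mono_set (Ioi_subset_Ioi hy))]
  have : ∫ x in (-y)..0, h x = ∫ x in (0 : ℝ)..y, h x := by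
    have := intervalIntegral.integral_comp_neg (a := -y) (b := 0) h
    simp only [he, neg_neg, neg_zero] at this
    exact this
  rw [this]
  ring

theorem continuous_tailMass_soliton (hp : 2 < p) :
    Continuous fun x => M ^ (3 - p / 2) / √(2 / p) * tailMass (p - 2) (soliton p M x / M) :=
  continuous_const.mul ((continuous_tailMass (by linarith)).comp
    ((continuous_soliton hp).div_const M))

theorem integral_soliton_sq (hp : 2 < p) (hM : 0 < M) {y : ℝ} (hy : 0 ≤ y) :
    IntegrableOn (fun x => soliton p M x ^ 2) (Ioi y) ∧ ∫ x in Ioi y, soliton p M x ^ 2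
      = M ^ (3 - p / 2) / √(2 / p) * tailMass (p - 2) (soliton p M y / M) := by
  refine integral_Ioi_eq_of_hasDerivAt_neg (continuous_tailMass_soliton hp)
    (fun x hx => hasDerivAt_tailMass_soliton hp hM hx) (fun x => sq_nonneg _) ?_ hy
  have h := ((continuous_tailMass (α := p - 2) (by linarith)).tendsto 0).comp
    (by simpa using (tendsto_soliton_atTop hp hM).div_const M)
  simpa using h.const_mul (M ^ (3 - p / 2) / √(2 / p))

theorem integral_solitonDeriv_sq (hp : 2 < p) (hM : 0 < M) {y : ℝ} (hy : 0 ≤ y) :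
    IntegrableOn (fun x => solitonDeriv p M x ^ 2) (Ioi y) ∧
      ∫ x in Ioi y, solitonDeriv p M x ^ 2 = calibration p M (soliton p M y) := by
  have hc : Continuous (calibration p M) :=
    continuous_iff_continuousAt.2 fun s => (hasDerivAt_calibration hp hM s).continuousAt
  refine integral_Ioi_eq_of_hasDerivAt_neg (hc.comp (continuous_soliton hp))
    (fun x hx => hasDerivAt_calibration_soliton hp hM hx.le) (fun x => sq_nonneg _) ?_ hy
  simpa using (hc.tendsto 0).comp (tendsto_soliton_atTop hp hM)

theorem integral_soliton_sq_neg (hp : 2 < p) (hM : 0 < M) {y : ℝ} (hy : 0 ≤ y) :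
    IntegrableOn (fun x => soliton p M x ^ 2) (Ioi (-y)) ∧ ∫ x in Ioi (-y), soliton p M x ^ 2
      = M ^ (3 - p / 2) / √(2 / p) *
        (2 * tailMass (p - 2) 1 - tailMass (p - 2) (soliton p M y / M)) := by
  have h := integral_Ioi_neg_eq_of_even (h := fun x => soliton p M x ^ 2)
    ((continuous_soliton (M := M) hp).pow 2) (fun x => by simp [soliton_neg])
    (integral_soliton_sq hp hM le_rfl).1 hy
  refine ⟨h.1, h.2.trans ?_⟩
  rw [(integral_soliton_sq hp hM le_rfl).2, (integral_soliton_sq hp hM hy).2, soliton_zero,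
    div_self hM.ne']
  ring

theorem integral_solitonDeriv_sq_neg (hp : 2 < p) (hM : 0 < M) {y : ℝ} (hy : 0 ≤ y) :
    IntegrableOn (fun x => solitonDeriv p M x ^ 2) (Ioi (-y)) ∧
      ∫ x in Ioi (-y), solitonDeriv p M x ^ 2
        = 2 * calibration p M M - calibration p M (soliton p M y) := by
  have h := integral_Ioi_neg_eq_of_even (h := fun x => solitonDeriv p M x ^ 2)
    ((continuous_solitonDeriv (M := M) hp).pow 2) (fun x => by simp [solitonDeriv_neg])
    (integral_solitonDeriv_sq hp hM le_rfl).1 hy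
  refine ⟨h.1, h.2.trans ?_⟩
  rw [(integral_solitonDeriv_sq hp hM le_rfl).2, (integral_solitonDeriv_sq hp hM hy).2,
    soliton_zero]

theorem setIntegral_Ioi_comp_add (h : ℝ → ℝ) (z : ℝ) :
    ∫ x in Ioi 0, h (x + z) = ∫ x in Ioi z, h x := by
  rw [← (measurePreserving_add_right volume z).setIntegral_preimage_emb
    (measurableEmbedding_addRight z) h (Ioi z)]
  simp

theorem integrableOn_Ioi_comp_add {h : ℝ → ℝ} {z : ℝ} (hi : IntegrableOn h (Ioi z)) :
    IntegrableOn (fun x => h (x + z)) (Ioi 0) := by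
  have := ((measurePreserving_add_right volume z).integrableOn_comp_preimage
    (measurableEmbedding_addRight z) (s := Ioi z)).2 hi
  simpa [Function.comp_def] using this

end soliton

/-- A classical derivative that is continuous is a weak derivative. -/
theorem HasWeakDerivOn.of_hasDerivAt {f g : ℝ → ℂ} (hf : ∀ x, HasDerivAt f (g x) x)
    (hg : Continuous g) : HasWeakDerivOn f g (Ioi 0) := by
  have hfc : Continuous f := continuous_iff_continuousAt.2 fun x => (hf x).continuousAt
  refine ⟨hfc.locallyIntegrable.locallyIntegrableOn _,
    hg.locallyIntegrable.locallyIntegrableOn _, fun φ hφ hc hs => ?_⟩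
  have hφd : Continuous (deriv φ) := hφ.continuous_deriv (by norm_num)
  have i₁ : Integrable fun x => deriv φ x • f x :=
    (hφd.smul hfc).integrable_of_hasCompactSupport hc.deriv.smul_right
  have i₂ : Integrable fun x => φ x • g x :=
    (hφ.continuous.smul hg).integrable_of_hasCompactSupport hc.smul_right
  have i₃ : Integrable fun x => φ x • f x :=
    (hφ.continuous.smul hfc).integrable_of_hasCompactSupport hc.smul_right
  have h := integral_eq_zero_of_hasDerivAt_of_integrable
    (fun x => ((hφ.differentiable (by norm_num)) x).hasDerivAt.smul (hf x)) (i₂.add i₁) i₃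
  rw [integral_add i₂ i₁] at h
  rw [setIntegral_eq_integral_of_forall_compl_eq_zero fun x hx => by
      rw [image_eq_zero_of_notMem_tsupport fun h => hx (hs (tsupport_deriv_subset h)), zero_smul],
    setIntegral_eq_integral_of_forall_compl_eq_zero fun x hx => by
      rw [image_eq_zero_of_notMem_tsupport fun h => hx (hs h), zero_smul]]
  linear_combination h

/-- The function on the star graph whose restriction to the `i`-th half-line is the soliton of
height `M` translated by `-y` if `i` belongs to `S`, so that its peak lies on that half-line, and by
`y` otherwise, so that only a tail is seen. -/
noncomputable def solitonStar (p M y : ℝ) (hp : 2 < p) (hM : 0 < M) (hy : 0 ≤ y) {N : ℕ}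
    (S : Finset (Fin N)) : StarH1 N where
  toFun i x := (soliton p M (x + if i ∈ S then -y else y) : ℂ)
  weakDeriv i x := (solitonDeriv p M (x + if i ∈ S then -y else y) : ℂ)
  vertexValue := (soliton p M y : ℂ)
  continuousOn i := (Complex.continuous_ofReal.comp ((continuous_soliton hp).comp
    (continuous_id.add continuous_const))).continuousOn
  toFun_zero i := by
    split_ifs <;> simp [soliton_neg]
  memLp i := by
    refine (memLp_two_iff_integrable_sq_norm (Complex.continuous_ofReal.comp
      ((continuous_soliton hp).comp
        (continuous_id.add continuous_const))).aestronglyMeasurable).2 ?_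
    simp only [Complex.norm_real, Real.norm_eq_abs, sq_abs, Function.comp_apply]
    refine integrableOn_Ioi_comp_add (h := fun x => soliton p M x ^ 2) ?_
    split_ifs
    exacts [(integral_soliton_sq_neg hp hM hy).1, (integral_soliton_sq hp hM hy).1]
  memLp_weakDeriv i := by
    refine (memLp_two_iff_integrable_sq_norm (Complex.continuous_ofReal.comp
      ((continuous_solitonDeriv hp).comp
        (continuous_id.add continuous_const))).aestronglyMeasurable).2 ?_
    simp only [Complex.norm_real, Real.norm_eq_abs, sq_abs, Function.comp_apply]
    refine integrableOn_Ioi_comp_add (h := fun x => solitonDeriv p M x ^ 2) ?_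
    split_ifs
    exacts [(integral_solitonDeriv_sq_neg hp hM hy).1, (integral_solitonDeriv_sq hp hM hy).1]
  hasWeakDerivOn i := HasWeakDerivOn.of_hasDerivAt
    (fun x => ((hasDerivAt_soliton hp _).comp_add_const x _).ofReal_comp)
    (Complex.continuous_ofReal.comp ((continuous_solitonDeriv hp).comp
      (continuous_id.add continuous_const)))

section solitonStar

variable {p q M y : ℝ} (hp : 2 < p) (hM : 0 < M) (hy : 0 ≤ y) {N : ℕ} (S : Finset (Fin N))

theorem norm_vertexValue_solitonStar :
    ‖(solitonStar p M y hp hM hy S).vertexValue‖ = soliton p M y := by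
  rw [solitonStar, Complex.norm_real, Real.norm_eq_abs, abs_of_pos (soliton_pos hM y)]

theorem norm_toFun_solitonStar (i : Fin N) (x : ℝ) :
    ‖(solitonStar p M y hp hM hy S).toFun i x‖
      = soliton p M (x + if i ∈ S then -y else y) := by
  rw [solitonStar, Complex.norm_real, Real.norm_eq_abs, abs_of_pos (soliton_pos hM _)]

theorem norm_weakDeriv_solitonStar (i : Fin N) (x : ℝ) :
    ‖(solitonStar p M y hp hM hy S).weakDeriv i x‖
      = |solitonDeriv p M (x + if i ∈ S then -y else y)| := by
  rw [solitonStar, Complex.norm_real, Real.norm_eq_abs]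

theorem sum_ite_mem_eq (A B : ℝ) : ∑ i : Fin N, (if i ∈ S then A else B)
    = S.card * A + (N - S.card) * B := by
  have h : S.card ≤ N := by simpa using S.card_le_univ
  rw [Finset.sum_ite, Finset.sum_const, Finset.sum_const, Finset.filter_not,
    Finset.filter_mem_eq_inter, Finset.univ_inter, ← Finset.compl_eq_univ_sdiff,
    Finset.card_compl, Fintype.card_fin, nsmul_eq_mul, nsmul_eq_mul, Nat.cast_sub h]

theorem mass_solitonStar : (solitonStar p M y hp hM hy S).mass = M ^ (3 - p / 2) / √(2 / p) *
    (2 * S.card * tailMass (p - 2) 1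
      + (N - 2 * S.card) * tailMass (p - 2) (soliton p M y / M)) := by
  have e : ∀ i, ∫ x in Ioi (0 : ℝ), ‖(solitonStar p M y hp hM hy S).toFun i x‖ ^ 2
      = if i ∈ S then M ^ (3 - p / 2) / √(2 / p) *
          (2 * tailMass (p - 2) 1 - tailMass (p - 2) (soliton p M y / M))
        else M ^ (3 - p / 2) / √(2 / p) * tailMass (p - 2) (soliton p M y / M) := fun i => by
    simp only [norm_toFun_solitonStar]
    rw [setIntegral_Ioi_comp_add (fun x => soliton p M x ^ 2)]
    split_ifs
    exacts [(integral_soliton_sq_neg hp hM hy).2, (integral_soliton_sq hp hM hy).2]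
  rw [StarH1.mass]
  simp only [e]
  rw [sum_ite_mem_eq]
  ring

theorem energy_solitonStar : (solitonStar p M y hp hM hy S).energy p q =
    -((solitonStar p M y hp hM hy S).mass / p) * M ^ (p - 2) + (2 * S.card * calibration p M M
      + (N - 2 * S.card) * calibration p M (soliton p M y)) - soliton p M y ^ q / q := by
  have hle : ∀ i x, 0 ≤ x → ‖(solitonStar p M y hp hM hy S).toFun i x‖ ≤ M := fun i x _ => by
    rw [norm_toFun_solitonStar]
    exact soliton_le hp hM _
  rw [StarH1.energy_eq_sum_density _ hp hM hle, norm_vertexValue_solitonStar]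
  have e : ∀ i, ∫ x in Ioi (0 : ℝ), (1 / 2 * ‖(solitonStar p M y hp hM hy S).weakDeriv i x‖ ^ 2
      + 1 / 2 * calibrationDeriv p M ‖(solitonStar p M y hp hM hy S).toFun i x‖ ^ 2)
      = if i ∈ S then 2 * calibration p M M - calibration p M (soliton p M y)
        else calibration p M (soliton p M y) := fun i => by
    simp only [norm_toFun_solitonStar, norm_weakDeriv_solitonStar, calibrationDeriv_soliton hp hM,
      sq_abs]
    rw [setIntegral_Ioi_comp_add
      (fun x => 1 / 2 * solitonDeriv p M x ^ 2 + 1 / 2 * solitonDeriv p M x ^ 2)]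
    have e' : ∀ x, 1 / 2 * solitonDeriv p M x ^ 2 + 1 / 2 * solitonDeriv p M x ^ 2
        = solitonDeriv p M x ^ 2 := fun x => by ring
    simp only [e']
    split_ifs
    exacts [(integral_solitonDeriv_sq_neg hp hM hy).2, (integral_solitonDeriv_sq hp hM hy).2]
  simp only [e]
  rw [sum_ite_mem_eq]
  ring

end solitonStar

/-! ### The reduced variational problem -/

/-- The function `X ↦ -(μ/p) X^(p-2) + √(2/p) (p-2)/(p+2) K X^(p/2+1)` of a height `X`. For
`K = 2 τ(1)` it is the energy on the line of a function of mass `μ` that follows the soliton of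
height `X` and has a plateau at that height, whose length makes up for the missing mass, provided
that `μ` is at least the mass of that soliton. -/
noncomputable def heightEnergy (p μ K X : ℝ) : ℝ :=
  -(μ / p) * X ^ (p - 2) + √(2 / p) * ((p - 2) / (p + 2)) * K * X ^ (p / 2 + 1)

/-- The minimum point of `heightEnergy p μ K`. For `K = 2 τ(1)` it is the height of the soliton of
mass `μ`. -/
noncomputable def criticalHeight (p μ K : ℝ) : ℝ := (μ * √(2 / p) / K) ^ (1 / (3 - p / 2))

/-- The energy of the soliton of mass `μ` on the real line. -/
noncomputable def lineLevel (p μ : ℝ) : ℝ :=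
  heightEnergy p μ (2 * tailMass (p - 2) 1) (criticalHeight p μ (2 * tailMass (p - 2) 1))

/-- The function that follows, on each of `N` half-lines, the tail of the soliton of height `M` that
starts at the height `s`, has mass `μ`. -/
structure IsTailPair (p : ℝ) (N : ℕ) (μ M s : ℝ) : Prop where
  pos : 0 < s
  le : s ≤ M
  mass_eq : M ^ (3 - p / 2) * (N * tailMass (p - 2) (s / M)) = μ * √(2 / p)

section reduced

variable {p q μ K M a b s X : ℝ} {N : ℕ}

theorem criticalHeight_pos (hp : 2 < p) (hμ : 0 < μ) (hK : 0 < K) : 0 < criticalHeight p μ K := by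
  have : 0 < √(2 / p) := Real.sqrt_pos.2 (by positivity)
  exact Real.rpow_pos_of_pos (by positivity) _

theorem criticalHeight_rpow (hp : 2 < p) (hp' : p < 6) (hμ : 0 < μ) (hK : 0 < K) :
    criticalHeight p μ K ^ (3 - p / 2) * K = μ * √(2 / p) := by
  have : 0 < √(2 / p) := Real.sqrt_pos.2 (by positivity)
  have hγ : 3 - p / 2 ≠ 0 := by linarith
  rw [criticalHeight, ← Real.rpow_mul (by positivity), one_div, inv_mul_cancel₀ hγ, Real.rpow_one]
  field_simp

/-- The equation for `X₀` is that of critical points; since `p - 2 < p / 2 + 1`, the critical point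
is the minimum. -/
theorem heightEnergy_critical_le (hp : 2 < p) (hp' : p < 6) (hμ : 0 < μ)
    {X₀ : ℝ} (hX₀ : 0 < X₀) (h : X₀ ^ (3 - p / 2) * K = μ * √(2 / p)) (hX : 0 < X) :
    heightEnergy p μ K X₀ ≤ heightEnergy p μ K X := by
  have hc : √(2 / p) ^ 2 = 2 / p := Real.sq_sqrt (by positivity)
  -- Young's inequality for `t = X / X₀`
  have hy := Real.geom_mean_le_arith_mean2_weighted (w₁ := (p - 2) / (p / 2 + 1))
    (w₂ := 1 - (p - 2) / (p / 2 + 1)) (p₁ := (X / X₀) ^ (p / 2 + 1)) (p₂ := 1)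
    (div_nonneg (by linarith) (by linarith))
    (sub_nonneg.2 ((div_le_one (by linarith)).2 (by linarith))) (by positivity) zero_le_one
    (by ring)
  rw [Real.one_rpow, mul_one, mul_one, ← Real.rpow_mul (by positivity)] at hy
  have e₀ : (p / 2 + 1) * ((p - 2) / (p / 2 + 1)) = p - 2 := by field_simp
  rw [e₀, Real.div_rpow hX.le hX₀.le, Real.div_rpow hX.le hX₀.le] at hy
  have e₁ : X₀ ^ (p / 2 + 1) = X₀ ^ (p - 2) * X₀ ^ (3 - p / 2) := by
    rw [← Real.rpow_add hX₀]
    ring_nf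
  have p₁ : 0 < X₀ ^ (p - 2) := Real.rpow_pos_of_pos hX₀ _
  have p₂ : 0 < X₀ ^ (3 - p / 2) := Real.rpow_pos_of_pos hX₀ _
  have hKe : K = μ * √(2 / p) / X₀ ^ (3 - p / 2) := by
    rw [eq_div_iff p₂.ne']
    linarith
  have key : ∀ Y : ℝ, heightEnergy p μ K Y = μ / p * X₀ ^ (p - 2) *
      (-(Y ^ (p - 2) / X₀ ^ (p - 2))
        + (p - 2) / (p / 2 + 1) * (Y ^ (p / 2 + 1) / X₀ ^ (p / 2 + 1))) := fun Y => by
    have e₂ : √(2 / p) * ((p - 2) / (p + 2)) * (μ * √(2 / p) / X₀ ^ (3 - p / 2))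
        = √(2 / p) ^ 2 * (μ * ((p - 2) / (p + 2)) / X₀ ^ (3 - p / 2)) := by ring
    rw [heightEnergy, hKe, e₂, hc, e₁]
    generalize X₀ ^ (3 - p / 2) = m₁ at *
    generalize X₀ ^ (p - 2) = m₂ at *
    generalize Y ^ (p / 2 + 1) = m₃ at *
    generalize Y ^ (p - 2) = m₄ at *
    have : p / 2 + 1 = (p + 2) / 2 := by ring
    rw [this]
    field_simp
  rw [key, key]
  have p₃ : X₀ ^ (p / 2 + 1) ≠ 0 := (Real.rpow_pos_of_pos hX₀ _).ne'
  rw [div_self p₁.ne', div_self p₃]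
  refine mul_le_mul_of_nonneg_left ?_ (by positivity)
  linarith

theorem lineLevel_le_heightEnergy (hp : 2 < p) (hp' : p < 6) (hμ : 0 < μ) (hX : 0 < X) :
    lineLevel p μ ≤ heightEnergy p μ (2 * tailMass (p - 2) 1) X := by
  have h := tailMass_pos (α := p - 2) (by linarith) one_pos le_rfl
  exact heightEnergy_critical_le hp hp' hμ
    (criticalHeight_pos hp hμ (by positivity)) (criticalHeight_rpow hp hp' hμ (by positivity)) hX

theorem calibration_self (hp : 2 < p) (hM : 0 < M) : calibration p M M
    = √(2 / p) * ((p - 2) / (p + 2)) * tailMass (p - 2) 1 * M ^ (p / 2 + 1) := by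
  have h := tailAction_one (α := p - 2) (by linarith)
  have h2 : tailAction (p - 2) 1 = (p - 2) / (p + 2) * tailMass (p - 2) 1 := by
    have : p + 2 ≠ 0 := by linarith
    field_simp
    linarith
  rw [calibration, div_self hM.ne', h2]
  ring

theorem reducedEnergy_zero_self (hp : 2 < p) (hq : 0 < q) (hM : 0 < M) :
    reducedEnergy p q N μ M 0 M = heightEnergy p μ (2 * tailMass (p - 2) 1) M := by
  rw [reducedEnergy, calibration_self hp hM, heightEnergy, calibration_zero,
    Real.zero_rpow hq.ne']
  ring

theorem reducedEnergy_self (hp : 2 < p) (hM : 0 < M) : reducedEnergy p q N μ M M M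
    = heightEnergy p μ (N * tailMass (p - 2) 1) M - M ^ q / q := by
  rw [reducedEnergy, calibration_self hp hM, heightEnergy]
  ring

theorem calibrationDeriv_nonneg (hM : 0 < M) (hs : 0 ≤ s) : 0 ≤ calibrationDeriv p M s := by
  unfold calibrationDeriv
  positivity

theorem half_mul_calibrationDeriv_le (hp : 2 < p) (hM : 0 < M) (hs : 0 ≤ s) :
    s / 2 * calibrationDeriv p M s ≤ calibration p M s := by
  have h := le_tailAction (α := p - 2) (by linarith) (div_nonneg hs hM.le)
  have e : M ^ (p / 2 + 1) = M ^ (p / 2 - 1) * M ^ 2 := by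
    rw [← Real.rpow_natCast, ← Real.rpow_add hM]
    norm_num
    ring_nf
  rw [calibration, calibrationDeriv, e]
  calc _ = √(2 / p) * (M ^ (p / 2 - 1) * M ^ 2) *
        ((s / M) ^ 2 / 2 * √(1 - (s / M) ^ (p - 2))) := by field_simp
    _ ≤ _ := mul_le_mul_of_nonneg_left h (by positivity)

/-- If the kink that the vertex condition allows is too weak to stop a bump from escaping, then
letting it escape lowers the energy. -/
theorem heightEnergy_lt_reducedEnergy (hp : 2 < p) (hq : 2 < q) (hM : 0 < M) (ha : 0 < a)
    (h : a ^ (q - 1) ≤ (N - 2) * calibrationDeriv p M a) :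
    heightEnergy p μ (2 * tailMass (p - 2) 1) M < reducedEnergy p q N μ M a M := by
  have h₀ : 0 < a ^ (q - 1) := Real.rpow_pos_of_pos ha _
  have hd := calibrationDeriv_nonneg (p := p) hM ha.le
  have hN : (0 : ℝ) < N - 2 := by
    by_contra! hcon
    nlinarith
  have h₁ := half_mul_calibrationDeriv_le hp hM ha.le
  have e : a ^ q = a ^ (q - 1) * a := by
    rw [← Real.rpow_add_one ha.ne']
    ring_nf
  have h₂ : a ^ q / 2 ≤ (N - 2) * calibration p M a := by
    rw [e]
    nlinarith
  have h₃ : a ^ q / q < a ^ q / 2 := div_lt_div_of_pos_left (Real.rpow_pos_of_pos ha _) two_pos hq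
  have h₄ : reducedEnergy p q N μ M a M = reducedEnergy p q N μ M 0 M
      + ((N - 2) * calibration p M a - a ^ q / q) := by
    rw [reducedEnergy, reducedEnergy, Real.zero_rpow (by linarith), calibration_zero]
    ring
  rw [h₄, reducedEnergy_zero_self hp (by linarith) hM]
  linarith

/-- In the opposite case, raising the value at the vertex lowers the energy. -/
theorem reducedEnergy_self_le_of_lt (hp : 2 < p) (hq : 2 < q) (hM : 0 < M) (ha : 0 < a)
    (h : (N - 2) * calibrationDeriv p M a ≤ a ^ (q - 1)) (has : a ≤ s) (hsM : s ≤ M) :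
    reducedEnergy p q N μ M s s ≤ reducedEnergy p q N μ M a M := by
  have hd : ∀ t, 0 < t → HasDerivAt (fun t => t ^ q / q - (N - 2) * calibration p M t)
      (t ^ (q - 1) - (N - 2) * calibrationDeriv p M t) t := fun t ht => by
    have h₁ := (Real.hasDerivAt_rpow_const (p := q) (Or.inl ht.ne')).div_const q
    refine (h₁.sub ((hasDerivAt_calibration hp hM t).const_mul _)).congr_deriv ?_
    field_simp
  have hmono : MonotoneOn (fun t => t ^ q / q - (N - 2) * calibration p M t) (Ici a) := by
    refine monotoneOn_of_deriv_nonneg (convex_Ici a)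
      (fun t ht => (hd t (ha.trans_le ht)).continuousAt.continuousWithinAt)
      (fun t ht => (hd t (ha.trans (by simpa using ht))).differentiableAt.differentiableWithinAt)
      fun t ht => ?_
    have hat : a < t := by simpa using ht
    have ht0 := ha.trans hat
    rw [(hd t ht0).deriv, sub_nonneg]
    have e : ∀ t : ℝ, 0 < t → t ^ (q - 1) = t * t ^ (q - 2) := fun t ht => by
      rw [mul_comm, ← Real.rpow_add_one ht.ne']
      ring_nf
    have e' : ∀ t : ℝ, (N - 2) * calibrationDeriv p M t
        = t * ((N - 2) * (√(2 / p) * M ^ (p / 2 - 1) * √(1 - (t / M) ^ (p - 2)))) := fun t => by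
      rw [calibrationDeriv]
      ring
    rw [e a ha, e', mul_le_mul_iff_right₀ ha] at h
    rw [e t ht0, e', mul_le_mul_iff_right₀ ht0]
    rcases le_total (0 : ℝ) (N - 2) with hN | hN
    · have h₁ : a ^ (q - 2) ≤ t ^ (q - 2) := Real.rpow_le_rpow ha.le hat.le (by linarith)
      have h₂ : (a / M) ^ (p - 2) ≤ (t / M) ^ (p - 2) :=
        Real.rpow_le_rpow (by positivity) (by gcongr) (by linarith)
      refine le_trans ?_ (h.trans h₁)
      gcongr
    · refine le_trans (mul_nonpos_of_nonpos_of_nonneg hN (by positivity)) (by positivity)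
  have h₁ := hmono (self_mem_Ici) has has
  have h₂ := calibration_monotoneOn hp hM (ha.le.trans has) hM.le hsM
  simp only at h₁
  rw [reducedEnergy, reducedEnergy]
  linarith

theorem reducedEnergy_self_le (hp : 2 < p) (hM : 0 < M) (ha : 0 ≤ a) (hab : a ≤ b) :
    reducedEnergy p q N μ M a a ≤ reducedEnergy p q N μ M a b := by
  have := calibration_monotoneOn hp hM ha (ha.trans hab) hab
  rw [reducedEnergy, reducedEnergy]
  linarith

/-- On a star of tails of solitons of given height, the vertex value can be chosen to yield any mass
up to that of the star of half-solitons. -/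
theorem exists_isTailPair_of_mass_le (hp : 2 < p) (hM : 0 < M) (hμ : 0 < μ)
    (h : μ * √(2 / p) ≤ M ^ (3 - p / 2) * (N * tailMass (p - 2) 1)) :
    ∃ s, IsTailPair p N μ M s := by
  have hcont : Continuous fun s => M ^ (3 - p / 2) * (N * tailMass (p - 2) (s / M)) :=
    continuous_const.mul (continuous_const.mul
      ((continuous_tailMass (by linarith)).comp (continuous_id.div_const M)))
  have hpos : 0 < μ * √(2 / p) := mul_pos hμ (Real.sqrt_pos.2 (by positivity))
  obtain ⟨s, hs, hse⟩ := intermediate_value_Icc hM.le hcont.continuousOn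
    (show μ * √(2 / p) ∈ _ from ⟨by simpa using hpos.le, by rwa [div_self hM.ne']⟩)
  refine ⟨s, lt_of_le_of_ne hs.1 fun h0 => ?_, hs.2, hse⟩
  simp only [← h0, zero_div, tailMass_zero, mul_zero] at hse
  linarith

/-- Given the vertex value, the height of the soliton can be raised so as to lower the mass to any
positive value. -/
theorem exists_isTailPair_of_le_mass (hp : 2 < p) (hμ : 0 < μ) (ha : 0 < a) (haM : a ≤ M)
    (h : μ * √(2 / p) ≤ M ^ (3 - p / 2) * (N * tailMass (p - 2) (a / M))) :
    ∃ M', M ≤ M' ∧ IsTailPair p N μ M' a := by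
  have hα : 0 < p - 2 := by linarith
  have hM : 0 < M := ha.trans_le haM
  have hpos : 0 < μ * √(2 / p) := mul_pos hμ (Real.sqrt_pos.2 (by positivity))
  set F : ℝ → ℝ := fun M => M ^ (3 - p / 2) * (N * tailMass (p - 2) (a / M)) with hF
  have hcont : ContinuousOn F (Ici M) := by
    refine ContinuousOn.mul (fun x hx => ?_) (continuousOn_const.mul
      ((continuous_tailMass hα).comp_continuousOn (continuousOn_const.div continuousOn_id
        fun x hx => (hM.trans_le hx).ne')))
    exact (Real.continuousAt_rpow_const _ _ (Or.inl (hM.trans_le hx).ne')).continuousWithinAt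
  have hlim : Tendsto F atTop (𝓝 0) := by
    have h₁ : Tendsto (fun x : ℝ => N * ((p - 2 + 4) / (2 * (p - 2)) * a ^ 2)
        * x ^ (-(p / 2 - 1))) atTop (𝓝 0) := by
      simpa using (tendsto_rpow_neg_atTop (y := p / 2 - 1) (by linarith)).const_mul
        (N * ((p - 2 + 4) / (2 * (p - 2)) * a ^ 2))
    refine tendsto_of_tendsto_of_tendsto_of_le_of_le' tendsto_const_nhds h₁ ?_ ?_
    · filter_upwards [eventually_ge_atTop M] with x hx
      have hx0 := hM.trans_le hx
      have := tailMass_pos hα (r := a / x) (by positivity) ((div_le_one hx0).2 (haM.trans hx))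
      simp only [hF]
      positivity
    · filter_upwards [eventually_ge_atTop M] with x hx
      have hx0 := hM.trans_le hx
      have h₂ := tailMass_le hα (r := a / x) (by positivity)
      have e : x ^ (-(p / 2 - 1)) = x ^ (3 - p / 2) / x ^ 2 := by
        rw [← Real.rpow_natCast, ← Real.rpow_sub hx0]
        norm_num
        ring_nf
      simp only [hF]
      calc x ^ (3 - p / 2) * (N * tailMass (p - 2) (a / x))
          ≤ x ^ (3 - p / 2) * (N * ((p - 2 + 4) / (2 * (p - 2)) * (a / x) ^ 2)) := by gcongr
        _ = _ := by
          rw [e]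
          ring
  obtain ⟨R, hR⟩ := eventually_atTop.1 (hlim.eventually (gt_mem_nhds hpos))
  have hmem : μ * √(2 / p) ∈ F '' Icc M (max M R) := by
    refine intermediate_value_Icc' (le_max_left _ _) (hcont.mono Icc_subset_Ici_self) ⟨?_, h⟩
    exact (hR _ (le_max_right _ _)).le
  obtain ⟨M', hM', he⟩ := hmem
  exact ⟨M', hM'.1, ha, haM.trans hM'.1, he⟩

theorem isTailPair_criticalHeight (hp : 2 < p) (hp' : p < 6) (hμ : 0 < μ) (hN : 1 ≤ N) {r : ℝ}
    (hr : 0 < r) (hr1 : r ≤ 1) :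
    IsTailPair p N μ (criticalHeight p μ (N * tailMass (p - 2) r))
      (r * criticalHeight p μ (N * tailMass (p - 2) r)) := by
  have hN' : (0 : ℝ) < N := by exact_mod_cast hN
  have hK : 0 < N * tailMass (p - 2) r := mul_pos hN' (tailMass_pos (by linarith) hr hr1)
  have hX := criticalHeight_pos hp hμ hK
  refine ⟨mul_pos hr hX, mul_le_of_le_one_left hX.le hr1, ?_⟩
  rw [mul_div_cancel_right₀ _ hX.ne']
  exact criticalHeight_rpow hp hp' hμ hK

end reduced

namespace StarH1

variable {N : ℕ} {p q : ℝ}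

/-- A function on the star graph has more energy than the soliton of the same mass, or it has
at least the energy of some star of tails of the same mass. -/
theorem lineLevel_lt_energy_or_exists_isTailPair (u : StarH1 N) (hN : 1 ≤ N) (hp : 2 < p)
    (hp' : p < 6) (hq : 2 < q) (hμ : 0 < u.mass) : lineLevel p u.mass < u.energy p q ∨
      ∃ M s, IsTailPair p N u.mass M s ∧ reducedEnergy p q N u.mass M s s ≤ u.energy p q := by
  have hα : 0 < p - 2 := by linarith
  obtain ⟨i, x₀, hx₀, hmax⟩ := u.exists_norm_max hN
  set μ := u.mass with hμ_def
  set a := ‖u.vertexValue‖ with ha_def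
  set b := ‖u.toFun i x₀‖ with hb_def
  have hab : a ≤ b := by
    have := hmax i 0 le_rfl
    rwa [u.toFun_zero i] at this
  have hb : 0 < b := by
    refine lt_of_le_of_ne (norm_nonneg _) fun h0 => hμ.ne' ?_
    rw [hμ_def, mass]
    refine Finset.sum_eq_zero fun j _ => ?_
    rw [setIntegral_congr_fun (g := fun _ => (0 : ℝ)) measurableSet_Ioi fun x hx => ?_]
    · simp
    · have := hmax j x (mem_Ioi.1 hx).le
      have h0' : ‖u.toFun j x‖ = 0 := le_antisymm (this.trans h0.symm.le) (norm_nonneg _)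
      simp [h0']
  have hbound : ∀ M, b ≤ M → ∀ j x, 0 ≤ x → ‖u.toFun j x‖ ≤ M := fun M hM j x hx =>
    (hmax j x hx).trans hM
  have lower : ∀ M, b ≤ M → reducedEnergy p q N μ M a b ≤ u.energy p q := fun M hM =>
    u.reducedEnergy_le_energy hp (hb.trans_le hM) (hbound M hM) hx₀
  rcases eq_or_lt_of_le (norm_nonneg u.vertexValue) with h0 | ha
  · left
    refine (lineLevel_le_heightEnergy hp hp' hμ hb).trans_lt ?_
    rw [← reducedEnergy_zero_self (q := q) (N := N) hp (by linarith) hb]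
    exact u.reducedEnergy_lt_energy_of_vertexValue_eq_zero hp hb (hbound b le_rfl)
      (norm_eq_zero.1 h0.symm) hx₀ (norm_pos_iff.1 hb)
  rcases le_total (a ^ (q - 1)) ((N - 2) * calibrationDeriv p b a) with hA | hB
  · left
    exact (lineLevel_le_heightEnergy hp hp' hμ hb).trans_lt
      ((heightEnergy_lt_reducedEnergy hp hq hb ha hA).trans_le (lower b le_rfl))
  right
  have hN' : (0 : ℝ) < N := by exact_mod_cast hN
  rcases le_total (μ * √(2 / p)) (b ^ (3 - p / 2) * (N * tailMass (p - 2) 1)) with hm | hm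
  · -- some star of tails of solitons of height `b` has the right mass
    obtain ⟨s, hs⟩ := exists_isTailPair_of_mass_le hp hb hμ hm
    rcases le_total a s with has | hsa
    · exact ⟨b, s, hs, (reducedEnergy_self_le_of_lt hp hq hb ha hB has hs.le).trans
        (lower b le_rfl)⟩
    · have hmass : tailMass (p - 2) (s / b) ≤ tailMass (p - 2) (a / b) :=
        (tailMass_strictMonoOn hα).monotoneOn
          ⟨div_nonneg hs.pos.le hb.le, (div_le_one hb).2 hs.le⟩
          ⟨div_nonneg ha.le hb.le, (div_le_one hb).2 hab⟩ (by gcongr)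
      obtain ⟨M, hbM, hM⟩ := exists_isTailPair_of_le_mass (N := N) hp hμ ha hab (by
        rw [← hs.mass_eq]
        gcongr)
      exact ⟨M, a, hM, (reducedEnergy_self_le hp (hb.trans_le hbM) ha.le hab).trans
        (lower M hbM)⟩
  · -- the star of half-solitons of height `b` has too little mass
    have hK : 0 < N * tailMass (p - 2) 1 := mul_pos hN' (tailMass_pos hα one_pos le_rfl)
    have htail := isTailPair_criticalHeight hp hp' hμ hN one_pos le_rfl
    have hX := criticalHeight_pos hp hμ hK
    have hcrit := criticalHeight_rpow hp hp' hμ hK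
    rw [one_mul] at htail
    set X := criticalHeight p μ (N * tailMass (p - 2) 1) with hX_def
    refine ⟨X, X, htail, ?_⟩
    refine le_trans ?_ ((reducedEnergy_self_le_of_lt hp hq hb ha hB hab le_rfl).trans
      (lower b le_rfl))
    rw [reducedEnergy_self hp hX, reducedEnergy_self hp hb]
    have hbX : b ≤ X := by
      rw [← hcrit] at hm
      exact (Real.rpow_le_rpow_iff hb.le hX.le (by linarith)).1 (le_of_mul_le_mul_right hm hK)
    have h₁ := heightEnergy_critical_le hp hp' hμ hX hcrit hb
    have h₂ : b ^ q / q ≤ X ^ q / q := by gcongr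
    linarith

end StarH1

section existence

variable {p q μ M s : ℝ} {N : ℕ}

/-- A star of tails is realised by a function on the star graph; its energy obeys the lower bounds
resulting from the calibrations of larger heights than the value at the vertex. -/
theorem IsTailPair.exists_starH1 (h : IsTailPair p N μ M s) (hp : 2 < p) :
    ∃ u : StarH1 N, u.mass = μ ∧ u.energy p q = reducedEnergy p q N μ M s s ∧
      ‖u.vertexValue‖ = s ∧ ∀ i x, 0 ≤ x → ‖u.toFun i x‖ ≤ s := by
  have hM : 0 < M := h.pos.trans_le h.le
  have hc : √(2 / p) ≠ 0 := (Real.sqrt_pos.2 (by positivity)).ne'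
  obtain ⟨y, hy, hys⟩ := exists_soliton_eq hp hM h.pos h.le
  have hmass : (solitonStar p M y hp hM hy (∅ : Finset (Fin N))).mass = μ := by
    rw [mass_solitonStar, hys, Finset.card_empty]
    rw [div_mul_eq_mul_div, div_eq_iff hc]
    push_cast
    linear_combination h.mass_eq
  refine ⟨solitonStar p M y hp hM hy ∅, hmass, ?_, ?_, fun i x hx => ?_⟩
  · rw [energy_solitonStar, hmass, hys, reducedEnergy, Finset.card_empty]
    push_cast
    ring
  · rw [norm_vertexValue_solitonStar, hys]
  · rw [norm_toFun_solitonStar, ← hys]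
    simp only [Finset.notMem_empty, if_false]
    have hanti : AntitoneOn (soliton p M) (Ici 0) := by
      refine antitoneOn_of_deriv_nonpos (convex_Ici 0) (continuous_soliton hp).continuousOn
        (fun x _ => (hasDerivAt_soliton hp x).differentiableAt.differentiableWithinAt)
        fun x hx => ?_
      rw [interior_Ici] at hx
      rw [(hasDerivAt_soliton hp x).deriv]
      exact solitonDeriv_nonpos hp hM (mem_Ioi.1 hx).le
    exact hanti hy (add_nonneg hx hy) (by linarith)

/-- The energy of a star of tails, as compared with the calibration of another height. -/
theorem IsTailPair.reducedEnergy_le (h : IsTailPair p N μ M s) (hp : 2 < p) (hN : 1 ≤ N) {M' : ℝ}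
    (hM' : s ≤ M') : reducedEnergy p q N μ M' s s ≤ reducedEnergy p q N μ M s s := by
  obtain ⟨u, hm, he, hv, hle⟩ := h.exists_starH1 (q := q) hp
  have h₁ := u.reducedEnergy_le_energy (q := q) hp (h.pos.trans_le hM')
    (fun j x hx => (hle j x hx).trans hM') (i := ⟨0, hN⟩) le_rfl
  rwa [hm, he, u.toFun_zero, hv] at h₁

/-- The energy of the soliton on the line can be approximated by functions on the star graph: the
peak of the soliton escapes to infinity along one half-line. -/
theorem exists_energy_le_lineLevel_add (hp : 2 < p) (hp' : p < 6) (hq : 2 < q) (hμ : 0 < μ)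
    (hN : 2 ≤ N) {ε : ℝ} (hε : 0 < ε) :
    ∃ u : StarH1 N, u.mass = μ ∧ u.energy p q ≤ lineLevel p μ + ε := by
  have hα : 0 < p - 2 := by linarith
  have hN' : (0 : ℝ) ≤ N - 2 := by
    have : (2 : ℝ) ≤ N := by exact_mod_cast hN
    linarith
  have hτ := tailMass_pos hα one_pos le_rfl
  have hc : 0 < √(2 / p) := Real.sqrt_pos.2 (by positivity)
  -- `κ r` is the normalised mass for the vertex value `r` times the height
  set κ : ℝ → ℝ := fun r => 2 * tailMass (p - 2) 1 + (N - 2) * tailMass (p - 2) r with hκ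
  set X : ℝ → ℝ := fun r => criticalHeight p μ (κ r) with hX
  set E : ℝ → ℝ := fun r => -(μ / p) * X r ^ (p - 2) + √(2 / p) * X r ^ (p / 2 + 1) *
    (2 * tailAction (p - 2) 1 + (N - 2) * tailAction (p - 2) r) - (r * X r) ^ q / q with hE
  have hκc : Continuous κ :=
    continuous_const.add (continuous_const.mul (continuous_tailMass hα))
  have hκ0 : κ 0 = 2 * tailMass (p - 2) 1 := by simp [hκ]
  have hXc : ContinuousAt X 0 := by
    refine ContinuousAt.rpow_const (ContinuousAt.div continuousAt_const hκc.continuousAt ?_)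
      (Or.inl ?_)
    · rw [hκ0]
      positivity
    · rw [hκ0]
      positivity
  have hX0 : 0 < X 0 := criticalHeight_pos hp hμ (by rw [hκ0]; positivity)
  have hEc : ContinuousAt E 0 := by
    refine (((continuousAt_const.mul (hXc.rpow_const (Or.inl hX0.ne'))).add
      ((continuousAt_const.mul (hXc.rpow_const (Or.inl hX0.ne'))).mul
        (continuous_const.add (continuous_const.mul
          (continuous_tailAction hα))).continuousAt)).sub
      (((continuousAt_id.mul hXc).rpow_const (Or.inr (by linarith))).div_const _))
  have hE0 : E 0 = lineLevel p μ := by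
    have h1 := tailAction_one hα
    have h2 : tailAction (p - 2) 1 = (p - 2) / (p + 2) * tailMass (p - 2) 1 := by
      have : p + 2 ≠ 0 := by linarith
      field_simp
      linarith
    simp only [hE, hX, hκ0, zero_mul, Real.zero_rpow (show q ≠ 0 by linarith), tailAction_zero]
    rw [lineLevel, heightEnergy, h2]
    ring
  have hev : ∀ᶠ r in 𝓝[>] (0 : ℝ), E r < lineLevel p μ + ε :=
    (hEc.eventually (gt_mem_nhds (by rw [hE0]; linarith))).filter_mono nhdsWithin_le_nhds
  have hev1 : ∀ᶠ r in 𝓝[>] (0 : ℝ), r ∈ Ioo (0 : ℝ) 1 := Ioo_mem_nhdsGT one_pos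
  obtain ⟨r, hr, hr0, hr1⟩ := (hev.and hev1).exists
  have hκr : 0 < κ r := by
    have := tailMass_pos hα hr0 hr1.le
    simp only [hκ]
    positivity
  have hXr : 0 < X r := criticalHeight_pos hp hμ hκr
  obtain ⟨y, hy, hys⟩ := exists_soliton_eq hp hXr (s := r * X r) (by positivity)
    (mul_le_of_le_one_left hXr.le hr1.le)
  have hdiv : r * X r / X r = r := mul_div_cancel_right₀ _ hXr.ne'
  set S : Finset (Fin N) := {⟨0, by lia⟩} with hS
  have hcard : S.card = 1 := by simp [hS]
  have hmass : (solitonStar p (X r) y hp hXr hy S).mass = μ := by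
    rw [mass_solitonStar, hys, hdiv, hcard]
    have := criticalHeight_rpow hp hp' hμ hκr
    change X r ^ (3 - p / 2) * κ r = _ at this
    have h3 : 2 * ((1 : ℕ) : ℝ) * tailMass (p - 2) 1
        + (N - 2 * ((1 : ℕ) : ℝ)) * tailMass (p - 2) r = κ r := by
      simp only [hκ]
      push_cast
      ring
    rw [h3, div_mul_eq_mul_div, this]
    field_simp
  refine ⟨solitonStar p (X r) y hp hXr hy S, hmass, ?_⟩
  rw [energy_solitonStar, hmass, hys, hcard]
  refine le_trans (le_of_eq ?_) hr.le
  simp only [hE, calibration, hdiv, div_self hXr.ne']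
  push_cast
  ring

end existence

/-! ### Scaling and the energy of stars of tails -/

/-- The height, for mass `1 / √(2 / p)`, of the solitons whose tails starting at `r` times the
height make up a star of tails. -/
noncomputable def tailHeight (p : ℝ) (N : ℕ) (r : ℝ) : ℝ :=
  (1 / (N * tailMass (p - 2) r)) ^ (1 / (3 - p / 2))

/-- The energy without the vertex term of the star of tails with mass `1 / √(2 / p)` and ratio `r`
between the vertex value and the height of the soliton. -/
noncomputable def tailBulkEnergy (p : ℝ) (N : ℕ) (r : ℝ) : ℝ :=
  -(√(2 / p) / 2) * tailHeight p N r ^ (p - 2)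
    + √(2 / p) * tailHeight p N r ^ (p / 2 + 1) * (N * tailAction (p - 2) r)

/-- The vertex term of the energy of the star of tails with mass `1 / √(2 / p)` and ratio `r`. -/
noncomputable def tailVertexEnergy (p q : ℝ) (N : ℕ) (r : ℝ) : ℝ :=
  (r * tailHeight p N r) ^ q / q

/-- The factor by which the heights of stars of tails of mass `μ` exceed those of mass
`1 / √(2 / p)`. -/
noncomputable def massScale (p μ : ℝ) : ℝ := (μ * √(2 / p)) ^ (1 / (3 - p / 2))

section scaling

variable {p q μ K M s r : ℝ} {N : ℕ}

theorem sqrt_two_div_pos (hp : 2 < p) : 0 < √(2 / p) := Real.sqrt_pos.2 (by positivity)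

theorem massScale_pos (hp : 2 < p) (hμ : 0 < μ) : 0 < massScale p μ := by
  have := sqrt_two_div_pos hp
  exact Real.rpow_pos_of_pos (by positivity) _

theorem massScale_rpow (hp : 2 < p) (hp' : p < 6) (hμ : 0 < μ) :
    massScale p μ ^ (3 - p / 2) = μ * √(2 / p) := by
  have := sqrt_two_div_pos hp
  have hγ : 3 - p / 2 ≠ 0 := by linarith
  rw [massScale, ← Real.rpow_mul (by positivity), one_div, inv_mul_cancel₀ hγ, Real.rpow_one]

theorem criticalHeight_eq_massScale_mul (hp : 2 < p) (hμ : 0 < μ) (hK : 0 < K) :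
    criticalHeight p μ K = massScale p μ * (1 / K) ^ (1 / (3 - p / 2)) := by
  have := sqrt_two_div_pos hp
  rw [criticalHeight, massScale, ← Real.mul_rpow (by positivity) (by positivity)]
  congr 1
  ring

theorem tailHeight_pos (hp : 2 < p) (hN : 1 ≤ N) (hr : 0 < r) (hr1 : r ≤ 1) :
    0 < tailHeight p N r := by
  have hN' : (0 : ℝ) < N := by exact_mod_cast hN
  have := tailMass_pos (α := p - 2) (by linarith) hr hr1
  exact Real.rpow_pos_of_pos (by positivity) _

theorem tailHeight_rpow (hp : 2 < p) (hp' : p < 6) (hN : 1 ≤ N) (hr : 0 < r) (hr1 : r ≤ 1) :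
    tailHeight p N r ^ (3 - p / 2) = 1 / (N * tailMass (p - 2) r) := by
  have hN' : (0 : ℝ) < N := by exact_mod_cast hN
  have := tailMass_pos (α := p - 2) (by linarith) hr hr1
  have hγ : 3 - p / 2 ≠ 0 := by linarith
  rw [tailHeight, ← Real.rpow_mul (by positivity), one_div (3 - p / 2), inv_mul_cancel₀ hγ,
    Real.rpow_one]

/-- Stars of tails are parametrised by the ratio of the vertex value and the height. -/
theorem isTailPair_iff (hp : 2 < p) (hp' : p < 6) (hμ : 0 < μ) (hN : 1 ≤ N) :
    IsTailPair p N μ M s ↔ ∃ r, 0 < r ∧ r ≤ 1 ∧ M = massScale p μ * tailHeight p N r ∧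
      s = r * (massScale p μ * tailHeight p N r) := by
  have hN' : (0 : ℝ) < N := by exact_mod_cast hN
  have hγ : 3 - p / 2 ≠ 0 := by linarith
  constructor
  · intro h
    have hM := h.pos.trans_le h.le
    have hr : 0 < s / M := div_pos h.pos hM
    have hr1 : s / M ≤ 1 := (div_le_one hM).2 h.le
    have hτ := tailMass_pos (α := p - 2) (by linarith) hr hr1
    have e : M = massScale p μ * tailHeight p N (s / M) := by
      have h₁ : M ^ (3 - p / 2) = (massScale p μ * tailHeight p N (s / M)) ^ (3 - p / 2) := by
        rw [Real.mul_rpow (massScale_pos hp hμ).le (tailHeight_pos hp hN hr hr1).le,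
          massScale_rpow hp hp' hμ, tailHeight_rpow hp hp' hN hr hr1, ← h.mass_eq]
        field_simp
      exact (Real.rpow_left_inj hM.le
        (mul_pos (massScale_pos hp hμ) (tailHeight_pos hp hN hr hr1)).le hγ).1 h₁
    refine ⟨s / M, hr, hr1, e, ?_⟩
    rw [← e]
    field_simp
  · rintro ⟨r, hr, hr1, rfl, rfl⟩
    have hτ := tailMass_pos (α := p - 2) (by linarith) hr hr1
    have h := isTailPair_criticalHeight hp hp' hμ hN hr hr1
    rwa [criticalHeight_eq_massScale_mul hp hμ (by positivity)] at h

theorem massScale_rpow_mul (hp : 2 < p) (hp' : p < 6) (hμ : 0 < μ) :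
    massScale p μ ^ (p / 2 + 1) = μ * √(2 / p) * massScale p μ ^ (p - 2) := by
  rw [← massScale_rpow hp hp' hμ, ← Real.rpow_add (massScale_pos hp hμ)]
  ring_nf

theorem div_eq_mul_sqrt (hp : 2 < p) (μ : ℝ) : μ / p = μ * √(2 / p) * (√(2 / p) / 2) := by
  have h : √(2 / p) ^ 2 = 2 / p := Real.sq_sqrt (by positivity)
  linear_combination (-(μ / 2)) * h

theorem heightEnergy_massScale_mul (hp : 2 < p) (hp' : p < 6) (hμ : 0 < μ) {X : ℝ} (hX : 0 ≤ X) :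
    heightEnergy p μ K (massScale p μ * X) =
      massScale p μ ^ (p / 2 + 1) * heightEnergy p (1 / √(2 / p)) K X := by
  have hc := sqrt_two_div_pos hp
  have hs := massScale_pos hp hμ
  rw [heightEnergy, heightEnergy, Real.mul_rpow hs.le hX, Real.mul_rpow hs.le hX,
    div_eq_mul_sqrt hp μ, div_eq_mul_sqrt hp (1 / √(2 / p)), one_div, inv_mul_cancel₀ hc.ne',
    massScale_rpow_mul hp hp' hμ]
  ring

theorem lineLevel_eq_massScale (hp : 2 < p) (hp' : p < 6) (hμ : 0 < μ) :
    lineLevel p μ = massScale p μ ^ (p / 2 + 1) * lineLevel p (1 / √(2 / p)) := by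
  have hc := sqrt_two_div_pos hp
  have hτ := tailMass_pos (α := p - 2) (by linarith) one_pos le_rfl
  have h1 : massScale p (1 / √(2 / p)) = 1 := by
    rw [massScale, one_div_mul_cancel hc.ne', Real.one_rpow]
  rw [lineLevel, criticalHeight_eq_massScale_mul hp hμ (by positivity),
    heightEnergy_massScale_mul hp hp' hμ (by positivity), lineLevel,
    criticalHeight_eq_massScale_mul hp (by positivity) (by positivity), h1, one_mul]

theorem reducedEnergy_tail (hp : 2 < p) (hp' : p < 6) (hμ : 0 < μ) (hN : 1 ≤ N) (hr : 0 < r)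
    (hr1 : r ≤ 1) :
    reducedEnergy p q N μ (massScale p μ * tailHeight p N r)
      (r * (massScale p μ * tailHeight p N r)) (r * (massScale p μ * tailHeight p N r))
    = massScale p μ ^ (p / 2 + 1) * tailBulkEnergy p N r
      - massScale p μ ^ q * tailVertexEnergy p q N r := by
  have hs := massScale_pos hp hμ
  have hX := tailHeight_pos hp hN hr hr1
  have e : r * (massScale p μ * tailHeight p N r)
      = massScale p μ * (r * tailHeight p N r) := by ring
  rw [reducedEnergy, calibration, mul_div_cancel_right₀ _ (mul_pos hs hX).ne', e,
    Real.mul_rpow hs.le (by positivity), Real.mul_rpow hs.le (by positivity),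
    Real.mul_rpow hs.le (by positivity), div_eq_mul_sqrt hp μ, tailBulkEnergy, tailVertexEnergy,
    massScale_rpow_mul hp hp' hμ]
  ring

theorem lineLevel_neg (hp : 2 < p) (hp' : p < 6) (hμ : 0 < μ) : lineLevel p μ < 0 := by
  have hτ := tailMass_pos (α := p - 2) (by linarith) one_pos le_rfl
  have hK : 0 < 2 * tailMass (p - 2) 1 := by positivity
  have hX := criticalHeight_pos hp hμ hK
  have h := criticalHeight_rpow hp hp' hμ hK
  rw [lineLevel, heightEnergy]
  set X := criticalHeight p μ (2 * tailMass (p - 2) 1)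
  have e : X ^ (p / 2 + 1) = X ^ (p - 2) * X ^ (3 - p / 2) := by
    rw [← Real.rpow_add hX]
    ring_nf
  have hc : √(2 / p) ^ 2 = 2 / p := Real.sq_sqrt (by positivity)
  have e' : √(2 / p) * ((p - 2) / (p + 2)) * (2 * tailMass (p - 2) 1) * X ^ (p / 2 + 1)
      = μ / p * X ^ (p - 2) * (2 * (p - 2) / (p + 2)) := by
    rw [e]
    calc _ = √(2 / p) * ((p - 2) / (p + 2)) * X ^ (p - 2)
          * (X ^ (3 - p / 2) * (2 * tailMass (p - 2) 1)) := by ring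
      _ = √(2 / p) ^ 2 * μ * ((p - 2) / (p + 2)) * X ^ (p - 2) := by
          rw [h]
          ring
      _ = _ := by
          rw [hc]
          ring
  rw [e']
  have h1 : 2 * (p - 2) / (p + 2) < 1 := (div_lt_one (by linarith)).2 (by linarith)
  have h2 : 0 < μ / p * X ^ (p - 2) := by
    have := Real.rpow_pos_of_pos hX (p - 2)
    positivity
  nlinarith

end scaling

section asymptotics

variable {p q r : ℝ} {N : ℕ}

theorem tailVertexEnergy_pos (hp : 2 < p) (hq : 2 < q) (hN : 1 ≤ N) (hr : 0 < r) (hr1 : r ≤ 1) :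
    0 < tailVertexEnergy p q N r := by
  have := tailHeight_pos hp hN hr hr1
  have := Real.rpow_pos_of_pos (mul_pos hr this) q
  unfold tailVertexEnergy
  positivity

theorem continuousOn_tailHeight (hp : 2 < p) (hN : 1 ≤ N) :
    ContinuousOn (tailHeight p N) (Ioc 0 1) := by
  have hN' : (0 : ℝ) < N := by exact_mod_cast hN
  intro r hr
  have hτ := tailMass_pos (α := p - 2) (by linarith) hr.1 hr.2
  refine (ContinuousAt.rpow_const (ContinuousAt.div continuousAt_const
    (continuous_const.mul (continuous_tailMass (by linarith))).continuousAt (mul_pos hN' hτ).ne')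
    (Or.inl (one_div_pos.2 (mul_pos hN' hτ)).ne')).continuousWithinAt

theorem continuousOn_tailBulkEnergy (hp : 2 < p) (hN : 1 ≤ N) :
    ContinuousOn (tailBulkEnergy p N) (Ioc 0 1) := by
  have h := continuousOn_tailHeight hp hN
  have h0 : ∀ r ∈ Ioc (0 : ℝ) 1, tailHeight p N r ≠ 0 := fun r hr =>
    (tailHeight_pos hp hN hr.1 hr.2).ne'
  exact (continuousOn_const.mul (h.rpow_const fun r hr => Or.inl (h0 r hr))).add
    ((continuousOn_const.mul (h.rpow_const fun r hr => Or.inl (h0 r hr))).mul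
      (continuous_const.mul (continuous_tailAction (by linarith))).continuousOn)

theorem continuousOn_tailVertexEnergy (hp : 2 < p) (hq : 2 < q) (hN : 1 ≤ N) :
    ContinuousOn (tailVertexEnergy p q N) (Ioc 0 1) :=
  ((continuousOn_id.mul (continuousOn_tailHeight hp hN)).rpow_const
    fun _ _ => Or.inr (by linarith)).div_const _

theorem tendsto_sqrt_one_sub_rpow {α : ℝ} (hα : 0 < α) :
    Tendsto (fun r : ℝ => √(1 - r ^ α)) (𝓝[>] 0) (𝓝 1) := by
  have h : Continuous fun r : ℝ => √(1 - r ^ α) :=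
    (continuous_const.sub (Real.continuous_rpow_const hα.le)).sqrt
  have := h.tendsto 0
  rw [Real.zero_rpow hα.ne', sub_zero, Real.sqrt_one] at this
  exact this.mono_left nhdsWithin_le_nhds

theorem tendsto_tailAction_div {α : ℝ} (hα : 0 < α) :
    Tendsto (fun r => tailAction α r / r ^ 2) (𝓝[>] 0) (𝓝 (1 / 2)) := by
  have h := (tendsto_sqrt_one_sub_rpow hα).const_mul (1 / 2)
  rw [mul_one] at h
  refine tendsto_of_tendsto_of_tendsto_of_le_of_le' h tendsto_const_nhds ?_ ?_
  · filter_upwards [self_mem_nhdsWithin] with r hr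
    have hr0 : 0 < r := hr
    rw [le_div_iff₀ (by positivity)]
    have := le_tailAction hα hr0.le
    linarith
  · filter_upwards [self_mem_nhdsWithin] with r hr
    have hr0 : 0 < r := hr
    rw [div_le_iff₀ (by positivity)]
    have := tailAction_le hα hr0.le
    linarith

theorem tendsto_tailMass_div {α : ℝ} (hα : 0 < α) :
    Tendsto (fun r => tailMass α r / r ^ 2) (𝓝[>] 0) (𝓝 (1 / 2)) := by
  have h := (((tendsto_tailAction_div hα).const_mul (α + 4)).sub
    ((tendsto_sqrt_one_sub_rpow hα).const_mul 2)).div_const α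
  have e : ((α + 4) * (1 / 2) - 2 * 1) / α = 1 / 2 := by
    field_simp
    ring
  rw [e] at h
  refine h.congr' ?_
  filter_upwards [self_mem_nhdsWithin] with r hr
  have hr0 : r ≠ 0 := (mem_Ioi.1 hr).ne'
  rw [tailMass]
  field_simp

/-- For `q < 4` the vertex term is negligible in comparison with the bulk energy when all the mass
concentrates at the vertex. -/
theorem tendsto_tailBulkEnergy_div (hp : 2 < p) (hp' : p < 6) (hq : 2 < q) (hq' : q < 4)
    (hN : 1 ≤ N) : Tendsto (fun r => tailBulkEnergy p N r / tailVertexEnergy p q N r)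
      (𝓝[>] 0) atTop := by
  have hα : 0 < p - 2 := by linarith
  have hγ : 0 < 3 - p / 2 := by linarith
  have hN' : (0 : ℝ) < N := by exact_mod_cast hN
  have hc := sqrt_two_div_pos hp
  -- the bulk energy grows like `r ^ (-2 (p - 2) / (3 - p / 2))`, the vertex term like
  -- `r ^ (q - 2 q / (3 - p / 2))`
  set e : ℝ := q + 2 / (3 - p / 2) * (p - 2 - q) with he
  have hepos : 0 < e := by
    have : e = (p - 2) * (2 - q / 2) / (3 - p / 2) := by
      rw [he, eq_div_iff hγ.ne']
      linear_combination (p - 2 - q) * div_mul_cancel₀ (2 : ℝ) hγ.ne'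
    rw [this]
    exact div_pos (mul_pos hα (by linarith)) hγ
  have hτ := tendsto_tailMass_div hα
  have hw : Tendsto (fun r => (N * (tailMass (p - 2) r / r ^ 2))⁻¹ ^ (1 / (3 - p / 2)))
      (𝓝[>] 0) (𝓝 ((N * (1 / 2) : ℝ)⁻¹ ^ (1 / (3 - p / 2)))) :=
    ((hτ.const_mul (N : ℝ)).inv₀ (by positivity)).rpow_const (Or.inl (by positivity))
  have hw' := hw.rpow_const (p := p - 2 - q)
    (Or.inl (Real.rpow_pos_of_pos (by positivity) _).ne')
  have hb : Tendsto (fun r => -(√(2 / p) / 2) + √(2 / p) *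
      ((tailAction (p - 2) r / r ^ 2) / (tailMass (p - 2) r / r ^ 2))) (𝓝[>] 0)
      (𝓝 (-(√(2 / p) / 2) + √(2 / p) * ((1 / 2) / (1 / 2)))) :=
    (((tendsto_tailAction_div hα).div hτ (by norm_num)).const_mul _).const_add _
  have hinv : Tendsto (fun r : ℝ => (r ^ e)⁻¹) (𝓝[>] 0) atTop := by
    refine Tendsto.inv_tendsto_nhdsGT_zero (tendsto_nhdsWithin_iff.2 ⟨?_, ?_⟩)
    · have := (Real.continuous_rpow_const hepos.le).tendsto 0
      rw [Real.zero_rpow hepos.ne'] at this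
      exact this.mono_left nhdsWithin_le_nhds
    · filter_upwards [self_mem_nhdsWithin] with r hr
      exact Real.rpow_pos_of_pos hr _
  have hlim := Tendsto.pos_mul_atTop (C := q * ((N * (1 / 2) : ℝ)⁻¹ ^ (1 / (3 - p / 2)))
    ^ (p - 2 - q) * (-(√(2 / p) / 2) + √(2 / p) * ((1 / 2) / (1 / 2))))
    (by
      have h1 : 0 < ((N * (1 / 2) : ℝ)⁻¹ ^ (1 / (3 - p / 2))) ^ (p - 2 - q) :=
        Real.rpow_pos_of_pos (Real.rpow_pos_of_pos (by positivity) _) _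
      have h2 : -(√(2 / p) / 2) + √(2 / p) * ((1 / 2) / (1 / 2)) = √(2 / p) / 2 := by
        norm_num
        ring
      rw [h2]
      positivity) ((hw'.const_mul q).mul hb) hinv
  refine hlim.congr' ?_
  filter_upwards [Ioo_mem_nhdsGT one_pos] with r hr
  have hr0 : 0 < r := hr.1
  have hτr := tailMass_pos hα hr.1 hr.2.le
  have hX := tailHeight_pos hp hN hr.1 hr.2.le
  have hXγ := tailHeight_rpow hp hp' hN hr.1 hr.2.le
  -- everything in terms of quotients that converge
  have e₁ : (N * (tailMass (p - 2) r / r ^ 2))⁻¹ ^ (1 / (3 - p / 2))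
      = tailHeight p N r * r ^ (2 / (3 - p / 2)) := by
    have : (N * (tailMass (p - 2) r / r ^ 2))⁻¹ = 1 / (N * tailMass (p - 2) r) * r ^ (2 : ℝ) := by
      rw [Real.rpow_two]
      field_simp
    rw [this, Real.mul_rpow (by positivity) (by positivity), ← tailHeight, ← Real.rpow_mul hr0.le]
    congr 2
    ring
  have e₂ : tailHeight p N r ^ (p / 2 + 1)
      = tailHeight p N r ^ (p - 2) * (1 / (N * tailMass (p - 2) r)) := by
    rw [← hXγ, ← Real.rpow_add hX]
    ring_nf
  have e₃ : tailBulkEnergy p N r = tailHeight p N r ^ (p - 2) * (-(√(2 / p) / 2) + √(2 / p) *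
      ((tailAction (p - 2) r / r ^ 2) / (tailMass (p - 2) r / r ^ 2))) := by
    rw [tailBulkEnergy, e₂]
    field_simp
  have e₄ : (tailHeight p N r * r ^ (2 / (3 - p / 2))) ^ (p - 2 - q) * (r ^ e)⁻¹
      = tailHeight p N r ^ (p - 2) / (r * tailHeight p N r) ^ q := by
    rw [Real.mul_rpow hX.le (by positivity), ← Real.rpow_mul hr0.le, Real.mul_rpow hr0.le hX.le,
      he, Real.rpow_add hr0, Real.rpow_sub hX]
    have h1 := (Real.rpow_pos_of_pos hr0 (2 / (3 - p / 2) * (p - 2 - q))).ne'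
    have h2 := (Real.rpow_pos_of_pos hr0 q).ne'
    have h3 := (Real.rpow_pos_of_pos hX q).ne'
    field_simp
  rw [e₁, e₃, tailVertexEnergy]
  have h4 := (Real.rpow_pos_of_pos (mul_pos hr0 hX) q).ne'
  have hq0 : q ≠ 0 := by linarith
  calc _ = q * ((tailHeight p N r * r ^ (2 / (3 - p / 2))) ^ (p - 2 - q) * (r ^ e)⁻¹) *
        (-(√(2 / p) / 2) + √(2 / p) *
          ((tailAction (p - 2) r / r ^ 2) / (tailMass (p - 2) r / r ^ 2))) := by ring
    _ = _ := by
      rw [e₄]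
      generalize (-(√(2 / p) / 2) + √(2 / p) *
          ((tailAction (p - 2) r / r ^ 2) / (tailMass (p - 2) r / r ^ 2))) = D
      field_simp

/-- A function on `(0, 1]` that is continuous and tends to infinity at `0` attains its minimum. -/
theorem exists_isMinOn_Ioc_of_tendsto_atTop {f : ℝ → ℝ} (hf : ContinuousOn f (Ioc 0 1))
    (hlim : Tendsto f (𝓝[>] 0) atTop) : ∃ r ∈ Ioc (0 : ℝ) 1, ∀ s ∈ Ioc (0 : ℝ) 1, f r ≤ f s := by
  have hev := hlim.eventually (eventually_ge_atTop (f 1))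
  obtain ⟨ρ, hρ, hsub⟩ := mem_nhdsGT_iff_exists_Ioo_subset.1 hev
  have hρ0 : 0 < ρ := hρ
  have hmin : 0 < min (ρ / 2) 1 := lt_min (by linarith) one_pos
  obtain ⟨r, hr, hmin'⟩ := isCompact_Icc.exists_isMinOn (s := Icc (min (ρ / 2) 1) 1)
    ⟨1, min_le_right _ _, le_rfl⟩ (hf.mono fun x hx => ⟨hmin.trans_le hx.1, hx.2⟩)
  refine ⟨r, ⟨hmin.trans_le hr.1, hr.2⟩, fun s hs => ?_⟩
  rcases le_total (min (ρ / 2) 1) s with h | h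
  · exact hmin' ⟨h, hs.2⟩
  · refine le_trans (hmin' ⟨min_le_right _ _, le_rfl⟩) ?_
    refine hsub ⟨hs.1, ?_⟩
    have := h.trans (min_le_left _ _)
    linarith

end asymptotics

/-! ### Existence of ground states in terms of stars of tails -/

section groundState

variable {p q μ : ℝ} {N : ℕ}

theorem isGroundState_of_forall_le {u : StarH1 N} (hu : u.mass = μ)
    (h : ∀ v : StarH1 N, v.mass = μ → u.energy p q ≤ v.energy p q) : IsGroundState p q μ u := by
  refine ⟨hu, le_antisymm (le_iInf fun v => ?_) (iInf_le_of_le ⟨u, hu⟩ le_rfl)⟩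
  exact EReal.coe_le_coe_iff.2 (h v.1 v.2)

theorem IsGroundState.energy_le {u v : StarH1 N} (hu : IsGroundState p q μ u) (hv : v.mass = μ) :
    u.energy p q ≤ v.energy p q := by
  have h : ((u.energy p q : ℝ) : EReal) ≤ v.energy p q := by
    rw [hu.2]
    exact iInf_le_of_le ⟨v, hv⟩ le_rfl
  exact EReal.coe_le_coe_iff.1 h

/-- If some star of tails does not have more energy than the soliton on the line, then the star of
tails of least energy is a ground state. -/
theorem exists_isGroundState_of_isTailPair (hp : 2 < p) (hp' : p < 6) (hq : 2 < q) (hq' : q < 4)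
    (hμ : 0 < μ) (hN : 1 ≤ N) {M s : ℝ} (h : IsTailPair p N μ M s)
    (hle : reducedEnergy p q N μ M s s ≤ lineLevel p μ) :
    ∃ u : StarH1 N, IsGroundState p q μ u := by
  have hs := massScale_pos hp hμ
  set E : ℝ → ℝ := fun r => massScale p μ ^ (p / 2 + 1) * tailBulkEnergy p N r
      - massScale p μ ^ q * tailVertexEnergy p q N r with hE
  have hEc : ContinuousOn E (Ioc 0 1) :=
    (continuousOn_const.mul (continuousOn_tailBulkEnergy hp hN)).sub
      (continuousOn_const.mul (continuousOn_tailVertexEnergy hp hq hN))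
  have hev : ∀ᶠ r in 𝓝[>] (0 : ℝ), 0 < E r := by
    filter_upwards [(tendsto_tailBulkEnergy_div hp hp' hq hq' hN).eventually
      (eventually_gt_atTop (massScale p μ ^ q / massScale p μ ^ (p / 2 + 1))),
      Ioo_mem_nhdsGT one_pos] with r hr hr'
    have hB := tailVertexEnergy_pos hp hq hN hr'.1 hr'.2.le
    have h1 : 0 < massScale p μ ^ (p / 2 + 1) := Real.rpow_pos_of_pos hs _
    rw [div_lt_div_iff₀ h1 hB] at hr
    simp only [hE]
    linarith
  obtain ⟨ρ, hρ, hsub⟩ := mem_nhdsGT_iff_exists_Ioo_subset.1 hev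
  have hρ0 : 0 < ρ := hρ
  obtain ⟨r₁, hr₁, hr₁', hM, hs₁⟩ := (isTailPair_iff hp hp' hμ hN).1 h
  have hE₁ : E r₁ ≤ lineLevel p μ := by
    rw [hM, hs₁, reducedEnergy_tail hp hp' hμ hN hr₁ hr₁'] at hle
    exact hle
  have hneg := lineLevel_neg hp hp' hμ
  have hρr : ∀ r, 0 < r → E r ≤ 0 → ρ / 2 ≤ r := fun r hr hEr => by
    by_contra! hcon
    have : 0 < E r := hsub ⟨hr, by linarith⟩
    linarith
  obtain ⟨r₀, hr₀, hmin⟩ := isCompact_Icc.exists_isMinOn (s := Icc (ρ / 2) 1)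
    ⟨r₁, hρr r₁ hr₁ (by linarith), hr₁'⟩ (hEc.mono fun x hx => ⟨by linarith [hx.1], hx.2⟩)
  have hr₀0 : 0 < r₀ := by linarith [hr₀.1]
  have hE₀ : E r₀ ≤ lineLevel p μ := (hmin ⟨hρr r₁ hr₁ (by linarith), hr₁'⟩).trans hE₁
  have hall : ∀ r, 0 < r → r ≤ 1 → E r₀ ≤ E r := fun r hr hr1 => by
    rcases le_total (E r) 0 with h0 | h0
    · exact hmin ⟨hρr r hr h0, hr1⟩
    · linarith
  have htail : IsTailPair p N μ (massScale p μ * tailHeight p N r₀)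
      (r₀ * (massScale p μ * tailHeight p N r₀)) :=
    (isTailPair_iff hp hp' hμ hN).2 ⟨r₀, hr₀0, hr₀.2, rfl, rfl⟩
  obtain ⟨u, hum, hue, -, -⟩ := htail.exists_starH1 (q := q) hp
  rw [reducedEnergy_tail hp hp' hμ hN hr₀0 hr₀.2] at hue
  refine ⟨u, isGroundState_of_forall_le hum fun v hv => ?_⟩
  rw [hue]
  rcases v.lineLevel_lt_energy_or_exists_isTailPair (q := q) hN hp hp' hq (by rw [hv]; exact hμ)
    with h1 | ⟨M', s', h1, h2⟩
  · rw [hv] at h1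
    exact hE₀.trans h1.le
  · rw [hv] at h1 h2
    obtain ⟨r, hr, hr1, rfl, rfl⟩ := (isTailPair_iff hp hp' hμ hN).1 h1
    rw [reducedEnergy_tail hp hp' hμ hN hr hr1] at h2
    exact (hall r hr hr1).trans h2

/-- On a star with at least two half-lines, the energy of a ground state does not exceed that of
the soliton on the line, so that some star of tails does not exceed it either. -/
theorem IsGroundState.exists_isTailPair (hp : 2 < p) (hp' : p < 6) (hq : 2 < q)
    (hμ : 0 < μ) (hN : 2 ≤ N) {u : StarH1 N} (hu : IsGroundState p q μ u) :
    ∃ M s, IsTailPair p N μ M s ∧ reducedEnergy p q N μ M s s ≤ lineLevel p μ := by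
  have hle : u.energy p q ≤ lineLevel p μ := le_of_forall_pos_le_add fun ε hε => by
    obtain ⟨v, hv, hve⟩ := exists_energy_le_lineLevel_add hp hp' hq hμ hN hε
    exact (hu.energy_le hv).trans hve
  rcases u.lineLevel_lt_energy_or_exists_isTailPair (q := q) (by lia) hp hp' hq
    (by rw [hu.1]; exact hμ) with h | ⟨M, s, h, h'⟩
  · rw [hu.1] at h
    linarith
  · rw [hu.1] at h h'
    exact ⟨M, s, h, h'.trans hle⟩

theorem exists_isGroundState_iff (hp : 2 < p) (hp' : p < 6) (hq : 2 < q) (hq' : q < 4)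
    (hμ : 0 < μ) (hN : 2 ≤ N) : (∃ u : StarH1 N, IsGroundState p q μ u) ↔
      ∃ M s, IsTailPair p N μ M s ∧ reducedEnergy p q N μ M s s ≤ lineLevel p μ :=
  ⟨fun ⟨_, hu⟩ => hu.exists_isTailPair hp hp' hq hμ hN,
    fun ⟨_, _, h, hle⟩ => exists_isGroundState_of_isTailPair hp hp' hq hq' hμ (by lia) h hle⟩

end groundState

/-! ### Thresholds -/

section threshold

variable {p q μ : ℝ} {N : ℕ}

/-- On a star with at least three half-lines, a star of tails has more bulk energy than the soliton
on the line. -/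
theorem lineLevel_lt_tailBulkEnergy (hp : 2 < p) (hp' : p < 6) (hN : 3 ≤ N) {r : ℝ}
    (hr : 0 < r) (hr1 : r ≤ 1) : lineLevel p (1 / √(2 / p)) < tailBulkEnergy p N r := by
  have hc := sqrt_two_div_pos hp
  have hα : 0 < p - 2 := by linarith
  have hμ : 0 < 1 / √(2 / p) := by positivity
  have hτ := tailMass_pos hα one_pos le_rfl
  have h1 : massScale p (1 / √(2 / p)) = 1 := by
    rw [massScale, one_div_mul_cancel hc.ne', Real.one_rpow]
  have hN1 : 1 ≤ N := by lia
  have htail : IsTailPair p N (1 / √(2 / p)) (tailHeight p N r) (r * tailHeight p N r) := by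
    refine (isTailPair_iff hp hp' hμ hN1).2 ⟨r, hr, hr1, ?_, ?_⟩ <;> rw [h1, one_mul]
  have hpos := htail.pos
  -- any vertex exponent can be used, as the vertex terms cancel
  have h := htail.reducedEnergy_le (q := 3) hp hN1 le_rfl
  have he := reducedEnergy_tail (q := 3) hp hp' hμ hN1 hr hr1
  rw [h1, one_mul, Real.one_rpow, Real.one_rpow, one_mul, one_mul] at he
  rw [he, reducedEnergy_self hp hpos, tailVertexEnergy] at h
  have h2 := lineLevel_le_heightEnergy hp hp' hμ hpos
  have h3 : heightEnergy p (1 / √(2 / p)) (2 * tailMass (p - 2) 1) (r * tailHeight p N r)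
      < heightEnergy p (1 / √(2 / p)) (N * tailMass (p - 2) 1) (r * tailHeight p N r) := by
    have hN' : (2 : ℝ) < N := by exact_mod_cast hN
    have h4 : 0 < (r * tailHeight p N r) ^ (p / 2 + 1) := Real.rpow_pos_of_pos hpos _
    have h5 : 0 < (p - 2) / (p + 2) := div_pos hα (by linarith)
    unfold heightEnergy
    gcongr
  linarith

/-- On a star with at least three half-lines there is a threshold for the strength
`massScale p μ ^ (q - (p / 2 + 1))` of the vertex term relative to the bulk energy, above which
ground states exist. -/
theorem exists_threshold (hp : 2 < p) (hp' : p < 6) (hq : 2 < q) (hq' : q < 4) (hN : 3 ≤ N) :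
    ∃ R : ℝ, 0 < R ∧ ∀ μ : ℝ, 0 < μ → ((∃ u : StarH1 N, IsGroundState p q μ u) ↔
      R ≤ massScale p μ ^ (q - (p / 2 + 1))) := by
  have hN1 : 1 ≤ N := by lia
  set ℓ := lineLevel p (1 / √(2 / p)) with hℓ
  have hc := sqrt_two_div_pos hp
  have hℓneg : ℓ < 0 := lineLevel_neg hp hp' (by positivity)
  set f : ℝ → ℝ := fun r => (tailBulkEnergy p N r - ℓ) / tailVertexEnergy p q N r with hf
  have hfc : ContinuousOn f (Ioc 0 1) :=
    ((continuousOn_tailBulkEnergy hp hN1).sub continuousOn_const).div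
      (continuousOn_tailVertexEnergy hp hq hN1)
      fun r hr => (tailVertexEnergy_pos hp hq hN1 hr.1 hr.2).ne'
  have hlim : Tendsto f (𝓝[>] 0) atTop := by
    refine tendsto_atTop_mono' _ ?_ (tendsto_tailBulkEnergy_div hp hp' hq hq' hN1)
    filter_upwards [Ioo_mem_nhdsGT one_pos] with r hr
    have := tailVertexEnergy_pos hp hq hN1 hr.1 hr.2.le
    simp only [hf]
    gcongr
    linarith
  obtain ⟨r₀, hr₀, hmin⟩ := exists_isMinOn_Ioc_of_tendsto_atTop hfc hlim
  refine ⟨f r₀, div_pos (sub_pos.2 (lineLevel_lt_tailBulkEnergy hp hp' hN hr₀.1 hr₀.2))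
    (tailVertexEnergy_pos hp hq hN1 hr₀.1 hr₀.2), fun μ hμ => ?_⟩
  have hs := massScale_pos hp hμ
  have key : ∀ r, 0 < r → r ≤ 1 → (massScale p μ ^ (p / 2 + 1) * tailBulkEnergy p N r
      - massScale p μ ^ q * tailVertexEnergy p q N r ≤ lineLevel p μ ↔
      f r ≤ massScale p μ ^ (q - (p / 2 + 1))) := fun r hr hr1 => by
    have hB := tailVertexEnergy_pos hp hq hN1 hr hr1
    have h1 : 0 < massScale p μ ^ (p / 2 + 1) := Real.rpow_pos_of_pos hs _
    rw [lineLevel_eq_massScale hp hp' hμ, ← hℓ, Real.rpow_sub hs]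
    simp only [hf]
    rw [div_le_div_iff₀ hB h1]
    constructor <;> intro h <;> linarith
  rw [exists_isGroundState_iff hp hp' hq hq' hμ (by lia)]
  constructor
  · rintro ⟨M, s, h, hle⟩
    obtain ⟨r, hr, hr1, rfl, rfl⟩ := (isTailPair_iff hp hp' hμ hN1).1 h
    rw [reducedEnergy_tail hp hp' hμ hN1 hr hr1, key r hr hr1] at hle
    exact (hmin r ⟨hr, hr1⟩).trans hle
  · intro hR
    refine ⟨_, _, (isTailPair_iff hp hp' hμ hN1).2 ⟨r₀, hr₀.1, hr₀.2, rfl, rfl⟩, ?_⟩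
    rw [reducedEnergy_tail hp hp' hμ hN1 hr₀.1 hr₀.2, key r₀ hr₀.1 hr₀.2]
    exact hR

theorem massScale_rpow_eq (hp : 2 < p) (hμ : 0 < μ) (e : ℝ) :
    massScale p μ ^ e = (μ * √(2 / p)) ^ (e / (3 - p / 2)) := by
  have hc := sqrt_two_div_pos hp
  rw [massScale, ← Real.rpow_mul (by positivity)]
  congr 1
  ring

/-- A power of `μ` with nonzero exponent crosses each positive level exactly once. -/
theorem exists_pos_massScale_rpow_eq (hp : 2 < p) (hp' : p < 6) {e R : ℝ} (he : e ≠ 0)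
    (hR : 0 < R) : ∃ μs, 0 < μs ∧ massScale p μs ^ e = R := by
  have hc := sqrt_two_div_pos hp
  have hγ : 3 - p / 2 ≠ 0 := by linarith
  have hpos : 0 < R ^ ((3 - p / 2) / e) := Real.rpow_pos_of_pos hR _
  refine ⟨R ^ ((3 - p / 2) / e) / √(2 / p), by positivity, ?_⟩
  rw [massScale_rpow_eq hp (by positivity), div_mul_cancel₀ _ hc.ne', ← Real.rpow_mul hR.le]
  have : (3 - p / 2) / e * (e / (3 - p / 2)) = 1 := by
    generalize 3 - p / 2 = g at hγ
    field_simp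
  rw [this, Real.rpow_one]

theorem massScale_lt_iff (hp : 2 < p) (hp' : p < 6) {μ ν : ℝ} (hμ : 0 < μ) (hν : 0 < ν) :
    massScale p μ < massScale p ν ↔ μ < ν := by
  have hc := sqrt_two_div_pos hp
  have hγ : 0 < 3 - p / 2 := by linarith
  rw [massScale, massScale, Real.rpow_lt_rpow_iff (by positivity) (by positivity) (by positivity),
    mul_lt_mul_iff_left₀ hc]

/-- If the standard nonlinearity is the stronger one, ground states exist for small mass only. -/
theorem exists_massThreshold_of_lt (hp : 2 < p) (hp' : p < 6) (hq : 2 < q) (hq' : q < 4)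
    (h : q < p / 2 + 1) (hN : 3 ≤ N) : ∃ μs : ℝ, 0 < μs ∧
      (∀ μ : ℝ, 0 < μ → μ ≤ μs → ∃ u : StarH1 N, IsGroundState p q μ u) ∧
      (∀ μ : ℝ, μs < μ → ¬ ∃ u : StarH1 N, IsGroundState p q μ u) := by
  obtain ⟨R, hR, hiff⟩ := exists_threshold hp hp' hq hq' hN
  have he : q - (p / 2 + 1) < 0 := by linarith
  obtain ⟨μs, hμs, heq⟩ := exists_pos_massScale_rpow_eq hp hp' he.ne hR
  refine ⟨μs, hμs, fun μ hμ hle => (hiff μ hμ).2 ?_, fun μ hlt hex => ?_⟩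
  · rw [← heq]
    refine Real.rpow_le_rpow_of_nonpos (massScale_pos hp hμ) ?_ he.le
    exact not_lt.1 fun hc => not_lt.2 hle ((massScale_lt_iff hp hp' hμs hμ).1 hc)
  · have hμ := hμs.trans hlt
    have h1 := (hiff μ hμ).1 hex
    rw [← heq] at h1
    exact not_lt.2 h1 (Real.rpow_lt_rpow_of_neg (massScale_pos hp hμs)
      ((massScale_lt_iff hp hp' hμs hμ).2 hlt) he)

/-- If the pointwise nonlinearity is the stronger one, ground states exist for large mass only. -/
theorem exists_massThreshold_of_gt (hp : 2 < p) (hp' : p < 6) (hq : 2 < q) (hq' : q < 4)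
    (h : p / 2 + 1 < q) (hN : 3 ≤ N) : ∃ μs : ℝ, 0 < μs ∧
      (∀ μ : ℝ, 0 < μ → μ < μs → ¬ ∃ u : StarH1 N, IsGroundState p q μ u) ∧
      (∀ μ : ℝ, μs ≤ μ → ∃ u : StarH1 N, IsGroundState p q μ u) := by
  obtain ⟨R, hR, hiff⟩ := exists_threshold hp hp' hq hq' hN
  have he : 0 < q - (p / 2 + 1) := by linarith
  obtain ⟨μs, hμs, heq⟩ := exists_pos_massScale_rpow_eq hp hp' he.ne' hR
  refine ⟨μs, hμs, fun μ hμ hlt hex => ?_, fun μ hle => ?_⟩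
  · have h1 := (hiff μ hμ).1 hex
    rw [← heq] at h1
    exact not_lt.2 h1 (Real.rpow_lt_rpow (massScale_pos hp hμ).le
      ((massScale_lt_iff hp hp' hμ hμs).2 hlt) he)
  · have hμ := hμs.trans_le hle
    refine (hiff μ hμ).2 ?_
    rw [← heq]
    refine Real.rpow_le_rpow (massScale_pos hp hμs).le ?_ he.le
    exact not_lt.1 fun hc => not_lt.2 hle ((massScale_lt_iff hp hp' hμ hμs).1 hc)

end threshold

/-! ### An inequality for integrals of powers of the cosine -/

section cosine

variable {k φ : ℝ}

theorem continuous_cos_rpow (hk : 0 ≤ k) : Continuous fun x : ℝ => Real.cos x ^ k :=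
  Real.continuous_cos.rpow_const fun _ => Or.inr hk

/-- The proportion of the integral of `cos ^ k` over `[0, π/2]` that comes from `[0, φ]` increases
with `k`, because the cosine is decreasing. -/
theorem integral_cos_rpow_le_of_pow {j : ℕ} (hjk : (j : ℝ) ≤ k) (hφ0 : 0 ≤ φ) (hφ : φ < Real.pi / 2)
    (h : ∫ x in φ..(Real.pi / 2), Real.cos x ^ j ≤ 2 * ∫ x in (0 : ℝ)..φ, Real.cos x ^ j) :
    ∫ x in φ..(Real.pi / 2), Real.cos x ^ k ≤ 2 * ∫ x in (0 : ℝ)..φ, Real.cos x ^ k := by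
  have hk : 0 ≤ k := (Nat.cast_nonneg j).trans hjk
  have hC : 0 < Real.cos φ := Real.cos_pos_of_mem_Ioo ⟨by linarith [Real.pi_pos], hφ⟩
  have split : ∀ x, 0 ≤ x → x < Real.pi / 2 →
      Real.cos x ^ k = Real.cos x ^ (k - j) * Real.cos x ^ j := fun x h0 hx => by
    have := Real.cos_pos_of_mem_Ioo ⟨by linarith [Real.pi_pos], hx⟩
    rw [← Real.rpow_natCast, ← Real.rpow_add this]
    ring_nf
  have hpow : Continuous fun x : ℝ => Real.cos φ ^ (k - j) * Real.cos x ^ j :=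
    continuous_const.mul (Real.continuous_cos.pow j)
  have h₁ : Real.cos φ ^ (k - j) * ∫ x in (0 : ℝ)..φ, Real.cos x ^ j
      ≤ ∫ x in (0 : ℝ)..φ, Real.cos x ^ k := by
    rw [← intervalIntegral.integral_const_mul]
    refine intervalIntegral.integral_mono_on hφ0 (hpow.intervalIntegrable _ _)
      ((continuous_cos_rpow hk).intervalIntegrable _ _) fun x hx => ?_
    rw [split x hx.1 (hx.2.trans_lt hφ)]
    have h2 : Real.cos φ ≤ Real.cos x := Real.cos_le_cos_of_nonneg_of_le_pi hx.1
      (by linarith [Real.pi_pos]) hx.2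
    refine mul_le_mul_of_nonneg_right (Real.rpow_le_rpow hC.le h2 (by linarith)) ?_
    exact pow_nonneg (hC.le.trans h2) j
  have h₂ : ∫ x in φ..(Real.pi / 2), Real.cos x ^ k
      ≤ Real.cos φ ^ (k - j) * ∫ x in φ..(Real.pi / 2), Real.cos x ^ j := by
    rw [← intervalIntegral.integral_const_mul]
    refine intervalIntegral.integral_mono_on_of_le_Ioo hφ.le
      ((continuous_cos_rpow hk).intervalIntegrable _ _) (hpow.intervalIntegrable _ _)
      fun x hx => ?_
    rw [split x (hφ0.trans hx.1.le) hx.2]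
    have h2 : Real.cos x ≤ Real.cos φ := Real.cos_le_cos_of_nonneg_of_le_pi hφ0
      (by linarith [Real.pi_pos, hx.2]) hx.1.le
    have h3 : 0 ≤ Real.cos x :=
      (Real.cos_pos_of_mem_Ioo ⟨by linarith [Real.pi_pos, hx.1], hx.2⟩).le
    exact mul_le_mul_of_nonneg_right (Real.rpow_le_rpow h3 h2 (by linarith)) (pow_nonneg h3 j)
  have h₃ : 0 ≤ Real.cos φ ^ (k - j) := by positivity
  nlinarith

/-- The numerical inequality behind the case of small exponents; here `t = tan φ`, and `D` stands
for `1 / cos φ`. -/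
theorem tan_inequality {t w D : ℝ} (hk1 : 2 / 9 ≤ t ^ 2) (ht0 : 0 < t) (ht : t ^ 2 ≤ 1 / 3)
    (hw : w ^ 2 = 3) (hw0 : 0 < w) (hD : D ^ 2 = 1 + t ^ 2) :
    9 * t ^ 2 - 1 ≤ (1 + w * t) * (w + t) * (Real.pi / 3 - D + t) := by
  have hπ := Real.pi_gt_d4
  have hw1 : 1.732 ≤ w := by nlinarith
  have hw2 : w ≤ 1.7321 := by nlinarith
  have ht1 : 0.47 ≤ t := by nlinarith
  have ht2 : t ≤ 0.578 := by nlinarith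
  -- the tangent to the square root at `t ^ 2 = 1 / 3`
  have hDle : D ≤ w / 4 * (7 / 3 + t ^ 2) := by
    nlinarith [sq_nonneg (2 / 3 * w - D)]
  have h1 : 0.0366 + t - 0.4331 * t ^ 2 ≤ Real.pi / 3 - D + t := by nlinarith
  have h2 : 1.732 + 4 * t + 1.732 * t ^ 2 ≤ (1 + w * t) * (w + t) := by nlinarith
  have h3 : 0 ≤ 0.0366 + t - 0.4331 * t ^ 2 := by nlinarith
  have h4 : (1.732 + 4 * t + 1.732 * t ^ 2) * (0.0366 + t - 0.4331 * t ^ 2)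
      ≤ (1 + w * t) * (w + t) * (Real.pi / 3 - D + t) :=
    mul_le_mul h2 h1 h3 (by positivity)
  refine le_trans ?_ h4
  nlinarith [mul_nonneg (sub_nonneg.2 ht1) (sub_nonneg.2 ht2),
    mul_nonneg (mul_nonneg (sub_nonneg.2 ht1) (sub_nonneg.2 ht2)) ht0.le,
    mul_nonneg (mul_nonneg (sub_nonneg.2 ht1) (sub_nonneg.2 ht2)) (sq_nonneg t)]

/-- On `[0, φ]` the power of the cosine is at least its value at `φ`, and on `[φ, π/2]` Bernoulli's
inequality makes it linear in the cosine; the hypothesis compares the resulting bounds. -/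
theorem integral_cos_rpow_le_of_bernoulli (hk : 0 < k) (hk1 : k < 1) (hφ0 : 0 < φ)
    (hφ : φ < Real.pi / 2)
    (h : (1 - k) * (Real.pi / 2 - φ) + k / Real.cos φ * (1 - Real.sin φ) ≤ 2 * φ) :
    ∫ x in φ..(Real.pi / 2), Real.cos x ^ k ≤ 2 * ∫ x in (0 : ℝ)..φ, Real.cos x ^ k := by
  have hC : 0 < Real.cos φ := Real.cos_pos_of_mem_Ioo ⟨by linarith [Real.pi_pos], hφ⟩
  set C := Real.cos φ with hCdef
  set S := Real.sin φ with hSdef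
  have hCk : 0 < C ^ k := Real.rpow_pos_of_pos hC _
  have h₁ : C ^ k * φ ≤ ∫ x in (0 : ℝ)..φ, Real.cos x ^ k := by
    have : ∫ _ in (0 : ℝ)..φ, C ^ k = C ^ k * φ := by simp [mul_comm]
    rw [← this]
    refine intervalIntegral.integral_mono_on hφ0.le (_root_.intervalIntegrable_const)
      ((continuous_cos_rpow hk.le).intervalIntegrable _ _) fun x hx => ?_
    exact Real.rpow_le_rpow hC.le (Real.cos_le_cos_of_nonneg_of_le_pi hx.1
      (by linarith [Real.pi_pos]) hx.2) hk.le
  -- Bernoulli's inequality for `(cos x / cos φ) ^ k`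
  have h₂ : ∫ x in φ..(Real.pi / 2), Real.cos x ^ k
      ≤ C ^ k * ((1 - k) * (Real.pi / 2 - φ) + k / C * (1 - S)) := by
    have hint : ∫ x in φ..(Real.pi / 2), C ^ k * ((1 - k) + k / C * Real.cos x)
        = C ^ k * ((1 - k) * (Real.pi / 2 - φ) + k / C * (1 - S)) := by
      rw [intervalIntegral.integral_const_mul, intervalIntegral.integral_add
        (_root_.intervalIntegrable_const)
        (by exact (continuous_const.mul Real.continuous_cos).intervalIntegrable _ _),
        intervalIntegral.integral_const, intervalIntegral.integral_const_mul, integral_cos,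
        Real.sin_pi_div_two, smul_eq_mul]
      ring
    rw [← hint]
    refine intervalIntegral.integral_mono_on hφ.le
      ((continuous_cos_rpow hk.le).intervalIntegrable _ _)
      ((continuous_const.mul (continuous_const.add
        (continuous_const.mul Real.continuous_cos))).intervalIntegrable _ _) fun x hx => ?_
    have h0 : 0 ≤ Real.cos x :=
      Real.cos_nonneg_of_mem_Icc ⟨by linarith [Real.pi_pos, hx.1], hx.2⟩
    have hb := rpow_one_add_le_one_add_mul_self (s := Real.cos x / C - 1)
      (by have := div_nonneg h0 hC.le
          linarith) hk.le hk1.le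
    rw [add_sub_cancel, Real.div_rpow h0 hC.le, div_le_iff₀ hCk] at hb
    refine hb.trans (le_of_eq ?_)
    ring
  have h₃ := mul_le_mul_of_nonneg_left h hCk.le
  linarith

/-- The angle is estimated by comparison with its value `π / 6` for `k = 0`. This reduces the claim
to an inequality for `tan φ`, of which `k` is a rational function. -/
theorem bernoulli_condition (hk : 0 < k) (hk1 : k < 1) (hφ0 : 0 < φ)
    (hφ : φ < Real.pi / 2) (hs : Real.sin φ ^ 2 * (10 * k + 12) = k + 3) :
    (1 - k) * (Real.pi / 2 - φ) + k / Real.cos φ * (1 - Real.sin φ) ≤ 2 * φ := by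
  have hC : 0 < Real.cos φ := Real.cos_pos_of_mem_Ioo ⟨by linarith [Real.pi_pos], hφ⟩
  have hS : 0 < Real.sin φ := Real.sin_pos_of_pos_of_lt_pi hφ0 (by linarith [Real.pi_pos])
  set C := Real.cos φ with hCdef
  set S := Real.sin φ with hSdef
  have hSC : S ^ 2 + C ^ 2 = 1 := Real.sin_sq_add_cos_sq φ
  set w := √(3 : ℝ) with hw
  have hw2 : w ^ 2 = 3 := Real.sq_sqrt (by norm_num)
  have hw0 : 0 < w := Real.sqrt_pos.2 (by norm_num)
  have hS4 : S ^ 2 ≤ 1 / 4 := by nlinarith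
  have hφ6 : φ ≤ Real.pi / 6 := by
    by_contra! hcon
    have h6 : (1 / 2 : ℝ) < S := by
      rw [← Real.sin_pi_div_six]
      exact Real.sin_lt_sin_of_lt_of_le_pi_div_two (by linarith [Real.pi_pos]) hφ.le hcon
    nlinarith
  -- the deviation of `φ` from its value `π / 6` for `k = 0`
  have hδ : Real.pi / 6 - φ ≤ (C - w * S) / (w * C + S) := by
    have h6 := Real.le_tan (x := Real.pi / 6 - φ) (by linarith) (by linarith [Real.pi_pos])
    refine h6.trans (le_of_eq ?_)
    rw [Real.tan_eq_sin_div_cos, Real.sin_sub, Real.cos_sub, Real.sin_pi_div_six,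
      Real.cos_pi_div_six, ← hCdef, ← hSdef, ← hw]
    have : w * C + S ≠ 0 := by positivity
    have : w / 2 * C + 1 / 2 * S ≠ 0 := by positivity
    field_simp
  set t := S / C with ht
  have hSt : S = t * C := by
    rw [ht]
    field_simp
  have ht0 : 0 < t := div_pos hS hC
  have hC2 : C ^ 2 * (1 + t ^ 2) = 1 := by
    have h5 : (t * C) ^ 2 + C ^ 2 = 1 := by rwa [← hSt]
    linear_combination h5
  have htk : t ^ 2 * (9 * (k + 1)) = k + 3 := by
    have h5 : C ^ 2 * (t ^ 2 * (9 * (k + 1)) - (k + 3)) = 0 := by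
      rw [hSt] at hs
      linear_combination hs - (k + 3) * hC2
    rcases mul_eq_zero.1 h5 with h6 | h6
    · exact absurd h6 (by positivity)
    · linarith
  have ht1 : 2 / 9 ≤ t ^ 2 := by nlinarith
  have ht2 : t ^ 2 ≤ 1 / 3 := by nlinarith
  have hnum := tan_inequality (D := 1 / C) ht1 ht0 ht2 hw2 hw0 (by
    rw [div_pow, one_pow, div_eq_iff (by positivity)]
    linarith)
  have hδ' : Real.pi / 6 - φ ≤ (1 - w * t) / (w + t) := by
    refine hδ.trans (le_of_eq ?_)
    rw [hSt]
    field_simp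
  have hwt : 0 ≤ 1 - w * t := by
    have h5 : (w * t) ^ 2 ≤ 1 := by nlinarith
    nlinarith [mul_pos hw0 ht0]
  have e1 : k / C * (1 - S) = k * (1 / C - t) := by
    rw [ht]
    field_simp
  rw [e1]
  have hkt : k * (9 * t ^ 2 - 1) = 3 * (1 - w * t) * (1 + w * t) := by
    linear_combination htk + 3 * t ^ 2 * hw2
  have hpos : 0 < 9 * t ^ 2 - 1 := by linarith
  -- multiply the numerical inequality by `3 (1 - w t) / ((9 t² - 1) (w + t))`
  have h7 : 3 * ((1 - w * t) / (w + t)) ≤ k * (Real.pi / 3 - 1 / C + t) := by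
    have hwt' : 0 < w + t := by positivity
    have e2 : 3 * ((1 - w * t) / (w + t)) * ((9 * t ^ 2 - 1) * (w + t))
        = 3 * (1 - w * t) * (9 * t ^ 2 - 1) := by
      field_simp
    have e3 : k * (Real.pi / 3 - 1 / C + t) * ((9 * t ^ 2 - 1) * (w + t))
        = 3 * (1 - w * t) * ((1 + w * t) * (w + t) * (Real.pi / 3 - 1 / C + t)) := by
      linear_combination (Real.pi / 3 - 1 / C + t) * (w + t) * hkt
    refine le_of_mul_le_mul_right ?_ (mul_pos hpos hwt')
    rw [e2, e3]
    exact mul_le_mul_of_nonneg_left hnum (by positivity)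
  nlinarith [mul_nonneg hk.le (sub_nonneg.2 hφ6)]

/-- The angle `φ` with `sin² φ = (k + 3) / (10 k + 12)` cuts off at least a third of the integral
of `cos ^ k` over `[0, π/2]`. For `k = 0`, where `φ = π / 6`, this is an equality. -/
theorem integral_cos_rpow_le (hk : 0 < k) (hφ0 : 0 < φ) (hφ : φ < Real.pi / 2)
    (hs : Real.sin φ ^ 2 * (10 * k + 12) = k + 3) :
    ∫ x in (0 : ℝ)..(Real.pi / 2), Real.cos x ^ k ≤ 3 * ∫ x in (0 : ℝ)..φ, Real.cos x ^ k := by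
  have hS : 0 < Real.sin φ := Real.sin_pos_of_pos_of_lt_pi hφ0 (by linarith [Real.pi_pos])
  rw [← intervalIntegral.integral_add_adjacent_intervals
    ((continuous_cos_rpow hk.le).intervalIntegrable 0 φ)
    ((continuous_cos_rpow hk.le).intervalIntegrable φ (Real.pi / 2))]
  suffices h : ∫ x in φ..(Real.pi / 2), Real.cos x ^ k ≤ 2 * ∫ x in (0 : ℝ)..φ, Real.cos x ^ k by
    linarith
  rcases lt_or_ge k 1 with h1 | h1
  · exact integral_cos_rpow_le_of_bernoulli hk h1 hφ0 hφ (bernoulli_condition hk h1 hφ0 hφ hs)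
  rcases lt_or_ge k 3 with h3 | h3
  · refine integral_cos_rpow_le_of_pow (j := 1) (by exact_mod_cast h1) hφ0.le hφ ?_
    simp only [pow_one]
    rw [integral_cos, integral_cos, Real.sin_pi_div_two, Real.sin_zero]
    have h4 : 1 / 7 ≤ Real.sin φ ^ 2 := by nlinarith
    have h5 : 1 / 3 ≤ Real.sin φ := by nlinarith
    linarith
  · refine integral_cos_rpow_le_of_pow (j := 3) (by exact_mod_cast h3) hφ0.le hφ ?_
    rw [integral_cos_pow_three, integral_cos_pow_three, Real.sin_pi_div_two, Real.sin_zero]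
    have h4 : 1 / 10 ≤ Real.sin φ ^ 2 := by nlinarith
    have h5 : Real.sin φ ^ 2 ≤ 1 / 7 := by nlinarith
    have h6 : 3 / 10 ≤ Real.sin φ := by nlinarith
    nlinarith

end cosine

/-! ### The case of nonlinearities of the same size -/

section critical

variable {α p μ : ℝ} {N : ℕ}

/-- The normalised mass of a tail in terms of the angle `φ` given by `r ^ α = cos² φ`. -/
theorem tailMass_cos_rpow (hα : 0 < α) (hα' : α < 4) {φ : ℝ} (hφ0 : 0 ≤ φ) (hφ : φ ≤ Real.pi / 2) :
    tailMass α (Real.cos φ ^ (2 / α)) + 2 / α * (∫ x in (0 : ℝ)..φ, Real.cos x ^ (4 / α - 1))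
      = tailMass α 1 := by
  have hk : 0 < 4 / α - 1 := by
    rw [sub_pos, one_lt_div hα]
    exact hα'
  set F : ℝ → ℝ := fun φ => tailMass α (Real.cos φ ^ (2 / α))
    + 2 / α * (∫ x in (0 : ℝ)..φ, Real.cos x ^ (4 / α - 1)) with hF
  have hcc := continuous_cos_rpow hk.le
  have hId : ∀ φ, HasDerivAt (fun φ => ∫ x in (0 : ℝ)..φ, Real.cos x ^ (4 / α - 1))
      (Real.cos φ ^ (4 / α - 1)) φ := fun φ =>
    intervalIntegral.integral_hasDerivAt_right (hcc.intervalIntegrable _ _)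
      hcc.stronglyMeasurable.stronglyMeasurableAtFilter hcc.continuousAt
  have hFc : Continuous F :=
    ((continuous_tailMass hα).comp (continuous_cos_rpow (by positivity))).add
      (continuous_const.mul (continuous_iff_continuousAt.2 fun φ => (hId φ).continuousAt))
  have hd : ∀ x ∈ Ioo 0 (Real.pi / 2), HasDerivAt F 0 x := fun x hx => by
    have hC : 0 < Real.cos x := Real.cos_pos_of_mem_Ioo ⟨by linarith [hx.1], hx.2⟩
    have hS : 0 < Real.sin x :=
      Real.sin_pos_of_pos_of_lt_pi hx.1 (by linarith [hx.2, Real.pi_pos])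
    have hC1 : Real.cos x < 1 := by nlinarith [Real.sin_sq_add_cos_sq x]
    have hr0 : 0 < Real.cos x ^ (2 / α) := Real.rpow_pos_of_pos hC _
    have hr1 : Real.cos x ^ (2 / α) < 1 := Real.rpow_lt_one hC.le hC1 (by positivity)
    have hrα : √(1 - (Real.cos x ^ (2 / α)) ^ α) = Real.sin x := by
      rw [← Real.rpow_mul hC.le, div_mul_cancel₀ _ hα.ne', Real.rpow_two, ← Real.sin_sq,
        Real.sqrt_sq hS.le]
    have h1 := (hasDerivAt_tailMass hα hr0 hr1).comp x
      ((Real.hasDerivAt_cos x).rpow_const (p := 2 / α) (Or.inl hC.ne'))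
    refine (h1.add ((hId x).const_mul (2 / α))).congr_deriv ?_
    rw [hrα]
    have e : Real.cos x ^ (2 / α) * Real.cos x ^ (2 / α - 1) = Real.cos x ^ (4 / α - 1) := by
      rw [← Real.rpow_add hC]
      ring_nf
    rw [← e]
    field_simp
    ring
  have hint : interior (Icc 0 (Real.pi / 2)) = Ioo 0 (Real.pi / 2) := interior_Icc
  have hdiff : DifferentiableOn ℝ F (interior (Icc 0 (Real.pi / 2))) := fun x hx =>
    (hd x (hint ▸ hx)).differentiableAt.differentiableWithinAt
  have hmono := monotoneOn_of_deriv_nonneg (convex_Icc 0 (Real.pi / 2)) hFc.continuousOn hdiff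
    fun x hx => (hd x (hint ▸ hx)).deriv.ge
  have hanti := antitoneOn_of_deriv_nonpos (convex_Icc 0 (Real.pi / 2)) hFc.continuousOn hdiff
    fun x hx => (hd x (hint ▸ hx)).deriv.le
  have h0 : (0 : ℝ) ∈ Icc 0 (Real.pi / 2) := ⟨le_rfl, hφ0.trans hφ⟩
  have h : F φ = F 0 := le_antisymm (hanti h0 ⟨hφ0, hφ⟩ hφ0) (hmono h0 ⟨hφ0, hφ⟩ hφ0)
  simpa [hF] using h

/-- The common ratio `s / M` of the heights at the vertex and of the full solitons, for the stars of
tails that are critical for the constrained problem with `q = p / 2 + 1`; it depends neither on the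
mass nor on `M`. -/
noncomputable def criticalRatio (p : ℝ) (N : ℕ) : ℝ :=
  (2 * (N : ℝ) ^ 2 / (2 * (N : ℝ) ^ 2 + p)) ^ (1 / (p - 2))

theorem criticalRatio_pos (hp : 2 < p) (hN : 1 ≤ N) : 0 < criticalRatio p N := by
  have : (0 : ℝ) < N := by exact_mod_cast hN
  unfold criticalRatio
  positivity

theorem criticalRatio_rpow (hp : 2 < p) :
    criticalRatio p N ^ (p - 2) = 2 * (N : ℝ) ^ 2 / (2 * (N : ℝ) ^ 2 + p) := by
  have h : p - 2 ≠ 0 := by linarith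
  rw [criticalRatio, ← Real.rpow_mul (by positivity), one_div_mul_cancel h, Real.rpow_one]

theorem criticalRatio_lt_one (hp : 2 < p) : criticalRatio p N < 1 := by
  refine Real.rpow_lt_one (by positivity) ?_ (by
    have : 0 < p - 2 := by linarith
    positivity)
  rw [div_lt_one (by positivity)]
  linarith

theorem criticalRatio_mono (hp : 2 < p) : Monotone (criticalRatio p) := fun m n hmn => by
  have h : 0 < p - 2 := by linarith
  refine Real.rpow_le_rpow (by positivity) ?_ (by positivity)
  rw [div_le_div_iff₀ (by positivity) (by positivity)]
  have : (m : ℝ) ^ 2 ≤ (n : ℝ) ^ 2 := by gcongr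
  nlinarith

/-- At the critical ratio the point interaction cancels the boundary terms of the tails, so that the
energy is that of a soliton whose mass coefficient is that of the `N` tails. -/
theorem reducedEnergy_criticalRatio (hp : 2 < p) (hN : 1 ≤ N) {X : ℝ} (hX : 0 < X) :
    reducedEnergy p (p / 2 + 1) N μ X (criticalRatio p N * X) (criticalRatio p N * X)
      = heightEnergy p μ (N * tailMass (p - 2) (criticalRatio p N)) X := by
  have hN0 : (0 : ℝ) < N := by exact_mod_cast hN
  set r := criticalRatio p N with hr
  have hr0 : 0 < r := criticalRatio_pos hp hN
  have hα : 0 < p - 2 := by linarith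
  have hv : r ^ (p - 2) = 2 * (N : ℝ) ^ 2 / (2 * (N : ℝ) ^ 2 + p) := criticalRatio_rpow hp
  have hA := tailAction_eq hα r
  have hrv : r ^ (p / 2 + 1) = r ^ 2 * √(r ^ (p - 2)) := by
    rw [Real.sqrt_eq_rpow, ← Real.rpow_mul hr0.le, ← Real.rpow_two, ← Real.rpow_add hr0]
    ring_nf
  -- this identity determines the critical ratio
  have hcrit : N * √(2 / p) * √(1 - r ^ (p - 2)) = √(r ^ (p - 2)) := by
    have h1 : 1 - r ^ (p - 2) = p / (2 * (N : ℝ) ^ 2 + p) := by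
      rw [hv]
      field_simp
      ring
    rw [h1, hv, mul_assoc, ← Real.sqrt_mul (by positivity)]
    nth_rewrite 1 [← Real.sqrt_sq hN0.le]
    rw [← Real.sqrt_mul (by positivity)]
    congr 1
    field_simp
  have hY : (r * X) ^ (p / 2 + 1) = r ^ (p / 2 + 1) * X ^ (p / 2 + 1) :=
    Real.mul_rpow hr0.le hX.le
  have e : r * X / X = r := by field_simp
  rw [reducedEnergy, heightEnergy, calibration, e, hY, hrv, ← hcrit]
  have h4 : (p - 2 + 4) ≠ 0 := by linarith
  have hA' : tailAction (p - 2) r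
      = ((p - 2) * tailMass (p - 2) r + 2 * r ^ 2 * √(1 - r ^ (p - 2))) / (p - 2 + 4) := by
    rw [eq_div_iff h4, ← hA]
    ring
  rw [hA']
  have h5 : p / 2 + 1 ≠ 0 := by linarith
  have h6 : p + 2 ≠ 0 := by linarith
  have h7 : p ≠ 0 := by linarith
  rw [show p - 2 + 4 = p + 2 by ring, show p / 2 + 1 = (p + 2) / 2 by ring]
  field_simp
  ring

/-- The competitor is the star of tails at the critical ratio, whose height minimises the height
energy with its own mass coefficient. -/
theorem exists_isTailPair_le (hp : 2 < p) (hp' : p < 6) (hμ : 0 < μ) (hN : 1 ≤ N)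
    (h : N * tailMass (p - 2) (criticalRatio p N) ≤ 2 * tailMass (p - 2) 1) :
    ∃ M s, IsTailPair p N μ M s ∧ reducedEnergy p (p / 2 + 1) N μ M s s ≤ lineLevel p μ := by
  have hN0 : (0 : ℝ) < N := by exact_mod_cast hN
  have hr0 := criticalRatio_pos hp hN
  have hr1 := criticalRatio_lt_one (N := N) hp
  have hτ := tailMass_pos (α := p - 2) (by linarith) hr0 hr1.le
  have hτ1 := tailMass_pos (α := p - 2) (by linarith) one_pos le_rfl
  set K := N * tailMass (p - 2) (criticalRatio p N) with hK
  have hK0 : 0 < K := by positivity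
  have hX := criticalHeight_pos hp hμ hK0
  have hm := criticalHeight_pos (K := 2 * tailMass (p - 2) 1) hp hμ (by positivity)
  refine ⟨_, _, isTailPair_criticalHeight hp hp' hμ hN hr0 hr1.le, ?_⟩
  rw [reducedEnergy_criticalRatio hp hN (by rwa [← hK]), ← hK]
  refine (heightEnergy_critical_le hp hp' hμ hX (criticalHeight_rpow hp hp' hμ hK0) hm).trans ?_
  rw [lineLevel, heightEnergy, heightEnergy]
  have hc : 0 ≤ √(2 / p) * ((p - 2) / (p + 2)) := by
    have : 0 < p - 2 := by linarith
    positivity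
  have := mul_le_mul_of_nonneg_right (mul_le_mul_of_nonneg_left h hc)
    (Real.rpow_nonneg hm.le (p / 2 + 1))
  linarith

/-- Every star of tails has at least the energy given by the calibration whose height puts the
vertex at the critical ratio. -/
theorem IsTailPair.tailMass_le (hp : 2 < p) (hp' : p < 6) (hμ : 0 < μ) (hN : 1 ≤ N)
    {M s : ℝ} (ht : IsTailPair p N μ M s)
    (hle : reducedEnergy p (p / 2 + 1) N μ M s s ≤ lineLevel p μ) :
    N * tailMass (p - 2) (criticalRatio p N) ≤ 2 * tailMass (p - 2) 1 := by
  by_contra! hcon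
  have hr0 := criticalRatio_pos hp hN
  have hr1 := criticalRatio_lt_one (N := N) hp
  set r := criticalRatio p N with hr
  have hX : 0 < s / r := div_pos ht.pos hr0
  have e : r * (s / r) = s := by field_simp
  have h1 := ht.reducedEnergy_le (q := p / 2 + 1) hp hN
    ((le_div_iff₀ hr0).2 (mul_le_of_le_one_right ht.pos.le hr1.le))
  have h2 := reducedEnergy_criticalRatio (μ := μ) hp hN hX
  rw [← hr, e] at h2
  have h3 := lineLevel_le_heightEnergy hp hp' hμ hX
  have h4 : heightEnergy p μ (2 * tailMass (p - 2) 1) (s / r)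
      < heightEnergy p μ (N * tailMass (p - 2) r) (s / r) := by
    have hc : 0 < √(2 / p) * ((p - 2) / (p + 2)) := by
      have : 0 < p - 2 := by linarith
      positivity
    have := mul_lt_mul_of_pos_right (mul_lt_mul_of_pos_left hcon hc)
      (Real.rpow_pos_of_pos hX (p / 2 + 1))
    rw [heightEnergy, heightEnergy]
    linarith
  linarith

/-- On the star with three half-lines the criterion holds. -/
theorem three_mul_tailMass_criticalRatio_le (hp : 2 < p) (hp' : p < 6) :
    3 * tailMass (p - 2) (criticalRatio p 3) ≤ 2 * tailMass (p - 2) 1 := by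
  have hα : 0 < p - 2 := by linarith
  have hα' : p - 2 < 4 := by linarith
  have hk : 0 < 4 / (p - 2) - 1 := by
    rw [sub_pos, one_lt_div hα]
    exact hα'
  set v : ℝ := 18 / (18 + p) with hv
  have hv0 : 0 < v := by positivity
  have hv1 : v < 1 := by
    rw [hv, div_lt_one (by positivity)]
    linarith
  have hw0 : 0 < √v := Real.sqrt_pos.2 hv0
  have hw1 : √v < 1 := by rwa [Real.sqrt_lt' one_pos, one_pow]
  have hcos : Real.cos (Real.arccos √v) = √v := Real.cos_arccos (by linarith) hw1.le
  have hφ0 : 0 < Real.arccos √v := Real.arccos_pos.2 hw1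
  have hφ : Real.arccos √v < Real.pi / 2 := Real.arccos_lt_pi_div_two.2 hw0
  have hr : criticalRatio p 3 = Real.cos (Real.arccos √v) ^ (2 / (p - 2)) := by
    rw [hcos, Real.sqrt_eq_rpow, ← Real.rpow_mul hv0.le, criticalRatio]
    congr 1
    · rw [hv]
      norm_num
    · ring
  have hs : Real.sin (Real.arccos √v) ^ 2 * (10 * (4 / (p - 2) - 1) + 12)
      = 4 / (p - 2) - 1 + 3 := by
    rw [Real.sin_sq, hcos, Real.sq_sqrt hv0.le, hv]
    field_simp
    ring
  have h1 := tailMass_cos_rpow hα hα' hφ0.le hφ.le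
  have h2 := tailMass_cos_rpow hα hα' Real.pi_div_two_pos.le le_rfl
  rw [Real.cos_pi_div_two, Real.zero_rpow (by positivity), tailMass_zero, zero_add] at h2
  rw [← hr] at h1
  have h3 := mul_le_mul_of_nonneg_left (integral_cos_rpow_le hk hφ0 hφ hs)
    (show 0 ≤ 2 / (p - 2) by positivity)
  linarith

/-- The criterion is the harder to satisfy, the more half-lines there are. -/
theorem monotone_mul_tailMass_criticalRatio (hp : 2 < p) {m n : ℕ} (hm : 1 ≤ m) (hmn : m ≤ n) :
    m * tailMass (p - 2) (criticalRatio p m) ≤ n * tailMass (p - 2) (criticalRatio p n) := by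
  have hα : 0 < p - 2 := by linarith
  have h0 := criticalRatio_pos hp hm
  have h1 := tailMass_pos hα h0 (criticalRatio_lt_one hp).le
  have h2 := (tailMass_strictMonoOn hα).monotoneOn ⟨h0.le, (criticalRatio_lt_one hp).le⟩
    ⟨(criticalRatio_pos hp (hm.trans hmn)).le, (criticalRatio_lt_one hp).le⟩
    (criticalRatio_mono hp hmn)
  exact mul_le_mul (by exact_mod_cast hmn) h2 h1.le (by positivity)

/-- The criterion fails for large `N`, since `τ` is bounded below along the increasing critical
ratios. -/
theorem exists_starThreshold (hp : 2 < p) (hp' : p < 6) : ∃ Ns : ℕ, 3 ≤ Ns ∧ ∀ N : ℕ, 1 ≤ N →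
    (N * tailMass (p - 2) (criticalRatio p N) ≤ 2 * tailMass (p - 2) 1 ↔ N ≤ Ns) := by
  classical
  have hα : 0 < p - 2 := by linarith
  have h1 := tailMass_pos hα (criticalRatio_pos hp le_rfl) (criticalRatio_lt_one hp).le
  have hex : ∃ n : ℕ, 1 ≤ n ∧
      2 * tailMass (p - 2) 1 < n * tailMass (p - 2) (criticalRatio p n) := by
    obtain ⟨n, hn⟩ := exists_nat_gt (2 * tailMass (p - 2) 1 / tailMass (p - 2) (criticalRatio p 1))
    rw [div_lt_iff₀ h1] at hn
    refine ⟨n + 1, by lia, ?_⟩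
    have h2 := (tailMass_strictMonoOn hα).monotoneOn
      ⟨(criticalRatio_pos hp le_rfl).le, (criticalRatio_lt_one hp).le⟩
      ⟨(criticalRatio_pos hp (show 1 ≤ n + 1 by lia)).le, (criticalRatio_lt_one hp).le⟩
      (criticalRatio_mono hp (show 1 ≤ n + 1 by lia))
    have h3 : (n : ℝ) * tailMass (p - 2) (criticalRatio p 1)
        ≤ (n + 1 : ℕ) * tailMass (p - 2) (criticalRatio p (n + 1)) :=
      mul_le_mul (by push_cast; linarith) h2 h1.le (by positivity)
    linarith
  obtain ⟨hn1, hn⟩ := Nat.find_spec hex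
  have hmin : ∀ N, 1 ≤ N → N < Nat.find hex →
      N * tailMass (p - 2) (criticalRatio p N) ≤ 2 * tailMass (p - 2) 1 := fun N hN hlt => by
    by_contra! hcon
    exact Nat.find_min hex hlt ⟨hN, hcon⟩
  have h3 : 3 < Nat.find hex := by
    by_contra! hle
    have h4 := monotone_mul_tailMass_criticalRatio hp hn1 hle
    have h5 := three_mul_tailMass_criticalRatio_le hp hp'
    push_cast at h4
    linarith
  refine ⟨Nat.find hex - 1, by lia, fun N hN => ⟨fun h => ?_, fun h => hmin N hN (by lia)⟩⟩
  by_contra! hcon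
  have h4 := monotone_mul_tailMass_criticalRatio hp hn1 (show Nat.find hex ≤ N by lia)
  linarith

end critical

theorem mainTheorem4 (p q : ℝ) (hp : 2 < p) (hp' : p < 6) (hq : 2 < q) (hq' : q < 4) :
    (q < p / 2 + 1 → ∀ N : ℕ, 3 ≤ N → ∃ μs : ℝ, 0 < μs ∧
      (∀ μ : ℝ, 0 < μ → μ ≤ μs → ∃ u : StarH1 N, IsGroundState p q μ u) ∧
      (∀ μ : ℝ, μs < μ → ¬ ∃ u : StarH1 N, IsGroundState p q μ u)) ∧
    (p / 2 + 1 < q → ∀ N : ℕ, 3 ≤ N → ∃ μs : ℝ, 0 < μs ∧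
      (∀ μ : ℝ, 0 < μ → μ < μs → ¬ ∃ u : StarH1 N, IsGroundState p q μ u) ∧
      (∀ μ : ℝ, μs ≤ μ → ∃ u : StarH1 N, IsGroundState p q μ u)) ∧
    (q = p / 2 + 1 → ∃ Ns : ℕ, 3 ≤ Ns ∧ ∀ N : ℕ, 1 ≤ N →
      (N ≤ Ns → ∀ μ : ℝ, 0 < μ → ∃ u : StarH1 N, IsGroundState p q μ u) ∧
      (Ns < N → ∀ μ : ℝ, 0 < μ → ¬ ∃ u : StarH1 N, IsGroundState p q μ u)) := by
  refine ⟨fun h N hN => exists_massThreshold_of_lt hp hp' hq hq' h hN,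
    fun h N hN => exists_massThreshold_of_gt hp hp' hq hq' h hN, ?_⟩
  rintro rfl
  obtain ⟨Ns, hNs, h⟩ := exists_starThreshold hp hp'
  refine ⟨Ns, hNs, fun N hN => ⟨fun hle μ hμ => ?_, fun hlt μ hμ hex => ?_⟩⟩
  · obtain ⟨M, s, ht, hE⟩ := exists_isTailPair_le hp hp' hμ hN ((h N hN).2 hle)
    exact exists_isGroundState_of_isTailPair hp hp' hq hq' hμ hN ht hE
  · obtain ⟨M, s, ht, hE⟩ :=
      (exists_isGroundState_iff hp hp' hq hq' hμ (show 2 ≤ N by lia)).1 hex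
    have := (h N hN).1 (ht.tailMass_le hp hp' hμ hN hE)
    lia
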